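/- Setting. Let $\mathbb T=S^1$ and let $\pi:M\to\Sigma$ be a smooth principal $\mathbb T$-bundle, where $\Sigma$ is a compact oriented surface without boundary and $M$ is a closed $3$-manifold. Let $R$ be the vector field generating the circle action ($\theta\in[0,2\pi)$), $\mathcal L_R$ the Lie derivative, $K=\frac1{2\pi}\int_0^{2\pi} r_\theta^*\,d\theta$ the averaging operator on functions and forms. A form is horizontal if its contraction with $R$ vanishes, and basic if it is moreover $\mathbb T$-invariant; basic forms on $M$ are identified with forms on $\Sigma$, and $\mathbb T$-invariant smooth functions on $M$ with $C^\infty(\Sigma)$. Let $\mathfrak g$ be a finite-dimensional real Lie algebra with a nondegenerate symmetric ad-invariant bilinear form $\langle\cdot,\cdot\rangle$ (for instance the Lie algebra of a compact Lie group), and put $\langle\!\langle\cdot,\cdot\rangle\!\rangle=K\langle\cdot,\cdot\rangle$. Fix a sign $\varepsilon\in\{1,-1\}$. The extended algebra is $\tilde{\mathfrak G}=C^\infty(\Sigma)\oplus C^\infty(M,\mathfrak g)\oplus C^\infty(\Sigma)$ with bracket $$[(x_1,\xi_1,y_1),(x_2,\xi_2,y_2)]=\bigl(0,\ [\xi_1,\xi_2]-x_1\mathcal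 L_R\xi_2+x_2\mathcal L_R\xi_1,\ \varepsilon\langle\!\langle\xi_1,\mathcal L_R\xi_2\rangle\!\rangle\bigr)$$ and pairing $$\langle\!\langle\!\langle(x_1,\xi_1,y_1),(x_2,\xi_2,y_2)\rangle\!\rangle\!\rangle=\langle\!\langle\xi_1,\xi_2\rangle\!\rangle+\varepsilon(x_1y_2+y_1x_2)\in C^\infty(\Sigma).$$ Let $\tilde{\mathcal A}$ be the affine space of triples $\tilde\ell=(\kappa,a,b)$ of smooth $1$-forms on $M$, where $\kappa$ is a connection form of $M\to\Sigma$ ($\mathbb T$-invariant with $\kappa(R)=1$), $a$ is $\mathfrak g$-valued and horizontal, and $b$ is real-valued and basic. An element $X=(x,\xi,y)\in\tilde{\mathfrak G}$ acts on $\tilde{\mathcal A}$ by the vector field $$V_X(\tilde\ell)=d_{\tilde\ell}X=dX+[\tilde\ell,X]=\bigl(dx,\ d\xi+[a,\xi]-\kappa\,\mathcal L_R\xi+x\,\mathcal L_R a,\ dy+\varepsilon\langle\!\langle a,\mathcal L_R\xi\rangle\!\rangle\bigr).$$ Let $\Omega=\frac12\int_\Sigma\langle\!\langle\!\langle\delta\tilde\ell\wedge\delta\tilde\ell\rangle\!\rangle\!\rangle$,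 that is, for tangent vectors $v,w$, $$\Omega(v,w)=\tfrac12\int_\Sigma\bigl(\langle\!\langle\!\langle v\wedge w\rangle\!\rangle\!\rangle-\langle\!\langle\!\langle w\wedge v\rangle\!\rangle\!\rangle\bigr).$$ Proposition. The space $\tilde{\mathfrak G}$ is a Lie algebra in which the last summand is central, and $X\mapsto V_X$ is a linear action of it on $\tilde{\mathcal A}$: each $V_X$ is tangent to $\tilde{\mathcal A}$ and $[V_X,V_Y]=V_{[X,Y]}$. The form $\Omega$ is a symplectic form on $\tilde{\mathcal A}$ (a closed, weakly nondegenerate $2$-form), and it is $\tilde{\mathfrak G}$-invariant: $\mathcal L_{V_X}\Omega=0$ for all $X$. The action is Hamiltonian with moment map the curvature $$\mu_{\tilde\ell}=F_{\tilde\ell}:=d\tilde\ell+\tfrac12[\tilde\ell\wedge\tilde\ell]=\bigl(d\kappa,\ F_a-\kappa\wedge\mathcal L_Ra,\ db+\tfrac{\varepsilon}{2}\langle\!\langle a\wedge\mathcal L_Ra\rangle\!\rangle\bigr),\qquad F_a=da+\tfrac12[a\wedge a],$$ regarded as the element $X\mapsto\int_\Sigma\langle\!\langle\!\langle F_{\tilde\ell},X\rangle\!\rangle\!\rangle$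 of the dual of $\tilde{\mathfrak G}$. That is, writing $\mu_X(\tilde\ell)=\int_\Sigma\langle\!\langle\!\langle F_{\tilde\ell},X\rangle\!\rangle\!\rangle$, the map $X\mapsto\mu_X$ is linear, $\delta\mu_X=-\iota_{V_X}\Omega$, and $V_X\mu_Y=\mu_{[X,Y]}$ for all $X,Y\in\tilde{\mathfrak G}$. The three components of $F_{\tilde\ell}$ are smooth horizontal $2$-forms on $M$; the first and the third are basic. -/

import Mathlib

open scoped Manifold ContDiff Topology

noncomputable section

namespace ExtendedConnection

/-! ### Lie algebras with a norm

A real Lie algebra together with a norm on its underlying vector space. The norm is only used to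
speak of derivatives and integrals of functions with values in a finite dimensional Lie algebra;
no compatibility with the bracket is required. -/

/-- A Lie ring whose additive group is normed. -/
class NormedLieRing (L : Type*) extends NormedAddCommGroup L, LieRing L

/-- A real Lie algebra whose underlying vector space is normed. -/
class NormedLieAlgebra (L : Type*) [NormedLieRing L] extends NormedSpace ℝ L, LieAlgebra ℝ L

/-- The model space of the surface. -/
abbrev E2 : Type := EuclideanSpace ℝ (Fin 2)

/-- The model space of the three-manifold. -/
abbrev E3 : Type := EuclideanSpace ℝ (Fin 3)

/-! ### Differential forms of degree at most two on a three-manifold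

In Mathlib the tangent space `TangentSpace (𝓡 3) m` is by definition the model space `E3`
(through the preferred chart at `m`). -/

/-- One-forms with values in `F` (no smoothness yet). -/
abbrev Form1 (M F : Type*) [NormedAddCommGroup F] [NormedSpace ℝ F] : Type _ :=
  M → (E3 →L[ℝ] F)

/-- Two-forms with values in `F`, as functions of two tangent vectors
(bilinearity, alternation and smoothness are in `IsSmoothForm2`). -/
abbrev Form2 (M F : Type*) : Type _ := M → E3 → E3 → F

section Forms

variable {M : Type*} [TopologicalSpace M] [ChartedSpace E3 M]
variable {F : Type*} [NormedAddCommGroup F] [NormedSpace ℝ F]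

/-- A smooth one-form: a smooth section of `Hom(TM, F)`. -/
def IsSmoothForm1 [IsManifold (𝓡 3) ∞ M] (α : Form1 M F) : Prop :=
  ContMDiff (𝓡 3) ((𝓡 3).prod 𝓘(ℝ, E3 →L[ℝ] F)) ∞
    (fun m => Bundle.TotalSpace.mk' (E3 →L[ℝ] F)
      (E := fun m : M => TangentSpace (𝓡 3) m →L[ℝ] F) m (α m))

/-- A smooth two-form: an alternating smooth section of `Hom(TM, Hom(TM, F))`. -/
def IsSmoothForm2 [IsManifold (𝓡 3) ∞ M] (β : Form2 M F) : Prop :=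
  ∃ η : M → (E3 →L[ℝ] E3 →L[ℝ] F),
    ContMDiff (𝓡 3) ((𝓡 3).prod 𝓘(ℝ, E3 →L[ℝ] E3 →L[ℝ] F)) ∞
      (fun m => Bundle.TotalSpace.mk' (E3 →L[ℝ] E3 →L[ℝ] F)
        (E := fun m : M => TangentSpace (𝓡 3) m →L[ℝ] TangentSpace (𝓡 3) m →L[ℝ] F) m (η m)) ∧
    (∀ m u v, β m u v = η m u v) ∧ ∀ m u, β m u u = 0

/-- The differential of a function. -/
def d0 (f : M → F) : Form1 M F := fun m => (mfderiv (𝓡 3) 𝓘(ℝ, F) f m : E3 →L[ℝ] F)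

/-- The expression of a one-form in the preferred chart at `m`. -/
def chartRep (α : Form1 M F) (m : M) (y : E3) : E3 →L[ℝ] F :=
  (α ((extChartAt (𝓡 3) m).symm y)).comp
    (mfderiv 𝓘(ℝ, E3) (𝓡 3) (extChartAt (𝓡 3) m).symm y : E3 →L[ℝ] E3)

/-- The exterior derivative of a one-form, computed at `m` in the preferred chart at `m`:
`dα (u, v) = ∂_u (α v) - ∂_v (α u)`. -/
def d1 (α : Form1 M F) : Form2 M F := fun m u v =>
  let φ : M → E3 := extChartAt (𝓡 3) m
  let u' : E3 := (mfderiv (𝓡 3) 𝓘(ℝ, E3) φ m : E3 →L[ℝ] E3) u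
  let v' : E3 := (mfderiv (𝓡 3) 𝓘(ℝ, E3) φ m : E3 →L[ℝ] E3) v
  fderiv ℝ (chartRep α m) (φ m) u' v' - fderiv ℝ (chartRep α m) (φ m) v' u'

/-- The wedge product of real-valued one-forms. -/
def wedge (α β : Form1 M ℝ) : Form2 M ℝ := fun m u v => α m u * β m v - α m v * β m u

end Forms

/-! ### The circle action -/

section Circle

variable {M : Type*} [TopologicalSpace M] [ChartedSpace E3 M] [MulAction Circle M]
variable {F : Type*} [NormedAddCommGroup F] [NormedSpace ℝ F]

/-- The action of `exp (i θ)`. -/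
def rot (θ : ℝ) (m : M) : M := Circle.exp θ • m

/-- The differential of `rot θ`. -/
def dRot (θ : ℝ) (m : M) : E3 →L[ℝ] E3 := mfderiv (𝓡 3) (𝓡 3) (rot θ) m

/-- The vector field `R` generating the circle action. -/
def genR (m : M) : E3 :=
  (mfderiv 𝓘(ℝ, ℝ) (𝓡 3) (fun θ : ℝ => rot θ m) 0 : ℝ →L[ℝ] E3) 1

/-- Pull-back of one-forms under `rot θ`. -/
def pull1 (θ : ℝ) (α : Form1 M F) : Form1 M F := fun m => (α (rot θ m)).comp (dRot θ m)

/-- Pull-back of two-forms under `rot θ`. -/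
def pull2 (θ : ℝ) (β : Form2 M F) : Form2 M F :=
  fun m u v => β (rot θ m) (dRot θ m u) (dRot θ m v)

/-- The Lie derivative of a function along `R`. -/
def lie0 (f : M → F) : M → F := fun m => deriv (fun θ : ℝ => f (rot θ m)) 0

/-- The Lie derivative of a one-form along `R`. -/
def lie1 (α : Form1 M F) : Form1 M F := fun m => deriv (fun θ : ℝ => pull1 θ α m) 0

/-- The averaging operator `K` on functions. -/
def avg0 (f : M → ℝ) : M → ℝ :=
  fun m => (2 * Real.pi)⁻¹ * ∫ θ in (0 : ℝ)..(2 * Real.pi), f (rot θ m)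

/-- The averaging operator `K` on one-forms. -/
def avg1 (α : Form1 M ℝ) : Form1 M ℝ :=
  fun m => (2 * Real.pi)⁻¹ • ∫ θ in (0 : ℝ)..(2 * Real.pi), pull1 θ α m

/-- The averaging operator `K` on two-forms. -/
def avg2 (β : Form2 M ℝ) : Form2 M ℝ :=
  fun m u v => (2 * Real.pi)⁻¹ * ∫ θ in (0 : ℝ)..(2 * Real.pi), pull2 θ β m u v

def IsHorizontal1 (α : Form1 M F) : Prop := ∀ m, α m (genR m) = 0

def IsInvariant1 (α : Form1 M F) : Prop := ∀ θ, pull1 θ α = α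

def IsHorizontal2 (β : Form2 M F) : Prop := ∀ m v, β m (genR m) v = 0

def IsInvariant2 (β : Form2 M F) : Prop := ∀ θ, pull2 θ β = β

end Circle

/-! ### Circle bundles over oriented surfaces and integration -/

section Surface

variable {S : Type*} [TopologicalSpace S] [ChartedSpace E2 S]

/-- The chosen atlas is oriented: the coordinate changes between preferred charts have positive
Jacobian determinant. -/
def IsOrientedAtlas (S : Type*) [TopologicalSpace S] [ChartedSpace E2 S] : Prop :=
  ∀ p q : S, ∀ y ∈ ((extChartAt (𝓡 2) p).symm.trans (extChartAt (𝓡 2) q)).source,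
    0 < (fderiv ℝ (extChartAt (𝓡 2) q ∘ (extChartAt (𝓡 2) p).symm) y : E2 →L[ℝ] E2).det

/-- A smooth partition of unity subordinate to the domains of the preferred charts. -/
def chartPartition (S : Type*) [TopologicalSpace S] [ChartedSpace E2 S] [IsManifold (𝓡 2) ∞ S]
    [T2Space S] [CompactSpace S] : SmoothPartitionOfUnity S (𝓡 2) S Set.univ :=
  (SmoothPartitionOfUnity.exists_isSubordinate_chartAt_source (𝓡 2) S).choose

/-- The integral of a two-form over a compact surface with an oriented atlas: the sum over the
charts of the integrals of the coordinate expressions, cut off by a partition of unity. -/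
def integral [IsManifold (𝓡 2) ∞ S] [T2Space S] [CompactSpace S] (η : S → E2 → E2 → ℝ) : ℝ :=
  ∑ᶠ i : S, ∫ y in (extChartAt (𝓡 2) i).target,
    let p : S := (extChartAt (𝓡 2) i).symm y
    let D : E2 →L[ℝ] E2 := mfderiv 𝓘(ℝ, E2) (𝓡 2) (extChartAt (𝓡 2) i).symm y
    chartPartition S i p *
      η p (D (EuclideanSpace.single 0 1)) (D (EuclideanSpace.single 1 1))

variable {M : Type*} [TopologicalSpace M] [ChartedSpace E3 M]

/-- `π : M → S` is a smooth principal circle bundle: `π` is smooth, the action of the circle is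
smooth, and near every point of `S` there is an equivariant smooth trivialization
`m ↦ (π m, τ m)` with inverse `(p, t) ↦ t • s p`. -/
structure IsPrincipalCircleBundle [MulAction Circle M] (π : M → S) : Prop where
  smooth : ContMDiff (𝓡 3) (𝓡 2) ∞ π
  smooth_action : ContMDiffSMul (𝓡 1) (𝓡 3) ∞ Circle M
  map_smul : ∀ (t : Circle) (m : M), π (t • m) = π m
  locally_trivial : ∀ p : S, ∃ U : Set S, IsOpen U ∧ p ∈ U ∧
    ∃ (s : S → M) (τ : M → Circle),
      ContMDiffOn (𝓡 2) (𝓡 3) ∞ s U ∧ ContMDiffOn (𝓡 3) (𝓡 1) ∞ τ (π ⁻¹' U) ∧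
      (∀ q ∈ U, π (s q) = q) ∧
      (∀ m ∈ π ⁻¹' U, τ m • s (π m) = m) ∧
      (∀ m ∈ π ⁻¹' U, ∀ t : Circle, τ (t • m) = t * τ m)

/-- The two-form on `S` whose pull-back along `π` is the given basic two-form on `M`. -/
def descend (π : M → S) (β : Form2 M ℝ) : S → E2 → E2 → ℝ :=
  Classical.epsilon fun η : S → E2 → E2 → ℝ => ∀ (m : M) (u v : E3),
    β m u v = η (π m) ((mfderiv (𝓡 3) (𝓡 2) π m : E3 →L[ℝ] E2) u)
      ((mfderiv (𝓡 3) (𝓡 2) π m : E3 →L[ℝ] E2) v)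

/-- The integral over `S` of a basic two-form on `M`. -/
def surfaceIntegral [IsManifold (𝓡 2) ∞ S] [T2Space S] [CompactSpace S] (π : M → S)
    (β : Form2 M ℝ) : ℝ :=
  integral (descend π β)

end Surface

/-! ### The extended gauge algebra and extended connections

The sign `ε = ±1` is the sign of the central cocycle `ε ⟪ξ₁, L_R ξ₂⟫` and, at the same time, of the
off-diagonal terms `ε (x₁ y₂ + y₁ x₂)` of the invariant pairing. -/

section Extended

variable (M 𝔤 : Type*) [NormedLieRing 𝔤] [NormedLieAlgebra 𝔤]

/-- Triples `(x, ξ, y)` (no smoothness or invariance yet). -/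
abbrev Gauge : Type _ := (M → ℝ) × (M → 𝔤) × (M → ℝ)

/-- Triples of one-forms `(κ, a, b)` (no conditions yet). -/
abbrev Triple : Type _ := Form1 M ℝ × Form1 M 𝔤 × Form1 M ℝ

/-- Triples of two-forms. -/
abbrev Triple2 : Type _ := Form2 M ℝ × Form2 M 𝔤 × Form2 M ℝ

variable {M 𝔤} [FiniteDimensional ℝ 𝔤]
variable [TopologicalSpace M] [ChartedSpace E3 M] [MulAction Circle M]

/-- The extended gauge algebra: `x` and `y` are circle-invariant smooth functions on `M`, that is,
smooth functions on the base surface, and `ξ` is a smooth `𝔤`-valued function on `M`. -/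
def gaugeAlgebra (M 𝔤 : Type*) [NormedLieRing 𝔤] [NormedLieAlgebra 𝔤]
    [TopologicalSpace M] [ChartedSpace E3 M] [MulAction Circle M] : Set (Gauge M 𝔤) :=
  {X | ContMDiff (𝓡 3) 𝓘(ℝ, ℝ) ∞ X.1 ∧ (∀ (t : Circle) (m : M), X.1 (t • m) = X.1 m) ∧
    ContMDiff (𝓡 3) 𝓘(ℝ, 𝔤) ∞ X.2.1 ∧
    ContMDiff (𝓡 3) 𝓘(ℝ, ℝ) ∞ X.2.2 ∧ ∀ (t : Circle) (m : M), X.2.2 (t • m) = X.2.2 m}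

/-- The space of extended connections `(κ, a, b)`: `κ` is a connection form of the circle bundle,
`a` is horizontal and `b` is basic. -/
def connections (M 𝔤 : Type*) [NormedLieRing 𝔤] [NormedLieAlgebra 𝔤] [TopologicalSpace M]
    [ChartedSpace E3 M] [IsManifold (𝓡 3) ∞ M] [MulAction Circle M] : Set (Triple M 𝔤) :=
  {l | (IsSmoothForm1 l.1 ∧ IsInvariant1 l.1 ∧ ∀ m, l.1 m (genR m) = 1) ∧
    (IsSmoothForm1 l.2.1 ∧ IsHorizontal1 l.2.1) ∧
    IsSmoothForm1 l.2.2 ∧ IsInvariant1 l.2.2 ∧ IsHorizontal1 l.2.2}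

/-- The tangent space (the space of translations) of the affine space of extended connections. -/
def variations (M 𝔤 : Type*) [NormedLieRing 𝔤] [NormedLieAlgebra 𝔤] [TopologicalSpace M]
    [ChartedSpace E3 M] [IsManifold (𝓡 3) ∞ M] [MulAction Circle M] : Set (Triple M 𝔤) :=
  {v | (IsSmoothForm1 v.1 ∧ IsInvariant1 v.1 ∧ IsHorizontal1 v.1) ∧
    (IsSmoothForm1 v.2.1 ∧ IsHorizontal1 v.2.1) ∧
    IsSmoothForm1 v.2.2 ∧ IsInvariant1 v.2.2 ∧ IsHorizontal1 v.2.2}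

variable (ε : ℝ) (B : LinearMap.BilinForm ℝ 𝔤)

/-- The bracket of the extended gauge algebra. -/
def bracket (X Y : Gauge M 𝔤) : Gauge M 𝔤 :=
  (0,
    fun m => ⁅X.2.1 m, Y.2.1 m⁆ - X.1 m • lie0 Y.2.1 m + Y.1 m • lie0 X.2.1 m,
    fun m => ε * avg0 (fun m => B (X.2.1 m) (lie0 Y.2.1 m)) m)

/-- The one-form `u ↦ ⁅a u, ξ⁆ - κ u • L_R ξ + x • (L_R a) u`. -/
def brGauge (l : Triple M 𝔤) (X : Gauge M 𝔤) : Form1 M 𝔤 := fun m =>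
  LinearMap.toContinuousLinearMap
    { toFun := fun u : E3 =>
        ⁅l.2.1 m u, X.2.1 m⁆ - l.1 m u • lie0 X.2.1 m + X.1 m • lie1 l.2.1 m u
      map_add' := fun u v => by
        simp only [map_add, add_lie, add_smul, smul_add]; abel
      map_smul' := fun c u => by
        simp only [map_smul, smul_lie, smul_eq_mul, mul_smul, RingHom.id_apply, smul_sub, smul_add]
        rw [smul_comm (X.1 m) c] }

/-- The one-form `⟨a, ξ⟩`. -/
def pairForm1 (a : Form1 M 𝔤) (ξ : M → 𝔤) : Form1 M ℝ := fun m =>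
  LinearMap.toContinuousLinearMap
    { toFun := fun u : E3 => B (a m u) (ξ m)
      map_add' := fun u v => by simp
      map_smul' := fun c u => by simp }

/-- The bracket `[l, X]` of a triple of one-forms with a gauge parameter, obtained by applying
the bracket of the extended gauge algebra to the values of `l`. -/
def formBracket1 (l : Triple M 𝔤) (X : Gauge M 𝔤) : Triple M 𝔤 :=
  (0, brGauge l X, ε • avg1 (pairForm1 B l.2.1 (lie0 X.2.1)))

/-- The differential of a gauge parameter. -/
def dGauge (X : Gauge M 𝔤) : Triple M 𝔤 := (d0 X.1, d0 X.2.1, d0 X.2.2)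

/-- The infinitesimal gauge action `d_l X = dX + [l, X]`, as a vector field in `l`. -/
def act (X : Gauge M 𝔤) (l : Triple M 𝔤) : Triple M 𝔤 := dGauge X + formBracket1 ε B l X

/-- The two-form `⟨α ∧ β⟩`. -/
def pairWedge (α β : Form1 M 𝔤) : Form2 M ℝ :=
  fun m u v => B (α m u) (β m v) - B (α m v) (β m u)

/-- The two-form `[a ∧ a']`. -/
def lieWedge (a a' : Form1 M 𝔤) : Form2 M 𝔤 := fun m u v => ⁅a m u, a' m v⁆ - ⁅a m v, a' m u⁆

/-- The two-form `κ ∧ a`. -/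
def smulWedge (κ : Form1 M ℝ) (a : Form1 M 𝔤) : Form2 M 𝔤 :=
  fun m u v => κ m u • a m v - κ m v • a m u

/-- The bracket `[l ∧ l']` of triples of one-forms. -/
def formBracket2 (l l' : Triple M 𝔤) : Triple2 M 𝔤 :=
  (0,
    lieWedge l.2.1 l'.2.1 - smulWedge l.1 (lie1 l'.2.1) - smulWedge l'.1 (lie1 l.2.1),
    ε • avg2 (pairWedge B l.2.1 (lie1 l'.2.1)))

/-- The exterior derivative of a triple of one-forms. -/
def dTriple (l : Triple M 𝔤) : Triple2 M 𝔤 := (d1 l.1, d1 l.2.1, d1 l.2.2)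

/-- The curvature `F_l = dl + ½ [l ∧ l]`. -/
def curvature (l : Triple M 𝔤) : Triple2 M 𝔤 := dTriple l + (1 / 2 : ℝ) • formBracket2 ε B l l

/-- The curvature `F_a = da + ½ [a ∧ a]` of a `𝔤`-valued one-form. -/
def curvatureG (a : Form1 M 𝔤) : Form2 M 𝔤 := d1 a + (1 / 2 : ℝ) • lieWedge a a

/-- The real-valued two-form `⟪⟪v ∧ w⟫⟫` on `M` obtained from the invariant pairing
`⟪⟪(x₁, ξ₁, y₁), (x₂, ξ₂, y₂)⟫⟫ = K ⟨ξ₁, ξ₂⟩ + ε (x₁ y₂ + y₁ x₂)`. -/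
def extPairWedge (v w : Triple M 𝔤) : Form2 M ℝ :=
  avg2 (pairWedge B v.2.1 w.2.1) + ε • (wedge v.1 w.2.2 + wedge v.2.2 w.1)

/-- The real-valued two-form `⟪⟪F, X⟫⟫` for a triple of two-forms and a gauge parameter. -/
def extPair (f : Triple2 M 𝔤) (X : Gauge M 𝔤) : Form2 M ℝ :=
  avg2 (fun m u v => B (f.2.1 m u v) (X.2.1 m)) +
    ε • fun m u v => f.1 m u v * X.2.2 m + f.2.2 m u v * X.1 m

variable {S : Type*} [TopologicalSpace S] [ChartedSpace E2 S] [IsManifold (𝓡 2) ∞ S]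
  [T2Space S] [CompactSpace S] (π : M → S)

/-- The two-form `Ω = ½ ∫ ⟪⟪δl ∧ δl⟫⟫` at the point `l`, evaluated on two tangent vectors. -/
def Omega (_l v w : Triple M 𝔤) : ℝ :=
  (1 / 2) * surfaceIntegral π (extPairWedge ε B v w - extPairWedge ε B w v)

/-- The functional on the extended gauge algebra given by a triple of two-forms `f`,
`X ↦ ∫ ⟪⟪f, X⟫⟫`. -/
def dualOf (f : Triple2 M 𝔤) (X : Gauge M 𝔤) : ℝ := surfaceIntegral π (extPair ε B f X)

/-- The directional derivative at `l` along `v` of a vector field on the space of triples, computed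
pointwise on `M`. -/
def fieldDeriv (W : Triple M 𝔤 → Triple M 𝔤) (l v : Triple M 𝔤) : Triple M 𝔤 :=
  (fun m => deriv (fun t : ℝ => (W (l + t • v)).1 m) 0,
    fun m => deriv (fun t : ℝ => (W (l + t • v)).2.1 m) 0,
    fun m => deriv (fun t : ℝ => (W (l + t • v)).2.2 m) 0)

end Extended

/-! ### Symplectic forms and Lie algebra actions on an affine space

`A` is an affine space inside the vector space `V`, with space of translations `T`. -/

section Abstract

variable {V : Type*} [AddCommGroup V] [Module ℝ V]

/-- `Ω` is a (weakly nondegenerate) symplectic form on `A`. -/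
structure IsSymplecticForm (A T : Set V) (Ω : V → V → V → ℝ) : Prop where
  add_left : ∀ l ∈ A, ∀ u ∈ T, ∀ v ∈ T, ∀ w ∈ T, Ω l (u + v) w = Ω l u w + Ω l v w
  smul_left : ∀ l ∈ A, ∀ (c : ℝ), ∀ v ∈ T, ∀ w ∈ T, Ω l (c • v) w = c * Ω l v w
  skew : ∀ l ∈ A, ∀ v ∈ T, ∀ w ∈ T, Ω l v w = -Ω l w v
  closed : ∀ l ∈ A, ∀ u ∈ T, ∀ v ∈ T, ∀ w ∈ T, ∃ c₁ c₂ c₃ : ℝ,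
    HasDerivAt (fun t : ℝ => Ω (l + t • u) v w) c₁ 0 ∧
    HasDerivAt (fun t : ℝ => Ω (l + t • v) w u) c₂ 0 ∧
    HasDerivAt (fun t : ℝ => Ω (l + t • w) u v) c₃ 0 ∧ c₁ + c₂ + c₃ = 0
  nondegenerate : ∀ l ∈ A, ∀ v ∈ T, (∀ w ∈ T, Ω l v w = 0) → v = 0

/-- `br` restricts to a real Lie bracket on the set `G`. -/
structure IsLieBracketOn (G : Set V) (br : V → V → V) : Prop where
  mem : ∀ X ∈ G, ∀ Y ∈ G, br X Y ∈ G
  add_left : ∀ X ∈ G, ∀ Y ∈ G, ∀ Z ∈ G, br (X + Y) Z = br X Z + br Y Z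
  smul_left : ∀ (c : ℝ), ∀ X ∈ G, ∀ Y ∈ G, br (c • X) Y = c • br X Y
  skew : ∀ X ∈ G, ∀ Y ∈ G, br X Y = -br Y X
  jacobi : ∀ X ∈ G, ∀ Y ∈ G, ∀ Z ∈ G, br X (br Y Z) + br Y (br Z X) + br Z (br X Y) = 0

end Abstract

end ExtendedConnection

end

open scoped Manifold ContDiff
open ExtendedConnection

/-! Everything is computed on `M`; the surface enters only through integration. Two kinds of
integration by parts do the work. Along the fibres, the mean over a period of the derivative of a
periodic function is zero (`mean_deriv`), so the averaging operator kills every Lie derivative along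
`R`, and it is linear over invariant functions and forms. Along the surface, Stokes' theorem holds
for basic one-forms (`surfaceIntegral_d1`).

In the middle component, the Jacobi identity and the commutator relation of the vector fields are
pointwise algebra: `L_R` is a derivation that commutes with `d` and annihilates `x` and `κ`. In the
central component the two sides agree before averaging only up to a Lie derivative. Each such proof
writes down the primitive, checks a pointwise identity with the ad-invariance of `B`, and averages
(`avg2_eq_of_isLieDeriv2`).

The field `V_X` is affine in the connection, with linear part `formBracket1`. As `Omega` does not
depend on the base point, it is closed, and its invariance says that this linear part is skew for
the pairing (`extPairWedge_formBracket1`). Throughout, `ε * ε = 1` makes the sign of the cocycle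
match the sign of the pairing.

The curvature is quadratic in the connection `l`, with derivative `d_l w` (`curvature_add_smul`).
The moment map equation is the Leibniz rule `⟨d_l w, X⟩ + ⟨d_l X ∧ w⟩ = d⟨w, X⟩`
(`extPair_dCurvature_add`) followed by Stokes. Equivariance is `d_l d_l X = [F_l, X]` together with
invariance of the pairing; it already holds for the averaged forms, before integration over the
surface (`extPair_dCurvature_act`).

For nondegeneracy, a horizontal form `α` that is nonzero at a point is tested against `g df`, with
`f` coming from the surface and `g` a bump function on `M`, such that `α ∧ df` has one sign on the
support of `g` (`IsPrincipalCircleBundle.eq_zero_of_surfaceIntegral`). Integrals are computed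
through local lifts of charts to `M` (`coord_eq`), and orientation makes them independent of the
chart. -/

noncomputable section

open Bundle Filter Set

set_option linter.unusedSectionVars false

namespace ExtendedConnection

/-! ### Smooth families of bilinear maps. -/

section Bilinear

variable {F : Type*} [NormedAddCommGroup F] [NormedSpace ℝ F]
variable {E : Type*} [NormedAddCommGroup E] [NormedSpace ℝ E]
variable {E₁ : Type*} [NormedAddCommGroup E₁] [NormedSpace ℝ E₁]
variable {E₂ : Type*} [NormedAddCommGroup E₂] [NormedSpace ℝ E₂]

theorem contDiffAt_flip {G : E → E₁ →L[ℝ] E₂ →L[ℝ] F} {y : E} (hG : ContDiffAt ℝ ∞ G y) :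
    ContDiffAt ℝ ∞ (fun z => (G z).flip) y := by
  have h : ContDiff ℝ ∞ (fun L : E₁ →L[ℝ] E₂ →L[ℝ] F => L.flip) :=
    IsBoundedLinearMap.contDiff ⟨⟨fun _ _ => rfl, fun _ _ => rfl⟩, 1, one_pos, fun x => by
      simp [ContinuousLinearMap.opNorm_flip]⟩
  exact h.contDiffAt.comp y hG

/-- Composition with `A` reaches only the first slot; a flip before and after reaches the second. -/
theorem contDiffAt_bilinearComp {G : E → E₁ →L[ℝ] E₁ →L[ℝ] F} {A : E → E₂ →L[ℝ] E₁} {y : E}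
    (hG : ContDiffAt ℝ ∞ G y) (hA : ContDiffAt ℝ ∞ A y) :
    ContDiffAt ℝ ∞ (fun z => (G z).bilinearComp (A z) (A z)) y := by
  have h1 : ContDiffAt ℝ ∞ (fun z => (G z).comp (A z)) y := hG.clm_comp hA
  have h2 : ContDiffAt ℝ ∞ (fun z => ((G z).comp (A z)).flip) y := contDiffAt_flip h1
  have h3 : ContDiffAt ℝ ∞ (fun z => (((G z).comp (A z)).flip).comp (A z)) y := h2.clm_comp hA
  exact contDiffAt_flip h3

end Bilinear

/-! ### Forms in charts, pull-backs and naturality of the exterior derivative. -/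

section Pullback

variable {M : Type*} [TopologicalSpace M] [ChartedSpace E3 M]
variable {F : Type*} [NormedAddCommGroup F] [NormedSpace ℝ F]
variable {E : Type*} [NormedAddCommGroup E] [NormedSpace ℝ E]

/-- The pull-back of a one-form on `M` along a map from a normed space. -/
def pb (Φ : E → M) (α : Form1 M F) (y : E) : E →L[ℝ] F :=
  (α (Φ y)).comp (mfderiv 𝓘(ℝ, E) (𝓡 3) Φ y : E →L[ℝ] E3)

/-- The pull-back of a bundled two-form on `M` along a map from a normed space. -/
def pb2 (Φ : E → M) (η : M → E3 →L[ℝ] E3 →L[ℝ] F) (y : E) : E →L[ℝ] E →L[ℝ] F :=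
  (η (Φ y)).bilinearComp (mfderiv 𝓘(ℝ, E) (𝓡 3) Φ y : E →L[ℝ] E3)
    (mfderiv 𝓘(ℝ, E) (𝓡 3) Φ y : E →L[ℝ] E3)

variable [IsManifold (𝓡 3) ∞ M]

/-- The chart at `m` and its inverse are smooth at the centre. This turns smoothness of a bundle
section at `m` into smoothness of its coordinate expression at one point of the model space. -/
theorem contMDiffAt_comp_extChartAt_iff {G : Type*} [NormedAddCommGroup G] [NormedSpace ℝ G]
    (g : E3 → G) (m : M) :
    ContMDiffAt (𝓡 3) 𝓘(ℝ, G) ∞ (fun x => g (extChartAt (𝓡 3) m x)) m ↔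
      ContDiffAt ℝ ∞ g (extChartAt (𝓡 3) m m) := by
  have hφ : ContMDiffAt (𝓡 3) 𝓘(ℝ, E3) ∞ (extChartAt (𝓡 3) m) m := contMDiffAt_extChartAt
  have hψ : ContMDiffAt 𝓘(ℝ, E3) (𝓡 3) ∞ (extChartAt (𝓡 3) m).symm (extChartAt (𝓡 3) m m) :=
    (contMDiffOn_extChartAt_symm m).contMDiffAt (extChartAt_target_mem_nhds m)
  constructor
  · intro h
    have h1 : ContMDiffAt 𝓘(ℝ, E3) 𝓘(ℝ, G) ∞
        ((fun x => g (extChartAt (𝓡 3) m x)) ∘ (extChartAt (𝓡 3) m).symm)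
        (extChartAt (𝓡 3) m m) :=
      ContMDiffAt.comp _ (by rw [extChartAt_to_inv]; exact h) hψ
    refine (contMDiffAt_iff_contDiffAt.1 h1).congr_of_eventuallyEq ?_
    filter_upwards [extChartAt_target_mem_nhds (I := 𝓡 3) m] with y hy
    simp only [Function.comp_apply, (extChartAt (𝓡 3) m).right_inv hy]
  · intro h
    exact (contMDiffAt_iff_contDiffAt.2 h).comp m hφ

/-- The trivialization of the tangent bundle at `m` is induced by the chart at `m`; the model has no
boundary, so the derivative within its range is the full derivative. -/
theorem symmL_trivializationAt_eq {m x : M} (hx : x ∈ (chartAt E3 m).source) :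
    (trivializationAt E3 (TangentSpace (𝓡 3)) m).symmL ℝ x =
      (mfderiv 𝓘(ℝ, E3) (𝓡 3) (extChartAt (𝓡 3) m).symm (extChartAt (𝓡 3) m x) : E3 →L[ℝ] E3) := by
  have : IsManifold (𝓡 3) 1 M := IsManifold.of_le (n := ∞) (by norm_cast)
  rw [TangentBundle.symmL_trivializationAt hx]
  rw [ModelWithCorners.range_eq_univ, mfderivWithin_univ]

/-- In the trivialization at `m` the section `α` has coordinates `chartRep α m`. Testing at the
centre of each chart suffices, because every point is the centre of its own preferred chart. -/
theorem isSmoothForm1_iff (α : Form1 M F) :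
    IsSmoothForm1 α ↔ ∀ m, ContDiffAt ℝ ∞ (chartRep α m) (extChartAt (𝓡 3) m m) := by
  refine forall_congr' fun m => ?_
  rw [contMDiffAt_hom_bundle, ← contMDiffAt_comp_extChartAt_iff]
  refine (and_iff_right contMDiffAt_id).trans ?_
  refine Filter.EventuallyEq.contMDiffAt_iff ?_
  filter_upwards [(chartAt E3 m).open_source.mem_nhds (mem_chart_source E3 m)] with x hx
  have h := symmL_trivializationAt_eq hx
  simp only [ContinuousLinearMap.inCoordinates, chartRep]
  rw [(extChartAt (𝓡 3) m).left_inv (by rw [extChartAt_source]; exact hx)]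
  simp [h]
  rfl

theorem contMDiffAt_form2_iff (η : M → (E3 →L[ℝ] E3 →L[ℝ] F)) (m : M) :
    ContMDiffAt (𝓡 3) ((𝓡 3).prod 𝓘(ℝ, E3 →L[ℝ] E3 →L[ℝ] F)) ∞
      (fun m => Bundle.TotalSpace.mk' (E3 →L[ℝ] E3 →L[ℝ] F)
        (E := fun m : M => TangentSpace (𝓡 3) m →L[ℝ] TangentSpace (𝓡 3) m →L[ℝ] F) m (η m)) m ↔
    ContDiffAt ℝ ∞ (pb2 (extChartAt (𝓡 3) m).symm η) (extChartAt (𝓡 3) m m) := by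
  rw [contMDiffAt_hom_bundle, ← contMDiffAt_comp_extChartAt_iff]
  refine (and_iff_right contMDiffAt_id).trans ?_
  refine Filter.EventuallyEq.contMDiffAt_iff ?_
  filter_upwards [(chartAt E3 m).open_source.mem_nhds (mem_chart_source E3 m)] with x hx
  have h := symmL_trivializationAt_eq hx
  have hb : x ∈ (trivializationAt (E3 →L[ℝ] F)
      (fun b : M => TangentSpace (𝓡 3) b →L[ℝ] F) m).baseSet := by
    rw [hom_trivializationAt_baseSet]; exact ⟨hx, mem_univ _⟩
  -- The bundle of one-forms is itself a Hom bundle; its trivialization is precomposition with the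
  -- inverse trivialization of the tangent bundle, which takes care of the second slot.
  have h2 (L : TangentSpace (𝓡 3) x →L[ℝ] F) :
      (trivializationAt (E3 →L[ℝ] F) (fun b : M => TangentSpace (𝓡 3) b →L[ℝ] F)
        m).continuousLinearMapAt ℝ x L =
      L.comp ((trivializationAt E3 (TangentSpace (𝓡 3)) m).symmL ℝ x) := by
    rw [Trivialization.continuousLinearMapAt_apply, Trivialization.coe_linearMapAt_of_mem _ hb]
    beta_reduce
    rw [hom_trivializationAt_apply]
    simp [ContinuousLinearMap.inCoordinates]
  ext u v
  simp only [ContinuousLinearMap.inCoordinates, pb2]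
  rw [(extChartAt (𝓡 3) m).left_inv (by rw [extChartAt_source]; exact hx),
    ContinuousLinearMap.comp_apply, h2, h]
  rfl

theorem eventually_contMDiffAt {Φ : E → M} {y : E} (h : ContMDiffAt 𝓘(ℝ, E) (𝓡 3) ∞ Φ y) :
    ∀ᶠ z in 𝓝 y, MDifferentiableAt 𝓘(ℝ, E) (𝓡 3) Φ z := by
  have : IsManifold (𝓡 3) 1 M := IsManifold.of_le (n := ∞) (by norm_cast)
  have h1 : ContMDiffAt 𝓘(ℝ, E) (𝓡 3) 1 Φ y := h.of_le (by norm_cast)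
  filter_upwards [(contMDiffAt_iff_contMDiffAt_nhds (by simp)).1 h1] with z hz using hz.mdifferentiableAt (by simp)

/-- Factorisation of a differential through a chart. -/
theorem mfderiv_factor_chart {Φ : E → M} {y : E} {m : M}
    (h : MDifferentiableAt 𝓘(ℝ, E) (𝓡 3) Φ y) (hm : Φ y ∈ (extChartAt (𝓡 3) m).source) :
    (mfderiv 𝓘(ℝ, E) (𝓡 3) Φ y : E →L[ℝ] E3) =
      (mfderiv 𝓘(ℝ, E3) (𝓡 3) (extChartAt (𝓡 3) m).symm (extChartAt (𝓡 3) m (Φ y)) :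
        E3 →L[ℝ] E3).comp (fderiv ℝ (fun z => extChartAt (𝓡 3) m (Φ z)) y) ∧
    DifferentiableAt ℝ (fun z => extChartAt (𝓡 3) m (Φ z)) y ∧
    fderiv ℝ (fun z => extChartAt (𝓡 3) m (Φ z)) y =
      (mfderiv (𝓡 3) 𝓘(ℝ, E3) (extChartAt (𝓡 3) m) (Φ y) : E3 →L[ℝ] E3).comp
        (mfderiv 𝓘(ℝ, E) (𝓡 3) Φ y : E →L[ℝ] E3) := by
  have : IsManifold (𝓡 3) 1 M := IsManifold.of_le (n := ∞) (by norm_cast)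
  have hφ : MDifferentiableAt (𝓡 3) 𝓘(ℝ, E3) (extChartAt (𝓡 3) m) (Φ y) :=
    mdifferentiableAt_extChartAt (by rw [← extChartAt_source (𝓡 3)]; exact hm)
  have hψ : MDifferentiableAt 𝓘(ℝ, E3) (𝓡 3) (extChartAt (𝓡 3) m).symm
      (extChartAt (𝓡 3) m (Φ y)) := by
    have := mdifferentiableWithinAt_extChartAt_symm (I := 𝓡 3)
      ((extChartAt (𝓡 3) m).map_source hm)
    simpa [mdifferentiableWithinAt_univ] using this
  have hc : MDifferentiableAt 𝓘(ℝ, E) 𝓘(ℝ, E3) ((extChartAt (𝓡 3) m) ∘ Φ) y := hφ.comp y h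
  refine ⟨?_, hc.differentiableAt, ?_⟩
  · have e : Φ =ᶠ[𝓝 y] (extChartAt (𝓡 3) m).symm ∘ ((extChartAt (𝓡 3) m) ∘ Φ) := by
      filter_upwards [h.continuousAt.preimage_mem_nhds
        ((isOpen_extChartAt_source m).mem_nhds hm)] with z hz
      exact ((extChartAt (𝓡 3) m).left_inv hz).symm
    rw [e.mfderiv_eq]
    have := mfderiv_comp y (I := 𝓘(ℝ, E)) (I' := 𝓘(ℝ, E3)) (I'' := 𝓡 3) (by exact hψ) hc
    rw [this, mfderiv_eq_fderiv]
    rfl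
  · have := mfderiv_comp y hφ h
    rw [mfderiv_eq_fderiv] at this
    exact this

theorem pb_eq_chartRep {Φ : E → M} {y : E} {m : M} (α : Form1 M F)
    (h : MDifferentiableAt 𝓘(ℝ, E) (𝓡 3) Φ y) (hm : Φ y ∈ (extChartAt (𝓡 3) m).source) :
    pb Φ α y = (chartRep α m (extChartAt (𝓡 3) m (Φ y))).comp
      (fderiv ℝ (fun z => extChartAt (𝓡 3) m (Φ z)) y) := by
  rw [pb, (mfderiv_factor_chart h hm).1, chartRep, (extChartAt (𝓡 3) m).left_inv hm]
  rfl

theorem pb2_eq_chart {Φ : E → M} {y : E} {m : M} (η : M → E3 →L[ℝ] E3 →L[ℝ] F)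
    (h : MDifferentiableAt 𝓘(ℝ, E) (𝓡 3) Φ y) (hm : Φ y ∈ (extChartAt (𝓡 3) m).source) :
    pb2 Φ η y = (pb2 (extChartAt (𝓡 3) m).symm η (extChartAt (𝓡 3) m (Φ y))).bilinearComp
      (fderiv ℝ (fun z => extChartAt (𝓡 3) m (Φ z)) y)
      (fderiv ℝ (fun z => extChartAt (𝓡 3) m (Φ z)) y) := by
  rw [pb2, (mfderiv_factor_chart h hm).1, pb2, (extChartAt (𝓡 3) m).left_inv hm]
  rfl

theorem eventually_mem_chart {Φ : E → M} {y : E} (h : ContMDiffAt 𝓘(ℝ, E) (𝓡 3) ∞ Φ y) :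
    ∀ᶠ z in 𝓝 y, MDifferentiableAt 𝓘(ℝ, E) (𝓡 3) Φ z ∧
      Φ z ∈ (extChartAt (𝓡 3) (Φ y)).source :=
  (eventually_contMDiffAt h).and
    (h.continuousAt.preimage_mem_nhds (extChartAt_source_mem_nhds (I := 𝓡 3) (Φ y)))

omit [IsManifold (𝓡 3) ∞ M] in
theorem contDiffAt_chart_comp {Φ : E → M} {y : E} (h : ContMDiffAt 𝓘(ℝ, E) (𝓡 3) ∞ Φ y) :
    ContDiffAt ℝ ∞ (fun z => extChartAt (𝓡 3) (Φ y) (Φ z)) y :=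
  contMDiffAt_iff_contDiffAt.1
    (ContMDiffAt.comp y (contMDiffAt_extChartAt (I := 𝓡 3) (n := ∞) (x := Φ y)) h)

/-- The pull-back of a smooth one-form along a smooth map is smooth. -/
theorem IsSmoothForm1.contDiffAt_pb {α : Form1 M F} (hα : IsSmoothForm1 α) {Φ : E → M} {y : E}
    (h : ContMDiffAt 𝓘(ℝ, E) (𝓡 3) ∞ Φ y) : ContDiffAt ℝ ∞ (pb Φ α) y := by
  have hc := contDiffAt_chart_comp h
  have h1 : ContDiffAt ℝ ∞ (fun z => chartRep α (Φ y) (extChartAt (𝓡 3) (Φ y) (Φ z))) y :=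
    ContDiffAt.comp (g := chartRep α (Φ y)) y ((isSmoothForm1_iff α).1 hα (Φ y)) hc
  refine (h1.clm_comp (hc.fderiv_right (m := ∞) (by norm_cast))).congr_of_eventuallyEq ?_
  filter_upwards [eventually_mem_chart h] with z hz using pb_eq_chartRep α hz.1 hz.2

theorem contDiffAt_pb2 {η : M → E3 →L[ℝ] E3 →L[ℝ] F}
    (hη : ∀ m, ContDiffAt ℝ ∞ (pb2 (extChartAt (𝓡 3) m).symm η) (extChartAt (𝓡 3) m m))
    {Φ : E → M} {y : E}
    (h : ContMDiffAt 𝓘(ℝ, E) (𝓡 3) ∞ Φ y) : ContDiffAt ℝ ∞ (pb2 Φ η) y := by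
  have hc := contDiffAt_chart_comp h
  have h1 : ContDiffAt ℝ ∞ (fun z => pb2 (extChartAt (𝓡 3) (Φ y)).symm η
      (extChartAt (𝓡 3) (Φ y) (Φ z))) y :=
    ContDiffAt.comp (g := pb2 (extChartAt (𝓡 3) (Φ y)).symm η) y (hη (Φ y)) hc
  refine (contDiffAt_bilinearComp h1
    (hc.fderiv_right (m := ∞) (by norm_cast))).congr_of_eventuallyEq ?_
  filter_upwards [eventually_mem_chart h] with z hz using pb2_eq_chart η hz.1 hz.2

/-- Smoothness of a two-form in terms of its coordinate expressions. -/
theorem isSmoothForm2_of_chart {β : Form2 M F}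
    (h : ∀ m, ∃ G : E3 → E3 →L[ℝ] E3 →L[ℝ] F, ContDiffAt ℝ ∞ G (extChartAt (𝓡 3) m m) ∧
      ∀ᶠ y in 𝓝 (extChartAt (𝓡 3) m m), ∀ u v, G y u v = β ((extChartAt (𝓡 3) m).symm y)
        ((mfderiv 𝓘(ℝ, E3) (𝓡 3) (extChartAt (𝓡 3) m).symm y : E3 →L[ℝ] E3) u)
        ((mfderiv 𝓘(ℝ, E3) (𝓡 3) (extChartAt (𝓡 3) m).symm y : E3 →L[ℝ] E3) v))
    (halt : ∀ m u, β m u u = 0) : IsSmoothForm2 β := by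
  have : IsManifold (𝓡 3) 1 M := IsManifold.of_le (n := ∞) (by norm_cast)
  choose G hG hGβ using h
  let D (m : M) : E3 →L[ℝ] E3 := mfderiv (𝓡 3) 𝓘(ℝ, E3) (extChartAt (𝓡 3) m) m
  have hD (m : M) : D m = ContinuousLinearMap.id ℝ E3 := mfderiv_extChartAt_self
  have hD' (m : M) (u : E3) : (mfderiv 𝓘(ℝ, E3) (𝓡 3) (extChartAt (𝓡 3) m).symm
      (extChartAt (𝓡 3) m m) : E3 →L[ℝ] E3) u = u := by
    have := mfderivWithin_range_extChartAt_symm (I := 𝓡 3) (x := m)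
    rw [ModelWithCorners.range_eq_univ, mfderivWithin_univ] at this
    exact DFunLike.congr_fun this u
  have key (m : M) (u v : E3) : β m u v = G m (extChartAt (𝓡 3) m m) u v := by
    rw [(hGβ m).self_of_nhds u v, hD', hD', (extChartAt (𝓡 3) m).left_inv (mem_extChartAt_source m)]
  -- Each `G m` is used only at its centre, where the chart differential is the identity; these
  -- values form the bundled section.
  refine ⟨fun m => G m (extChartAt (𝓡 3) m m), fun m => ?_, key, halt⟩
  refine (contMDiffAt_form2_iff _ m).2 ((hG m).congr_of_eventuallyEq ?_)
  filter_upwards [hGβ m] with y hy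
  ext u v
  exact (key _ _ _).symm.trans (hy u v).symm

theorem IsSmoothForm2.exists_pb2 {β : Form2 M F} (h : IsSmoothForm2 β) :
    ∃ η : M → (E3 →L[ℝ] E3 →L[ℝ] F), (∀ m u v, β m u v = η m u v) ∧
      ∀ m, ContDiffAt ℝ ∞ (pb2 (extChartAt (𝓡 3) m).symm η) (extChartAt (𝓡 3) m m) := by
  obtain ⟨η, h1, h2, -⟩ := h
  exact ⟨η, h2, fun m => (contMDiffAt_form2_iff η m).1 (h1 m)⟩

/-- Naturality of the exterior derivative. -/
theorem d1_pb {α : Form1 M F} (hα : IsSmoothForm1 α) {Φ : E → M} {y : E}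
    (h : ContMDiffAt 𝓘(ℝ, E) (𝓡 3) ∞ Φ y) (u v : E) :
    d1 α (Φ y) ((mfderiv 𝓘(ℝ, E) (𝓡 3) Φ y : E →L[ℝ] E3) u)
      ((mfderiv 𝓘(ℝ, E) (𝓡 3) Φ y : E →L[ℝ] E3) v) =
    fderiv ℝ (pb Φ α) y u v - fderiv ℝ (pb Φ α) y v u := by
  have hc := contDiffAt_chart_comp h
  have hfac := mfderiv_factor_chart (eventually_mem_chart h).self_of_nhds.1
    (eventually_mem_chart h).self_of_nhds.2
  set c : E → E3 := fun z => extChartAt (𝓡 3) (Φ y) (Φ z) with hcdef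
  have hA : DifferentiableAt ℝ (chartRep α (Φ y)) (c y) :=
    ((isSmoothForm1_iff α).1 hα (Φ y)).differentiableAt (by simp)
  have hcd : DifferentiableAt ℝ c y := hc.differentiableAt (by simp)
  have hc2 : DifferentiableAt ℝ (fderiv ℝ c) y :=
    (hc.fderiv_right (m := ∞) (by norm_cast)).differentiableAt (by simp)
  have e : pb Φ α =ᶠ[𝓝 y] fun z => (chartRep α (Φ y) (c z)).comp (fderiv ℝ c z) := by
    filter_upwards [eventually_mem_chart h] with z hz using pb_eq_chartRep α hz.1 hz.2
  -- The second derivative of the coordinate expression of `Φ` is the only non-tensorial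
  -- contribution; being symmetric, it drops out of the antisymmetrization.
  have hsym : fderiv ℝ (fderiv ℝ c) y u v = fderiv ℝ (fderiv ℝ c) y v u :=
    (hc.isSymmSndFDerivAt (by simp; norm_cast)).eq u v
  have hAc : DifferentiableAt ℝ (fun z => chartRep α (Φ y) (c z)) y := hA.comp y hcd
  have hd (u v : E) : fderiv ℝ (pb Φ α) y u v =
      fderiv ℝ (chartRep α (Φ y)) (c y) (fderiv ℝ c y u) (fderiv ℝ c y v) +
        chartRep α (Φ y) (c y) (fderiv ℝ (fderiv ℝ c) y u v) := by
    rw [e.fderiv_eq, fderiv_clm_comp hAc hc2]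
    have : fderiv ℝ (fun z => chartRep α (Φ y) (c z)) y =
      (fderiv ℝ (chartRep α (Φ y)) (c y)).comp (fderiv ℝ c y) := fderiv_comp y hA hcd
    simp [this, add_comm]
  rw [hd, hd, hsym]
  have hfu (u : E) : fderiv ℝ c y u = (mfderiv (𝓡 3) 𝓘(ℝ, E3) (extChartAt (𝓡 3) (Φ y)) (Φ y) :
      E3 →L[ℝ] E3) ((mfderiv 𝓘(ℝ, E) (𝓡 3) Φ y : E →L[ℝ] E3) u) := by
    rw [hfac.2.2]; rfl
  rw [hfu, hfu]
  simp only [d1, hcdef]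
  abel

end Pullback

/-! ### Mixed partial derivatives in time and space. -/

section MixedPartials

variable {E : Type*} [NormedAddCommGroup E] [NormedSpace ℝ E]
variable {F : Type*} [NormedAddCommGroup F] [NormedSpace ℝ F]

theorem hasFDerivAt_slice_right {G : ℝ × E → F} {θ : ℝ} {y : E}
    (h : DifferentiableAt ℝ G (θ, y)) :
    HasFDerivAt (fun z => G (θ, z)) ((fderiv ℝ G (θ, y)).comp (ContinuousLinearMap.inr ℝ ℝ E)) y :=
  HasFDerivAt.comp y h.hasFDerivAt (hasFDerivAt_prodMk_right θ y)

theorem hasDerivAt_slice_left {G : ℝ × E → F} {θ : ℝ} {y : E}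
    (h : DifferentiableAt ℝ G (θ, y)) :
    HasDerivAt (fun t => G (t, y)) (fderiv ℝ G (θ, y) (1, 0)) θ := by
  have := HasFDerivAt.comp (f := fun t : ℝ => (t, y)) θ h.hasFDerivAt (hasFDerivAt_prodMk_left θ y)
  have h2 := this.hasDerivAt
  simpa [Function.comp_def] using h2

/-- Equality of mixed partial derivatives. -/
theorem hasDerivAt_fderiv_slice {G : ℝ × E → F} {θ : ℝ} {y : E}
    (h : ContDiffAt ℝ ∞ G (θ, y)) {g : E → F} (hg : ∀ᶠ z in 𝓝 y, g z = fderiv ℝ G (θ, z) (1, 0))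
    (u : E) :
    HasDerivAt (fun t => fderiv ℝ G (t, y) (0, u)) (fderiv ℝ g y u) θ := by
  have hd : DifferentiableAt ℝ (fderiv ℝ G) (θ, y) :=
    (h.fderiv_right (m := ∞) (by norm_cast)).differentiableAt (by simp)
  have h1 := hasDerivAt_slice_left hd
  have h2 := h1.clm_apply (hasDerivAt_const θ ((0 : ℝ), u))
  have h3 : HasFDerivAt g (((fderiv ℝ (fderiv ℝ G) (θ, y)).comp
      (ContinuousLinearMap.inr ℝ ℝ E)).flip (1, 0)) y := by
    have := (hasFDerivAt_slice_right hd).clm_apply (hasFDerivAt_const ((1 : ℝ), (0 : E)) y)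
    refine HasFDerivAt.congr_of_eventuallyEq ?_ hg
    simpa using this
  have hs := (h.isSymmSndFDerivAt (by simp; norm_cast)).eq (0, u) (1, 0)
  rw [h3.fderiv]
  simpa [hs] using h2

end MixedPartials
-- Differentiation under the integral sign.
section ParametricIntegral

variable {E : Type} [NormedAddCommGroup E] [NormedSpace ℝ E] [FiniteDimensional ℝ E]

/-- The derivative in `y` is continuous, hence bounded on the product of the interval with a closed
ball, which is compact in finite dimension. A constant bound is enough for dominated
differentiation. -/
theorem hasFDerivAt_intervalIntegral {F : Type*} [NormedAddCommGroup F] [NormedSpace ℝ F]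
    [CompleteSpace F] {G : ℝ × E → F} {V : Set E} (hV : IsOpen V)
    (hG : ∀ θ, ∀ y ∈ V, ContDiffAt ℝ ∞ G (θ, y)) (a b : ℝ) {y : E} (hy : y ∈ V) :
    HasFDerivAt (fun y => ∫ θ in a..b, G (θ, y))
      (∫ θ in a..b, (fderiv ℝ G (θ, y)).comp (ContinuousLinearMap.inr ℝ ℝ E)) y := by
  obtain ⟨r, hr, hrV⟩ := Metric.nhds_basis_closedBall.mem_iff.1 (hV.mem_nhds hy)
  have hcont (z : E) (hz : z ∈ V) : Continuous fun θ => G (θ, z) :=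
    continuous_iff_continuousAt.2 fun θ =>
      ContinuousAt.comp (f := fun θ : ℝ => (θ, z)) (hG θ z hz).continuousAt
        (Continuous.prodMk_left z).continuousAt
  let G' : ℝ × E → (E →L[ℝ] F) := fun p => (fderiv ℝ G p).comp (ContinuousLinearMap.inr ℝ ℝ E)
  have hG'c (θ : ℝ) (z : E) (hz : z ∈ V) : ContinuousAt G' (θ, z) :=
    (((hG θ z hz).fderiv_right (m := ∞) (by norm_cast)).clm_comp contDiffAt_const).continuousAt
  have hcont' (z : E) (hz : z ∈ V) : Continuous fun θ => G' (θ, z) :=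
    continuous_iff_continuousAt.2 fun θ =>
      ContinuousAt.comp (f := fun θ : ℝ => (θ, z)) (hG'c θ z hz)
        (Continuous.prodMk_left z).continuousAt
  obtain ⟨C, hC⟩ : ∃ C, ∀ p ∈ uIcc a b ×ˢ Metric.closedBall y r, ‖G' p‖ ≤ C :=
    (isCompact_uIcc.prod (isCompact_closedBall y r)).exists_bound_of_continuousOn
      fun p hp => (hG'c p.1 p.2 (hrV hp.2)).continuousWithinAt
  refine (intervalIntegral.hasFDerivAt_integral_of_dominated_of_fderiv_le
    (F := fun y θ => G (θ, y)) (F' := fun y θ => G' (θ, y)) (bound := fun _ => C)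
    (Metric.closedBall_mem_nhds y hr) ?_ ?_ ?_ ?_ ?_ ?_)
  · filter_upwards [hV.mem_nhds hy] with z hz using (hcont z hz).aestronglyMeasurable
  · exact (hcont y hy).intervalIntegrable _ _
  · exact (hcont' y hy).aestronglyMeasurable
  · exact Eventually.of_forall fun θ hθ z hz => hC _ ⟨uIoc_subset_uIcc hθ, hz⟩
  · exact intervalIntegrable_const
  · exact Eventually.of_forall fun θ _ z hz =>
      hasFDerivAt_slice_right ((hG θ z (hrV hz)).differentiableAt (by simp))

/-- Smooth dependence of an integral on a parameter. -/
theorem contDiffOn_intervalIntegral_nat (n : ℕ) : ∀ {F : Type*} [NormedAddCommGroup F]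
    [NormedSpace ℝ F] [CompleteSpace F] {G : ℝ × E → F} {V : Set E} (_ : IsOpen V)
    (_ : ∀ θ, ∀ y ∈ V, ContDiffAt ℝ ∞ G (θ, y)) (a b : ℝ),
    ContDiffOn ℝ n (fun y => ∫ θ in a..b, G (θ, y)) V := by
  induction n with
  | zero =>
    intro F _ _ _ G V hV hG a b
    exact contDiffOn_zero.2 fun y hy =>
      (hasFDerivAt_intervalIntegral hV hG a b hy).continuousAt.continuousWithinAt
  | succ n ih =>
    intro F _ _ _ G V hV hG a b
    push_cast
    rw [contDiffOn_succ_iff_fderiv_of_isOpen hV]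
    refine ⟨fun y hy => (hasFDerivAt_intervalIntegral hV hG a b
      hy).differentiableAt.differentiableWithinAt, by simp, ?_⟩
    -- The derivative is again a parameter integral, with values in `E →L[ℝ] F`. The induction
    -- therefore runs over all `F`, and `E : Type` keeps this space in the universe of `F`.
    refine ContDiffOn.congr (ih (G := fun p => (fderiv ℝ G p).comp (ContinuousLinearMap.inr ℝ ℝ E))
      hV (fun θ y hy => ((hG θ y hy).fderiv_right (m := ∞) (by norm_cast)).clm_comp
        contDiffAt_const) a b) fun y hy => (hasFDerivAt_intervalIntegral hV hG a b hy).fderiv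

theorem contDiffOn_intervalIntegral {F : Type*} [NormedAddCommGroup F]
    [NormedSpace ℝ F] [CompleteSpace F] {G : ℝ × E → F} {V : Set E} (hV : IsOpen V)
    (hG : ∀ θ, ∀ y ∈ V, ContDiffAt ℝ ∞ G (θ, y)) (a b : ℝ) :
    ContDiffOn ℝ ∞ (fun y => ∫ θ in a..b, G (θ, y)) V :=
  contDiffOn_infty.2 fun n => contDiffOn_intervalIntegral_nat n hV hG a b

end ParametricIntegral

/-! ### Forms at the centre of a chart. -/

section ChartCentre

variable {M : Type*} [TopologicalSpace M] [ChartedSpace E3 M] [IsManifold (𝓡 3) ∞ M]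
variable {F : Type*} [NormedAddCommGroup F] [NormedSpace ℝ F]

theorem contMDiffAt_chart_symm {m : M} {y : E3} (hy : y ∈ (extChartAt (𝓡 3) m).target) :
    ContMDiffAt 𝓘(ℝ, E3) (𝓡 3) ∞ (extChartAt (𝓡 3) m).symm y :=
  (contMDiffOn_extChartAt_symm m).contMDiffAt ((isOpen_extChartAt_target m).mem_nhds hy)

/-- The tangent space at `m` is the model space by way of the chart at `m`, so this chart has
identity differential there. Values of forms and of `d1` at `m` can be read in coordinates without a
change of basis. -/
theorem mfderiv_chart_symm_self (m : M) :
    (mfderiv 𝓘(ℝ, E3) (𝓡 3) (extChartAt (𝓡 3) m).symm (extChartAt (𝓡 3) m m) : E3 →L[ℝ] E3) =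
      ContinuousLinearMap.id ℝ E3 := by
  have : IsManifold (𝓡 3) 1 M := IsManifold.of_le (n := ∞) (by norm_cast)
  have h := mfderivWithin_range_extChartAt_symm (I := 𝓡 3) (x := m)
  rw [ModelWithCorners.range_eq_univ, mfderivWithin_univ] at h
  exact h

theorem mfderiv_chart_self (m : M) :
    (mfderiv (𝓡 3) 𝓘(ℝ, E3) (extChartAt (𝓡 3) m) m : E3 →L[ℝ] E3) =
      ContinuousLinearMap.id ℝ E3 := by
  have : IsManifold (𝓡 3) 1 M := IsManifold.of_le (n := ∞) (by norm_cast)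
  exact mfderiv_extChartAt_self

theorem chartRep_self (α : Form1 M F) (m : M) : chartRep α m (extChartAt (𝓡 3) m m) = α m := by
  rw [chartRep, mfderiv_chart_symm_self, (extChartAt (𝓡 3) m).left_inv (mem_extChartAt_source m)]
  rfl

theorem d1_eq_chartRep (α : Form1 M F) (m : M) (u v : E3) :
    d1 α m u v = fderiv ℝ (chartRep α m) (extChartAt (𝓡 3) m m) u v -
      fderiv ℝ (chartRep α m) (extChartAt (𝓡 3) m m) v u := by
  simp only [d1, mfderiv_chart_self]
  rfl

omit [IsManifold (𝓡 3) ∞ M] in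
theorem pb_apply {E : Type*} [NormedAddCommGroup E] [NormedSpace ℝ E] (Φ : E → M) (α : Form1 M F)
    (y v : E) : pb Φ α y v = α (Φ y) ((mfderiv 𝓘(ℝ, E) (𝓡 3) Φ y : E →L[ℝ] E3) v) := rfl

theorem contMDiffAt_iff_chart (f : M → F) (m : M) :
    ContMDiffAt (𝓡 3) 𝓘(ℝ, F) ∞ f m ↔
      ContDiffAt ℝ ∞ (f ∘ (extChartAt (𝓡 3) m).symm) (extChartAt (𝓡 3) m m) := by
  rw [← contMDiffAt_comp_extChartAt_iff]
  refine Filter.EventuallyEq.contMDiffAt_iff ?_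
  filter_upwards [extChartAt_source_mem_nhds (I := 𝓡 3) m] with x hx
  rw [Function.comp_apply, (extChartAt (𝓡 3) m).left_inv hx]

omit [IsManifold (𝓡 3) ∞ M] in
/-- The pull-back of the differential of a function. -/
theorem pb_d0 {E : Type*} [NormedAddCommGroup E] [NormedSpace ℝ E] {Φ : E → M} {f : M → F} {y : E}
    (hΦ : ContMDiffAt 𝓘(ℝ, E) (𝓡 3) ∞ Φ y) (hf : ContMDiffAt (𝓡 3) 𝓘(ℝ, F) ∞ f (Φ y)) :
    pb Φ (d0 f) y = fderiv ℝ (f ∘ Φ) y := by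
  have h := mfderiv_comp y (hf.mdifferentiableAt (by simp)) (hΦ.mdifferentiableAt (by simp))
  rw [mfderiv_eq_fderiv] at h
  exact h.symm

theorem d0_eq_fderiv {f : M → F} {m : M} (hf : ContMDiffAt (𝓡 3) 𝓘(ℝ, F) ∞ f m) :
    d0 f m = fderiv ℝ (f ∘ (extChartAt (𝓡 3) m).symm) (extChartAt (𝓡 3) m m) := by
  rw [← pb_d0 (contMDiffAt_chart_symm (mem_extChartAt_target m))
    (by rwa [(extChartAt (𝓡 3) m).left_inv (mem_extChartAt_source m)])]
  exact (chartRep_self (d0 f) m).symm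

end ChartCentre

/-! ### The group law of the rotations. -/

section Rot

variable {M : Type*} [MulAction Circle M]

theorem rot_zero (m : M) : rot 0 m = m := by simp [rot]

theorem rot_rot (θ η : ℝ) (m : M) : rot θ (rot η m) = rot (θ + η) m := by
  simp [rot, Circle.exp_add, mul_smul]

theorem rot_add_two_pi (θ : ℝ) (m : M) : rot (θ + 2 * Real.pi) m = rot θ m := by
  simp [rot, Circle.exp_add]

theorem exists_rot (t : Circle) : ∃ θ : ℝ, ∀ m : M, t • m = rot θ m := by
  refine ⟨Complex.arg t, fun m => ?_⟩
  rw [rot, Circle.exp_arg]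

end Rot

/-! ### The generator, pull-backs, Lie derivatives and Cartan's formula. -/

section CircleAction

variable {M : Type*} [TopologicalSpace M] [ChartedSpace E3 M] [MulAction Circle M]
variable {F : Type*} [NormedAddCommGroup F] [NormedSpace ℝ F]
variable {E : Type*} [NormedAddCommGroup E] [NormedSpace ℝ E]

/-- The circle action, transported along a map into `M`. -/
def rotMap (Ψ : E → M) (p : ℝ × E) : M := rot p.1 (Ψ p.2)

variable [ContMDiffSMul (𝓡 1) (𝓡 3) ∞ Circle M]

theorem contMDiff_rot_uncurry :
    ContMDiff (𝓘(ℝ, ℝ).prod (𝓡 3)) (𝓡 3) ∞ (fun p : ℝ × M => rot p.1 p.2) :=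
  (contMDiff_smul (I := 𝓡 1) (G := Circle)).comp
    ((contMDiff_circleExp.comp contMDiff_fst).prodMk contMDiff_snd)

theorem contMDiff_rot (θ : ℝ) : ContMDiff (𝓡 3) (𝓡 3) ∞ (rot θ : M → M) :=
  contMDiff_rot_uncurry.comp (contMDiff_const.prodMk contMDiff_id)

theorem contMDiff_orbit (m : M) : ContMDiff 𝓘(ℝ, ℝ) (𝓡 3) ∞ (fun θ : ℝ => rot θ m) :=
  contMDiff_rot_uncurry.comp (contMDiff_id.prodMk contMDiff_const)

theorem mdifferentiable_rot (θ : ℝ) : MDifferentiable (𝓡 3) (𝓡 3) (rot θ : M → M) :=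
  (contMDiff_rot θ).mdifferentiable (by simp)

theorem contMDiffAt_rotMap {Ψ : E → M} {θ : ℝ} {y : E}
    (h : ContMDiffAt 𝓘(ℝ, E) (𝓡 3) ∞ Ψ y) :
    ContMDiffAt 𝓘(ℝ, ℝ × E) (𝓡 3) ∞ (rotMap Ψ) (θ, y) := by
  have h1 : ContMDiffAt 𝓘(ℝ, ℝ × E) 𝓘(ℝ, ℝ) ∞ (Prod.fst : ℝ × E → ℝ) (θ, y) :=
     contDiff_fst.contDiffAt.contMDiffAt
  have h2 : ContMDiffAt 𝓘(ℝ, ℝ × E) 𝓘(ℝ, E) ∞ (Prod.snd : ℝ × E → E) (θ, y) :=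
     contDiff_snd.contDiffAt.contMDiffAt
  exact contMDiff_rot_uncurry.contMDiffAt.comp (θ, y)
    (h1.prodMk (ContMDiffAt.comp (θ, y) h h2))

omit [ContMDiffSMul (𝓡 1) (𝓡 3) ∞ Circle M] in
theorem dRot_zero (m : M) : dRot 0 m = ContinuousLinearMap.id ℝ E3 := by
  have : (rot 0 : M → M) = id := funext rot_zero
  rw [dRot, this, mfderiv_id]
  rfl

theorem dRot_dRot (θ η : ℝ) (m : M) (u : E3) :
    dRot θ (rot η m) (dRot η m u) = dRot (θ + η) m u := by
  have h : (rot (θ + η) : M → M) = rot θ ∘ rot η := funext fun x => (rot_rot θ η x).symm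
  have := mfderiv_comp m (mdifferentiable_rot θ (rot η m)) (mdifferentiable_rot η m)
  simp only [dRot]
  rw [h, this]
  rfl

theorem mfderiv_orbit (m : M) (θ : ℝ) :
    (mfderiv 𝓘(ℝ, ℝ) (𝓡 3) (fun t : ℝ => rot t m) θ : ℝ →L[ℝ] E3) 1 = genR (rot θ m) := by
  have h : (fun t : ℝ => rot t m) = (fun t : ℝ => rot t (rot θ m)) ∘ fun t => t - θ := by
    funext t; simp [rot_rot]
  have h1 : MDifferentiableAt 𝓘(ℝ, ℝ) (𝓡 3) (fun t : ℝ => rot t (rot θ m)) (θ - θ) :=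
    ((contMDiff_orbit (rot θ m)).mdifferentiable (by simp)) _
  have hs : HasFDerivAt (fun t : ℝ => t - θ) (ContinuousLinearMap.id ℝ ℝ) θ :=
    (hasFDerivAt_id θ).sub_const θ
  have h3 := HasMFDerivAt.comp (f := fun t : ℝ => t - θ) θ h1.hasMFDerivAt hs.hasMFDerivAt
  -- The chain rule evaluates at `θ - θ`, which is not `0` by definition; a variable time with a
  -- proof permits the substitution.
  have h4 (t : ℝ) (ht : t = 0) : (mfderiv 𝓘(ℝ, ℝ) (𝓡 3) (fun t : ℝ => rot t (rot θ m)) t :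
      ℝ →L[ℝ] E3) 1 = genR (rot θ m) := by rw [ht]; rfl
  rw [h, h3.mfderiv]
  exact h4 _ (sub_self θ)

/-- The generator of the action is invariant. -/
theorem dRot_genR (θ : ℝ) (m : M) : dRot θ m (genR m) = genR (rot θ m) := by
  have h : (fun t : ℝ => rot t (rot θ m)) = rot θ ∘ fun t : ℝ => rot t m := by
    funext t; simp [rot_rot, add_comm]
  have h1 : MDifferentiableAt 𝓘(ℝ, ℝ) (𝓡 3) (fun t : ℝ => rot t m) 0 :=
    (contMDiff_orbit m).mdifferentiable (by simp) _
  have h2 : MDifferentiableAt (𝓡 3) (𝓡 3) (rot θ : M → M) ((fun t : ℝ => rot t m) 0) :=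
    mdifferentiable_rot θ _
  have h3 := mfderiv_comp 0 h2 h1
  rw [← h, rot_zero] at h3
  exact (DFunLike.congr_fun h3 (1 : ℝ)).symm

/-- `rotMap Ψ` is one smooth map on `ℝ × E` whose partial derivatives are the rotated frame and, in
`mfderiv_rotMap_inl`, the generator `R`. Through it pull-backs, Lie derivatives, averages and
contractions with `R` become partial derivatives and parameter integrals on a vector space. -/
theorem mfderiv_rotMap_inr {Ψ : E → M} {θ : ℝ} {y : E}
    (h : ContMDiffAt 𝓘(ℝ, E) (𝓡 3) ∞ Ψ y) (v : E) :
    (mfderiv 𝓘(ℝ, ℝ × E) (𝓡 3) (rotMap Ψ) (θ, y) : ℝ × E →L[ℝ] E3) (0, v) =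
      dRot θ (Ψ y) ((mfderiv 𝓘(ℝ, E) (𝓡 3) Ψ y : E →L[ℝ] E3) v) := by
  have h1 : MDifferentiableAt 𝓘(ℝ, ℝ × E) (𝓡 3) (rotMap Ψ) (θ, y) :=
    (contMDiffAt_rotMap h).mdifferentiableAt (by simp)
  have h2 := HasMFDerivAt.comp y h1.hasMFDerivAt (hasFDerivAt_prodMk_right θ y).hasMFDerivAt
  have h3 := HasMFDerivAt.comp y (mdifferentiable_rot θ (Ψ y)).hasMFDerivAt
    (h.mdifferentiableAt (by simp)).hasMFDerivAt
  exact DFunLike.congr_fun (hasMFDerivAt_unique h2 h3) v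

theorem mfderiv_rotMap_inl {Ψ : E → M} {θ : ℝ} {y : E}
    (h : ContMDiffAt 𝓘(ℝ, E) (𝓡 3) ∞ Ψ y) :
    (mfderiv 𝓘(ℝ, ℝ × E) (𝓡 3) (rotMap Ψ) (θ, y) : ℝ × E →L[ℝ] E3) (1, 0) =
      genR (rot θ (Ψ y)) := by
  have h1 : MDifferentiableAt 𝓘(ℝ, ℝ × E) (𝓡 3) (rotMap Ψ) (θ, y) :=
    (contMDiffAt_rotMap h).mdifferentiableAt (by simp)
  have h2 := HasMFDerivAt.comp (f := fun t : ℝ => (t, y)) θ h1.hasMFDerivAt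
    (hasFDerivAt_prodMk_left θ y).hasMFDerivAt
  have h3 := ((contMDiff_orbit (Ψ y)).mdifferentiable (by simp) θ).hasMFDerivAt
  rw [← mfderiv_orbit]
  exact DFunLike.congr_fun (hasMFDerivAt_unique h2 h3) 1

theorem pb_rotMap_inr (α : Form1 M F) {Ψ : E → M} {θ : ℝ} {y : E}
    (h : ContMDiffAt 𝓘(ℝ, E) (𝓡 3) ∞ Ψ y) :
    (pb (rotMap Ψ) α (θ, y)).comp (ContinuousLinearMap.inr ℝ ℝ E) = pb Ψ (pull1 θ α) y := by
  ext v
  exact congrArg (α (rot θ (Ψ y))) (mfderiv_rotMap_inr h v)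

omit [ContMDiffSMul (𝓡 1) (𝓡 3) ∞ Circle M] in
theorem pull1_zero (α : Form1 M F) : pull1 0 α = α := by
  funext m
  rw [pull1, dRot_zero, rot_zero]
  rfl

theorem pull1_pull1 (θ η : ℝ) (α : Form1 M F) : pull1 θ (pull1 η α) = pull1 (η + θ) α := by
  funext m
  ext u
  simp only [pull1, ContinuousLinearMap.comp_apply]
  rw [dRot_dRot, rot_rot]

omit [ContMDiffSMul (𝓡 1) (𝓡 3) ∞ Circle M] in
theorem dRot_add_two_pi (θ : ℝ) (m : M) : dRot (θ + 2 * Real.pi) m = dRot θ m := by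
  have : (rot (θ + 2 * Real.pi) : M → M) = rot θ := funext fun x => rot_add_two_pi θ x
  rw [dRot, dRot, this]

omit [ContMDiffSMul (𝓡 1) (𝓡 3) ∞ Circle M] in
theorem pull1_add_two_pi (θ : ℝ) (α : Form1 M F) : pull1 (θ + 2 * Real.pi) α = pull1 θ α := by
  funext m
  rw [pull1, pull1, dRot_add_two_pi, rot_add_two_pi]

variable [IsManifold (𝓡 3) ∞ M]

theorem chartRep_pull1 (α : Form1 M F) (θ : ℝ) {m : M} {y : E3}
    (hy : y ∈ (extChartAt (𝓡 3) m).target) :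
    chartRep (pull1 θ α) m y = (pb (rotMap (extChartAt (𝓡 3) m).symm) α (θ, y)).comp
      (ContinuousLinearMap.inr ℝ ℝ E3) :=
  (pb_rotMap_inr α (contMDiffAt_chart_symm hy)).symm

variable {α : Form1 M F}

theorem IsSmoothForm1.contDiffAt_pull1_param (hα : IsSmoothForm1 α) (θ : ℝ) {m : M} {y : E3}
    (hy : y ∈ (extChartAt (𝓡 3) m).target) :
    ContDiffAt ℝ ∞ (fun p : ℝ × E3 => (pb (rotMap (extChartAt (𝓡 3) m).symm) α p).comp
      (ContinuousLinearMap.inr ℝ ℝ E3)) (θ, y) :=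
  (hα.contDiffAt_pb (contMDiffAt_rotMap (contMDiffAt_chart_symm hy))).clm_comp contDiffAt_const

theorem pull1_eq_param (α : Form1 M F) (θ : ℝ) (m : M) : ExtendedConnection.pull1 θ α m =
    (pb (rotMap (extChartAt (𝓡 3) m).symm) α (θ, extChartAt (𝓡 3) m m)).comp
      (ContinuousLinearMap.inr ℝ ℝ E3) := by
  rw [← chartRep_pull1 α θ (mem_extChartAt_target m), chartRep_self]

theorem IsSmoothForm1.differentiableAt_pull1 (hα : IsSmoothForm1 α) (θ : ℝ) (m : M) :
    DifferentiableAt ℝ (fun θ => ExtendedConnection.pull1 θ α m) θ := by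
  simp only [pull1_eq_param]
  exact (hasDerivAt_slice_left ((hα.contDiffAt_pull1_param θ
    (mem_extChartAt_target m)).differentiableAt (by simp))).differentiableAt

/-- The Lie derivative is defined as a derivative at time `0`. The group law moves it to time `θ`: a
nearby pull-back is a pull-back by a small rotation at `rot θ m`, composed with the fixed map `dRot
θ m`. -/
theorem IsSmoothForm1.hasDerivAt_pull1 (hα : IsSmoothForm1 α) (θ : ℝ) (m : M) :
    HasDerivAt (fun θ => ExtendedConnection.pull1 θ α m)
      (ExtendedConnection.pull1 θ (lie1 α) m) θ := by
  have h0 : HasDerivAt (fun s => ExtendedConnection.pull1 s α (rot θ m)) (lie1 α (rot θ m)) 0 :=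
    (hα.differentiableAt_pull1 0 (rot θ m)).hasDerivAt
  have h1 := h0.clm_comp (hasDerivAt_const 0 (dRot θ m))
  have h2 : HasDerivAt (fun s => ExtendedConnection.pull1 (s + θ) α m)
      (ExtendedConnection.pull1 θ (lie1 α) m) 0 := by
    convert! h1 using 1
    · funext s
      rw [← pull1_pull1]
      rfl
    · simp [ExtendedConnection.pull1]
  have h3 := HasDerivAt.scomp (𝕜' := ℝ) (h := fun t => t - θ)
    (g₁ := fun s => ExtendedConnection.pull1 (s + θ) α m) θ (by simpa using h2)
    ((hasDerivAt_id θ).sub_const θ)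
  simpa [Function.comp_def] using h3

/-- The right side is a time derivative of a function that is smooth jointly in time and position;
this is what makes `lie1 α` smooth. -/
theorem chartRep_lie1 (hα : IsSmoothForm1 α) {m : M} {y : E3}
    (hy : y ∈ (extChartAt (𝓡 3) m).target) :
    chartRep (lie1 α) m y = fderiv ℝ (fun p : ℝ × E3 => (pb (rotMap (extChartAt (𝓡 3) m).symm) α
      p).comp (ContinuousLinearMap.inr ℝ ℝ E3)) (0, y) (1, 0) := by
  have h1 := hasDerivAt_slice_left ((hα.contDiffAt_pull1_param 0 hy).differentiableAt (by simp))
  have h0 := hα.hasDerivAt_pull1 0 ((extChartAt (𝓡 3) m).symm y)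
  let D : E3 →L[ℝ] E3 := mfderiv 𝓘(ℝ, E3) (𝓡 3) (extChartAt (𝓡 3) m).symm y
  have h2 := h0.clm_comp (hasDerivAt_const 0 D)
  rw [pull1_zero] at h2
  refine HasDerivAt.unique (f := fun t => chartRep (ExtendedConnection.pull1 t α) m y) ?_ ?_
    (x := 0)
  · convert! h2 using 1
    simp [chartRep, D]
  · simpa only [← chartRep_pull1 α _ hy] using h1

theorem IsSmoothForm1.lie1 (hα : IsSmoothForm1 α) : IsSmoothForm1 (lie1 α) := by
  refine (isSmoothForm1_iff _).2 fun m => ?_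
  have h := ContDiffAt.comp (extChartAt (𝓡 3) m m) (((hα.contDiffAt_pull1_param 0
    (mem_extChartAt_target m)).fderiv_right (m := ∞) (by norm_cast)))
    (contDiff_prodMk_right (0 : ℝ)).contDiffAt
  have h' := h.clm_apply (contDiffAt_const (c := ((1 : ℝ), (0 : E3))))
  refine h'.congr_of_eventuallyEq ?_
  filter_upwards [extChartAt_target_mem_nhds (I := 𝓡 3) m] with y hy using chartRep_lie1 hα hy

/-- Naturality along the single map `rot θ ∘ (extChartAt (𝓡 3) m).symm` gives both sides, since
pulling `α` back along it yields the chart expression of the rotated form. -/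
theorem pull2_d1 (hα : IsSmoothForm1 α) (θ : ℝ) :
    pull2 θ (d1 α) = d1 (ExtendedConnection.pull1 θ α) := by
  funext m u v
  have hψ : ContMDiffAt 𝓘(ℝ, E3) (𝓡 3) ∞ (extChartAt (𝓡 3) m).symm (extChartAt (𝓡 3) m m) :=
    contMDiffAt_chart_symm (mem_extChartAt_target m)
  have hc : ContMDiffAt 𝓘(ℝ, E3) (𝓡 3) ∞ (rot θ ∘ (extChartAt (𝓡 3) m).symm)
      (extChartAt (𝓡 3) m m) := (contMDiff_rot θ).contMDiffAt.comp _ hψ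
  have hd {y : E3} (hy : y ∈ (extChartAt (𝓡 3) m).target) :
      (mfderiv 𝓘(ℝ, E3) (𝓡 3) (rot θ ∘ (extChartAt (𝓡 3) m).symm) y : E3 →L[ℝ] E3) =
      (dRot θ ((extChartAt (𝓡 3) m).symm y)).comp
        (mfderiv 𝓘(ℝ, E3) (𝓡 3) (extChartAt (𝓡 3) m).symm y : E3 →L[ℝ] E3) :=
    mfderiv_comp y (mdifferentiable_rot θ _)
      ((contMDiffAt_chart_symm hy).mdifferentiableAt (by simp))
  have e : pb (rot θ ∘ (extChartAt (𝓡 3) m).symm) α =ᶠ[𝓝 (extChartAt (𝓡 3) m m)]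
      chartRep (ExtendedConnection.pull1 θ α) m := by
    filter_upwards [extChartAt_target_mem_nhds (I := 𝓡 3) m] with y hy
    rw [pb, hd hy]
    rfl
  have h := d1_pb hα hc u v
  rw [hd (mem_extChartAt_target m), mfderiv_chart_symm_self, e.fderiv_eq] at h
  rw [d1_eq_chartRep, ← h, Function.comp_apply,
    (extChartAt (𝓡 3) m).left_inv (mem_extChartAt_source m)]
  rfl

theorem fderiv_chartRep_pull1 (hα : IsSmoothForm1 α) (m : M) (θ : ℝ) (u : E3) :
    fderiv ℝ (chartRep (ExtendedConnection.pull1 θ α) m) (extChartAt (𝓡 3) m m) u =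
      fderiv ℝ (fun p : ℝ × E3 =>
        (pb (rotMap (extChartAt (𝓡 3) m).symm) α p).comp (ContinuousLinearMap.inr ℝ ℝ E3))
        (θ, extChartAt (𝓡 3) m m) (0, u) := by
  have h1 := hasFDerivAt_slice_right ((hα.contDiffAt_pull1_param θ
    (mem_extChartAt_target m)).differentiableAt (by simp))
  have e : chartRep (ExtendedConnection.pull1 θ α) m =ᶠ[𝓝 (extChartAt (𝓡 3) m m)] fun y =>
      (pb (rotMap (extChartAt (𝓡 3) m).symm) α (θ, y)).comp
        (ContinuousLinearMap.inr ℝ ℝ E3) := by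
    filter_upwards [extChartAt_target_mem_nhds (I := 𝓡 3) m] with y hy
      using chartRep_pull1 α θ hy
  rw [e.fderiv_eq, h1.fderiv]
  simp

/-- The exterior derivative differentiates in space and the Lie derivative in time; on a jointly
smooth function the two commute. -/
theorem hasDerivAt_d1_pull1 (hα : IsSmoothForm1 α) (m : M) (u v : E3) :
    HasDerivAt (fun θ => d1 (ExtendedConnection.pull1 θ α) m u v) (d1 (lie1 α) m u v) 0 := by
  have hP := hα.contDiffAt_pull1_param 0 (mem_extChartAt_target m)
  have hg : ∀ᶠ y in 𝓝 (extChartAt (𝓡 3) m m), chartRep (lie1 α) m y =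
      fderiv ℝ (fun p : ℝ × E3 => (pb (rotMap (extChartAt (𝓡 3) m).symm) α
        p).comp (ContinuousLinearMap.inr ℝ ℝ E3)) (0, y) (1, 0) := by
    filter_upwards [extChartAt_target_mem_nhds (I := 𝓡 3) m] with y hy using chartRep_lie1 hα hy
  have h (u v : E3) := (hasDerivAt_fderiv_slice hP hg u).clm_apply (hasDerivAt_const 0 v)
  have h' := (h u v).sub (h v u)
  simp only [d1_eq_chartRep, fderiv_chartRep_pull1 hα]
  convert! h' using 1
  simp

theorem pb_rotMap_genR (α : Form1 M F) {m : M} {y : E3}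
    (hy : y ∈ (extChartAt (𝓡 3) m).target) :
    pb (rotMap (extChartAt (𝓡 3) m).symm) α ((0 : ℝ), y) (1, 0) =
      ((fun m => α m (genR m)) ∘ (extChartAt (𝓡 3) m).symm) y := by
  have h := mfderiv_rotMap_inl (θ := 0) (contMDiffAt_chart_symm hy)
  rw [rot_zero] at h
  rw [pb_apply, h, rotMap, rot_zero, Function.comp_apply]

theorem IsSmoothForm1.contMDiff_apply_genR (hα : IsSmoothForm1 α) :
    ContMDiff (𝓡 3) 𝓘(ℝ, F) ∞ (fun m => α m (genR m)) := fun m => by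
  have hΦ := contMDiffAt_rotMap (θ := 0) (contMDiffAt_chart_symm (mem_extChartAt_target m))
  have h4 : ContDiffAt ℝ ∞ (fun y => pb (rotMap (extChartAt (𝓡 3) m).symm) α ((0 : ℝ), y) (1, 0))
      (extChartAt (𝓡 3) m m) := ContDiffAt.clm_apply
    (ContDiffAt.comp (extChartAt (𝓡 3) m m) (hα.contDiffAt_pb hΦ)
      (contDiff_prodMk_right (0 : ℝ)).contDiffAt) contDiffAt_const
  refine (contMDiffAt_iff_chart _ _).2 (h4.congr_of_eventuallyEq ?_)
  filter_upwards [extChartAt_target_mem_nhds (I := 𝓡 3) m] with y hy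
    using (pb_rotMap_genR α hy).symm

/-- Cartan's formula for the contraction with the generator. -/
theorem d1_genR (hα : IsSmoothForm1 α) (m : M) (v : E3) :
    d1 α m (genR m) v = ExtendedConnection.lie1 α m v - d0 (fun m => α m (genR m)) m v := by
  have hy := mem_extChartAt_target (I := 𝓡 3) m
  have hΦ := contMDiffAt_rotMap (θ := 0) (contMDiffAt_chart_symm hy)
  -- On `ℝ × E3` the vectors `(1, 0)` and `(0, v)` are constant fields, so `d` has no bracket term:
  -- its two terms are the time derivative of the pull-back, applied to `v`, and the spatial
  -- derivative of `α(R)`.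
  have h := d1_pb hα hΦ (1, 0) (0, v)
  rw [mfderiv_rotMap_inl (contMDiffAt_chart_symm hy),
    mfderiv_rotMap_inr (contMDiffAt_chart_symm hy), mfderiv_chart_symm_self, rotMap, rot_zero,
    dRot_zero] at h
  simp only [(extChartAt (𝓡 3) m).left_inv (mem_extChartAt_source m)] at h
  have hdiff := (hα.contDiffAt_pb hΦ).differentiableAt (by simp)
  have h1 := (hasDerivAt_slice_left hdiff).clm_apply (hasDerivAt_const 0 ((0 : ℝ), v))
  have h1' : HasDerivAt (fun θ => ExtendedConnection.pull1 θ α m v)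
      (fderiv ℝ (pb (rotMap (extChartAt (𝓡 3) m).symm) α) (0, extChartAt (𝓡 3) m m) (1, 0)
        (0, v)) 0 := by
    simp only [pull1_eq_param]
    simpa using h1
  have h2 : HasDerivAt (fun θ => ExtendedConnection.pull1 θ α m v)
      (ExtendedConnection.lie1 α m v) 0 := by
    have := (hα.hasDerivAt_pull1 0 m).clm_apply (hasDerivAt_const 0 v)
    simpa [pull1_zero] using this
  have h3 := (hasFDerivAt_slice_right hdiff).clm_apply
    (hasFDerivAt_const ((1 : ℝ), (0 : E3)) (extChartAt (𝓡 3) m m))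
  have e : (fun y => pb (rotMap (extChartAt (𝓡 3) m).symm) α ((0 : ℝ), y) (1, 0)) =ᶠ[
      𝓝 (extChartAt (𝓡 3) m m)] (fun m => α m (genR m)) ∘ (extChartAt (𝓡 3) m).symm := by
    filter_upwards [extChartAt_target_mem_nhds (I := 𝓡 3) m] with y hy using pb_rotMap_genR α hy
  rw [d0_eq_fderiv (hα.contMDiff_apply_genR m), ← e.fderiv_eq, h3.fderiv, ← h1'.unique h2]
  refine h.trans ?_
  simp

end CircleAction

theorem contDiffAt_clm_of_apply {E E' F : Type*} [NormedAddCommGroup E] [NormedSpace ℝ E]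
    [NormedAddCommGroup E'] [NormedSpace ℝ E'] [FiniteDimensional ℝ E'] [NormedAddCommGroup F]
    [NormedSpace ℝ F] {f : E → E' →L[ℝ] F} {y : E} (h : ∀ u, ContDiffAt ℝ ∞ (fun z => f z u) y) :
    ContDiffAt ℝ ∞ f y := by
  let d := Module.finrank ℝ E'
  have hd : d = Module.finrank ℝ (Fin d → ℝ) := (Module.finrank_fin_fun ℝ).symm
  let e₁ := ContinuousLinearEquiv.ofFinrankEq hd
  let e₂ := (e₁.arrowCongr (1 : F ≃L[ℝ] F)).trans (ContinuousLinearEquiv.piRing (Fin d))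
  rw [← Function.id_comp f, ← e₂.symm_comp_self]
  exact e₂.symm.contDiff.contDiffAt.comp y (contDiffAt_pi.mpr fun i => h _)

/-! ### Differentials and Lie derivatives of functions. -/

section Functions

variable {M : Type*} [TopologicalSpace M] [ChartedSpace E3 M] [IsManifold (𝓡 3) ∞ M]
variable {F : Type*} [NormedAddCommGroup F] [NormedSpace ℝ F]

theorem isSmoothForm1_d0 {f : M → F} (hf : ContMDiff (𝓡 3) 𝓘(ℝ, F) ∞ f) :
    IsSmoothForm1 (d0 f) := by
  refine (isSmoothForm1_iff _).2 fun m => ?_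
  have h := ((contMDiffAt_iff_chart f m).1 (hf m)).fderiv_right (m := ∞) (by norm_cast)
  refine h.congr_of_eventuallyEq ?_
  filter_upwards [extChartAt_target_mem_nhds (I := 𝓡 3) m] with y hy
    using pb_d0 (contMDiffAt_chart_symm hy) (hf _)

theorem d1_d0 {f : M → F} (hf : ContMDiff (𝓡 3) 𝓘(ℝ, F) ∞ f) : d1 (d0 f) = 0 := by
  funext m u v
  have e : chartRep (d0 f) m =ᶠ[𝓝 (extChartAt (𝓡 3) m m)]
      fderiv ℝ (f ∘ (extChartAt (𝓡 3) m).symm) := by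
    filter_upwards [extChartAt_target_mem_nhds (I := 𝓡 3) m] with y hy
      using pb_d0 (contMDiffAt_chart_symm hy) (hf _)
  have hs := (((contMDiffAt_iff_chart f m).1 (hf m)).isSymmSndFDerivAt
    (by simp; norm_cast)).eq u v
  rw [d1_eq_chartRep, e.fderiv_eq, hs]
  simp

omit [IsManifold (𝓡 3) ∞ M] in
theorem d0_const (c : F) : d0 (fun _ : M => c) = 0 := by
  funext m
  exact mfderiv_const

variable [MulAction Circle M] [ContMDiffSMul (𝓡 1) (𝓡 3) ∞ Circle M]

omit [IsManifold (𝓡 3) ∞ M] in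
theorem pull1_d0 {f : M → F} (hf : ContMDiff (𝓡 3) 𝓘(ℝ, F) ∞ f) (θ : ℝ) :
    pull1 θ (d0 f) = d0 (fun m => f (rot θ m)) := by
  funext m
  exact (mfderiv_comp m (hf.mdifferentiable (by simp) _) (mdifferentiable_rot θ m)).symm

omit [IsManifold (𝓡 3) ∞ M] in
theorem hasDerivAt_rot {f : M → F} (hf : ContMDiff (𝓡 3) 𝓘(ℝ, F) ∞ f) (θ : ℝ) (m : M) :
    HasDerivAt (fun θ => f (rot θ m)) (d0 f (rot θ m) (genR (rot θ m))) θ := by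
  have h1 := HasMFDerivAt.comp θ (hf.mdifferentiable (by simp) (rot θ m)).hasMFDerivAt
    ((contMDiff_orbit m).mdifferentiable (by simp) θ).hasMFDerivAt
  have h2 : HasFDerivAt (fun θ => f (rot θ m)) ((d0 f (rot θ m)).comp
    (mfderiv 𝓘(ℝ, ℝ) (𝓡 3) (fun t : ℝ => rot t m) θ : ℝ →L[ℝ] E3)) θ :=
    hasMFDerivAt_iff_hasFDerivAt.1 h1
  rw [← mfderiv_orbit]
  exact h2.hasDerivAt

omit [IsManifold (𝓡 3) ∞ M] in
theorem lie0_eq {f : M → F} (hf : ContMDiff (𝓡 3) 𝓘(ℝ, F) ∞ f) (m : M) :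
    lie0 f m = d0 f m (genR m) := by
  have := (hasDerivAt_rot hf 0 m).deriv
  rwa [rot_zero] at this

omit [IsManifold (𝓡 3) ∞ M] in
theorem hasDerivAt_comp_rot {f : M → F} (hf : ContMDiff (𝓡 3) 𝓘(ℝ, F) ∞ f) (θ : ℝ) (m : M) :
    HasDerivAt (fun θ => f (rot θ m)) (lie0 f (rot θ m)) θ := by
  rw [lie0_eq hf]
  exact hasDerivAt_rot hf θ m

theorem contMDiff_lie0 {f : M → F} (hf : ContMDiff (𝓡 3) 𝓘(ℝ, F) ∞ f) :
    ContMDiff (𝓡 3) 𝓘(ℝ, F) ∞ (lie0 f) := by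
  have : lie0 f = fun m => d0 f m (genR m) := funext (lie0_eq hf)
  rw [this]
  exact (isSmoothForm1_d0 hf).contMDiff_apply_genR

/-- Cartan's formula for `df`: the left side vanishes since `ddf = 0`, and `df(R) = L_R f`. -/
theorem lie1_d0 {f : M → F} (hf : ContMDiff (𝓡 3) 𝓘(ℝ, F) ∞ f) : lie1 (d0 f) = d0 (lie0 f) := by
  funext m
  ext v
  have h := d1_genR (isSmoothForm1_d0 hf) m v
  rw [d1_d0 hf, ← funext (lie0_eq hf)] at h
  exact (sub_eq_zero.1 h.symm)

end Functions

/-! ### Products and wedge products of forms, and their Leibniz rules. -/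

section Algebra

variable {M : Type*} [TopologicalSpace M] [ChartedSpace E3 M]
variable {F : Type*} [NormedAddCommGroup F] [NormedSpace ℝ F]
variable {F₁ : Type*} [NormedAddCommGroup F₁] [NormedSpace ℝ F₁]
variable {F₂ : Type*} [NormedAddCommGroup F₂] [NormedSpace ℝ F₂]
variable {F₃ : Type*} [NormedAddCommGroup F₃] [NormedSpace ℝ F₃]

/-- The product of a one-form and a function, for a bilinear pairing of the values. -/
def mulForm1 (L : F₁ →L[ℝ] F₂ →L[ℝ] F₃) (α : Form1 M F₁) (f : M → F₂) : Form1 M F₃ :=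
  fun m => (L.flip (f m)).comp (α m)

/-- The wedge product of one-forms, for a bilinear pairing of the values. -/
def wedgeForm (L : F₁ →L[ℝ] F₂ →L[ℝ] F₃) (α : Form1 M F₁) (β : Form1 M F₂) : Form2 M F₃ :=
  fun m u v => L (α m u) (β m v) - L (α m v) (β m u)

/-- The product of a two-form and a function, for a bilinear pairing of the values. -/
def mulForm2 (L : F₁ →L[ℝ] F₂ →L[ℝ] F₃) (β : Form2 M F₁) (f : M → F₂) : Form2 M F₃ :=
  fun m u v => L (β m u v) (f m)

omit [TopologicalSpace M] [ChartedSpace E3 M] in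
theorem mulForm1_apply (L : F₁ →L[ℝ] F₂ →L[ℝ] F₃) (α : Form1 M F₁) (f : M → F₂) (m : M) (u : E3) :
    mulForm1 L α f m u = L (α m u) (f m) := rfl

variable [IsManifold (𝓡 3) ∞ M]

theorem IsSmoothForm1.add {α β : Form1 M F} (hα : IsSmoothForm1 α) (hβ : IsSmoothForm1 β) :
    IsSmoothForm1 (α + β) := by
  refine (isSmoothForm1_iff _).2 fun m => ?_
  refine (((isSmoothForm1_iff _).1 hα m).add ((isSmoothForm1_iff _).1 hβ m)).congr_of_eventuallyEq
    (Eventually.of_forall fun y => ?_)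
  rfl

theorem IsSmoothForm1.const_smul {α : Form1 M F} (hα : IsSmoothForm1 α) (c : ℝ) :
    IsSmoothForm1 (c • α) := by
  refine (isSmoothForm1_iff _).2 fun m => ?_
  refine (((isSmoothForm1_iff _).1 hα m).const_smul c).congr_of_eventuallyEq
    (Eventually.of_forall fun y => ?_)
  rfl

theorem IsSmoothForm1.zero : IsSmoothForm1 (0 : Form1 M F) := by
  refine (isSmoothForm1_iff _).2 fun m => ?_
  exact contDiffAt_const (c := 0) |>.congr_of_eventuallyEq
    (Eventually.of_forall fun y => rfl)

theorem IsSmoothForm1.mulForm1 (L : F₁ →L[ℝ] F₂ →L[ℝ] F₃) {α : Form1 M F₁} {f : M → F₂}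
    (hα : IsSmoothForm1 α) (hf : ContMDiff (𝓡 3) 𝓘(ℝ, F₂) ∞ f) :
    IsSmoothForm1 (mulForm1 L α f) := by
  refine (isSmoothForm1_iff _).2 fun m => ?_
  have h1 := (isSmoothForm1_iff _).1 hα m
  have h2 := (contMDiffAt_iff_chart f m).1 (hf m)
  have h3 : ContDiffAt ℝ ∞ (fun y => L.flip ((f ∘ (extChartAt (𝓡 3) m).symm) y))
    (extChartAt (𝓡 3) m m) := L.flip.contDiff.contDiffAt.comp _ h2
  exact h3.clm_comp h1

theorem d1_add {α β : Form1 M F} (hα : IsSmoothForm1 α) (hβ : IsSmoothForm1 β) :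
    d1 (α + β) = d1 α + d1 β := by
  funext m u v
  have e : chartRep (α + β) m = chartRep α m + chartRep β m := by
    funext y
    rfl
  have h1 := ((isSmoothForm1_iff _).1 hα m).differentiableAt (by simp)
  have h2 := ((isSmoothForm1_iff _).1 hβ m).differentiableAt (by simp)
  simp only [d1_eq_chartRep, e, fderiv_add h1 h2, Pi.add_apply, add_apply]
  abel

theorem d1_const_smul {α : Form1 M F} (hα : IsSmoothForm1 α) (c : ℝ) :
    d1 (c • α) = c • d1 α := by
  funext m u v
  have e : chartRep (c • α) m = c • chartRep α m := by
    funext y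
    rfl
  have h1 := ((isSmoothForm1_iff _).1 hα m).differentiableAt (by simp)
  simp only [d1_eq_chartRep, e, fderiv_const_smul h1, Pi.smul_apply, smul_apply,
    smul_sub]

/-- The Leibniz rule for the exterior derivative. -/
theorem d1_mulForm1 (L : F₁ →L[ℝ] F₂ →L[ℝ] F₃) {α : Form1 M F₁} {f : M → F₂}
    (hα : IsSmoothForm1 α) (hf : ContMDiff (𝓡 3) 𝓘(ℝ, F₂) ∞ f) (m : M) (u v : E3) :
    d1 (ExtendedConnection.mulForm1 L α f) m u v =
      L (d1 α m u v) (f m) - (L (α m u) (d0 f m v) - L (α m v) (d0 f m u)) := by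
  have h1 := ((isSmoothForm1_iff _).1 hα m).differentiableAt (by simp)
  have h2 := ((contMDiffAt_iff_chart f m).1 (hf m)).differentiableAt (by simp)
  have h3 : HasFDerivAt (fun y => L.flip ((f ∘ (extChartAt (𝓡 3) m).symm) y))
      (L.flip.comp (fderiv ℝ (f ∘ (extChartAt (𝓡 3) m).symm) (extChartAt (𝓡 3) m m)))
      (extChartAt (𝓡 3) m m) := L.flip.hasFDerivAt.comp _ h2.hasFDerivAt
  have h4 := (h3.clm_comp h1.hasFDerivAt).fderiv
  have e : chartRep (ExtendedConnection.mulForm1 L α f) m = fun y =>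
    (L.flip ((f ∘ (extChartAt (𝓡 3) m).symm) y)).comp (chartRep α m y) := rfl
  have hf0 : (f ∘ (extChartAt (𝓡 3) m).symm) (extChartAt (𝓡 3) m m) = f m := by
    rw [Function.comp_apply, (extChartAt (𝓡 3) m).left_inv (mem_extChartAt_source m)]
  simp only [d1_eq_chartRep, e, h4, d0_eq_fderiv (hf m), hf0]
  simp [← chartRep_self α m]
  abel

theorem IsSmoothForm2.exists_chart {β : Form2 M F} (h : IsSmoothForm2 β) (m : M) :
    ∃ G : E3 → E3 →L[ℝ] E3 →L[ℝ] F, ContDiffAt ℝ ∞ G (extChartAt (𝓡 3) m m) ∧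
      ∀ y u v, G y u v = β ((extChartAt (𝓡 3) m).symm y)
        ((mfderiv 𝓘(ℝ, E3) (𝓡 3) (extChartAt (𝓡 3) m).symm y : E3 →L[ℝ] E3) u)
        ((mfderiv 𝓘(ℝ, E3) (𝓡 3) (extChartAt (𝓡 3) m).symm y : E3 →L[ℝ] E3) v) := by
  obtain ⟨η, h1, h2⟩ := h.exists_pb2
  exact ⟨_, h2 m, fun y u v => (h1 _ _ _).symm⟩

theorem IsSmoothForm2.alt {β : Form2 M F} (h : IsSmoothForm2 β) (m : M) (u : E3) :
    β m u u = 0 := h.choose_spec.2.2 m u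

theorem IsSmoothForm2.add {β γ : Form2 M F} (hβ : IsSmoothForm2 β) (hγ : IsSmoothForm2 γ) :
    IsSmoothForm2 (β + γ) := by
  refine isSmoothForm2_of_chart (fun m => ?_) fun m u => by simp [hβ.alt, hγ.alt]
  obtain ⟨G, hG, h1⟩ := hβ.exists_chart m
  obtain ⟨H, hH, h2⟩ := hγ.exists_chart m
  exact ⟨G + H, hG.add hH, Eventually.of_forall fun y u v =>
    congrArg₂ (· + ·) (h1 y u v) (h2 y u v)⟩

theorem IsSmoothForm2.const_smul {β : Form2 M F} (hβ : IsSmoothForm2 β) (c : ℝ) :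
    IsSmoothForm2 (c • β) := by
  refine isSmoothForm2_of_chart (fun m => ?_) fun m u => by simp [hβ.alt]
  obtain ⟨G, hG, h1⟩ := hβ.exists_chart m
  exact ⟨c • G, hG.const_smul c, Eventually.of_forall fun y u v =>
    congrArg (c • ·) (h1 y u v)⟩

theorem IsSmoothForm2.sub {β γ : Form2 M F} (hβ : IsSmoothForm2 β) (hγ : IsSmoothForm2 γ) :
    IsSmoothForm2 (β - γ) := by
  have := hβ.add (hγ.const_smul (-1))
  rwa [neg_one_smul, ← sub_eq_add_neg] at this

theorem IsSmoothForm2.mulForm2 (L : F₁ →L[ℝ] F₂ →L[ℝ] F₃) {β : Form2 M F₁} {f : M → F₂}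
    (hβ : IsSmoothForm2 β) (hf : ContMDiff (𝓡 3) 𝓘(ℝ, F₂) ∞ f) :
    IsSmoothForm2 (mulForm2 L β f) := by
  refine isSmoothForm2_of_chart (fun m => ?_) fun m u => by
    simp [ExtendedConnection.mulForm2, hβ.alt]
  obtain ⟨G, hG, h1⟩ := hβ.exists_chart m
  have h2 := (contMDiffAt_iff_chart f m).1 (hf m)
  have h3 : ContDiffAt ℝ ∞ (fun y => L.flip ((f ∘ (extChartAt (𝓡 3) m).symm) y))
    (extChartAt (𝓡 3) m m) := L.flip.contDiff.contDiffAt.comp _ h2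
  refine ⟨fun y => (ContinuousLinearMap.compL ℝ E3 F₁ F₃
    (L.flip ((f ∘ (extChartAt (𝓡 3) m).symm) y))).comp (G y), contDiffAt_clm_of_apply fun u => ?_,
    Eventually.of_forall fun y u v =>
      congrArg (fun z => L z (f ((extChartAt (𝓡 3) m).symm y))) (h1 y u v)⟩
  exact h3.clm_comp (hG.clm_apply contDiffAt_const)

theorem isSmoothForm2_wedgeForm (L : F₁ →L[ℝ] F₂ →L[ℝ] F₃) {α : Form1 M F₁} {β : Form1 M F₂}
    (hα : IsSmoothForm1 α) (hβ : IsSmoothForm1 β) : IsSmoothForm2 (wedgeForm L α β) := by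
  refine isSmoothForm2_of_chart (fun m => ?_) fun m u => by simp [wedgeForm]
  have h1 := (isSmoothForm1_iff _).1 hα m
  have h2 := (isSmoothForm1_iff _).1 hβ m
  have h3 : ContDiffAt ℝ ∞ (fun y => (L.comp (chartRep α m y)).flip) (extChartAt (𝓡 3) m m) :=
    contDiffAt_flip (contDiffAt_const.clm_comp h1)
  have h4 := h3.clm_comp h2
  exact ⟨_, (contDiffAt_flip h4).sub h4, Eventually.of_forall fun y u v => rfl⟩

theorem isSmoothForm2_d1 {α : Form1 M F} (hα : IsSmoothForm1 α) : IsSmoothForm2 (d1 α) := by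
  refine isSmoothForm2_of_chart (fun m => ?_) fun m u => by simp [d1]
  have h1 := ((isSmoothForm1_iff _).1 hα m).fderiv_right (m := ∞) (by norm_cast)
  refine ⟨_, h1.sub (contDiffAt_flip h1), ?_⟩
  filter_upwards [extChartAt_target_mem_nhds (I := 𝓡 3) m] with y hy u v
  rw [d1_pb hα (contMDiffAt_chart_symm hy)]
  rfl

end Algebra

/-! ### Means over a period. -/

section Mean

/-- The mean value over a period of the circle. -/
def mean (g : ℝ → ℝ) : ℝ := (2 * Real.pi)⁻¹ * ∫ θ in (0 : ℝ)..(2 * Real.pi), g θ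

theorem mean_add {f g : ℝ → ℝ} (hf : Continuous f) (hg : Continuous g) :
    mean (fun θ => f θ + g θ) = mean f + mean g := by
  rw [mean, intervalIntegral.integral_add (hf.intervalIntegrable _ _) (hg.intervalIntegrable _ _),
    mul_add]
  rfl

theorem mean_sub {f g : ℝ → ℝ} (hf : Continuous f) (hg : Continuous g) :
    mean (fun θ => f θ - g θ) = mean f - mean g := by
  rw [mean, intervalIntegral.integral_sub (hf.intervalIntegrable _ _) (hg.intervalIntegrable _ _),
    mul_sub]
  rfl

theorem mean_const_mul (c : ℝ) (f : ℝ → ℝ) : mean (fun θ => c * f θ) = c * mean f := by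
  simp only [mean, intervalIntegral.integral_const_mul]
  ring

theorem mean_const (c : ℝ) : mean (fun _ => c) = c := by
  have : Real.pi ≠ 0 := Real.pi_ne_zero
  simp only [mean, intervalIntegral.integral_const, smul_eq_mul, sub_zero]
  field_simp

theorem mean_shift {f : ℝ → ℝ} (hf : Function.Periodic f (2 * Real.pi)) (η : ℝ) :
    mean (fun θ => f (θ + η)) = mean f := by
  have h := hf.intervalIntegral_add_eq η 0
  rw [mean, mean, intervalIntegral.integral_comp_add_right, zero_add, add_comm (2 * Real.pi) η, h,
    zero_add]

/-- The fundamental theorem of calculus over a full period. Every integration by parts along the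
fibres comes from here. -/
theorem mean_deriv {G g : ℝ → ℝ} (h : ∀ θ, HasDerivAt G (g θ) θ) (hg : Continuous g)
    (hG : Function.Periodic G (2 * Real.pi)) : mean g = 0 := by
  rw [mean, intervalIntegral.integral_eq_sub_of_hasDerivAt (fun θ _ => h θ)
    (hg.intervalIntegrable _ _)]
  have := hG 0
  rw [zero_add] at this
  rw [this]
  simp

theorem mean_nonneg {f : ℝ → ℝ} (hf : ∀ θ, 0 ≤ f θ) : 0 ≤ mean f :=
  mul_nonneg (by positivity) (intervalIntegral.integral_nonneg (by positivity) fun θ _ => hf θ)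

/-- By continuity, strict positivity at the single time `0` suffices; the application is at a point
where a bump function equals one. -/
theorem mean_pos {f : ℝ → ℝ} (hc : Continuous f) (hf : ∀ θ, 0 ≤ f θ) (h0 : 0 < f 0) :
    0 < mean f := by
  refine mul_pos (by positivity) ?_
  exact intervalIntegral.integral_pos (by positivity) hc.continuousOn (fun θ _ => hf θ)
    ⟨0, ⟨le_rfl, by positivity⟩, h0⟩

end Mean

section ApplyIntegral

variable {E₁ E₂ F : Type*} [NormedAddCommGroup E₁] [NormedSpace ℝ E₁] [NormedAddCommGroup E₂]
  [NormedSpace ℝ E₂] [NormedAddCommGroup F] [NormedSpace ℝ F]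

theorem intervalIntegral_clm_apply [CompleteSpace F] {Q : ℝ → E₁ →L[ℝ] F}
    (hQ : Continuous Q) (a b : ℝ) (u : E₁) :
    (∫ θ in a..b, Q θ) u = ∫ θ in a..b, Q θ u :=
  ContinuousLinearMap.intervalIntegral_apply (hQ.intervalIntegrable a b) u

set_option synthInstance.maxHeartbeats 400000 in
theorem intervalIntegral_apply₂ [CompleteSpace F] {Q : ℝ → E₁ →L[ℝ] E₂ →L[ℝ] F}
    (hQ : Continuous Q) (a b : ℝ) (u : E₁) (v : E₂) :
    (∫ θ in a..b, Q θ) u v = ∫ θ in a..b, Q θ u v := by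
  have h1 := intervalIntegral_clm_apply hQ a b u
  have h2 := intervalIntegral_clm_apply (hQ.clm_apply continuous_const) a b v (Q := fun θ => Q θ u)
  rw [h1, h2]

end ApplyIntegral

/-! ### The averaging operator on functions and forms. -/

section Averages

variable {M : Type*} [TopologicalSpace M] [ChartedSpace E3 M] [MulAction Circle M]
variable {F : Type*} [NormedAddCommGroup F] [NormedSpace ℝ F]

omit [TopologicalSpace M] [ChartedSpace E3 M] in
theorem avg0_apply (f : M → ℝ) (m : M) : avg0 f m = mean fun θ => f (rot θ m) := rfl

theorem avg2_apply (β : Form2 M ℝ) (m : M) (u v : E3) :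
    avg2 β m u v = mean fun θ => pull2 θ β m u v := rfl

omit [TopologicalSpace M] [ChartedSpace E3 M] in
theorem avg0_rot (f : M → ℝ) (η : ℝ) (m : M) : avg0 f (rot η m) = avg0 f m := by
  simp only [avg0_apply, rot_rot]
  exact mean_shift (f := fun θ => f (rot θ m)) (fun θ => by simp only [rot_add_two_pi]) η

omit [TopologicalSpace M] [ChartedSpace E3 M] in
theorem avg0_smul (f : M → ℝ) (t : Circle) (m : M) : avg0 f (t • m) = avg0 f m := by
  obtain ⟨θ, hθ⟩ := exists_rot (M := M) t
  rw [hθ, avg0_rot]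

omit [NormedAddCommGroup F] [NormedSpace ℝ F] in
theorem pull2_add_two_pi (θ : ℝ) (β : Form2 M F) : pull2 (θ + 2 * Real.pi) β = pull2 θ β := by
  funext m u v
  rw [pull2, pull2, dRot_add_two_pi, rot_add_two_pi]

variable [ContMDiffSMul (𝓡 1) (𝓡 3) ∞ Circle M]

omit [NormedAddCommGroup F] [NormedSpace ℝ F] in
theorem pull2_pull2 (θ η : ℝ) (β : Form2 M F) : pull2 θ (pull2 η β) = pull2 (η + θ) β := by
  funext m u v
  simp only [pull2, dRot_dRot, rot_rot]

theorem isInvariant2_avg2 (β : Form2 M ℝ) : IsInvariant2 (avg2 β) := fun η => by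
  funext m u v
  have h (θ : ℝ) : pull2 θ β (rot η m) (dRot η m u) (dRot η m v) = pull2 (θ + η) β m u v := by
    rw [← pull2_pull2]; rfl
  rw [pull2, avg2_apply, avg2_apply]
  simp only [h]
  exact mean_shift (f := fun θ => pull2 θ β m u v) (fun θ => by simp only [pull2_add_two_pi]) η

omit [NormedSpace ℝ F] in
theorem isHorizontal2_pull2 {β : Form2 M F} (hβ : IsHorizontal2 β) (θ : ℝ) :
    IsHorizontal2 (pull2 θ β) := fun m v => by
  rw [pull2, dRot_genR, hβ]

theorem isHorizontal2_avg2 {β : Form2 M ℝ} (hβ : IsHorizontal2 β) : IsHorizontal2 (avg2 β) :=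
  fun m v => by
    rw [avg2_apply]
    simp only [isHorizontal2_pull2 hβ _ m v, mean_const]

variable [IsManifold (𝓡 3) ∞ M]

omit [IsManifold (𝓡 3) ∞ M] in
theorem continuous_rot_apply {f : M → F} (hf : ContMDiff (𝓡 3) 𝓘(ℝ, F) ∞ f) (m : M) :
    Continuous fun θ => f (rot θ m) :=
  hf.continuous.comp (contMDiff_orbit m).continuous

theorem IsSmoothForm1.continuous_pull1 {α : Form1 M F} (hα : IsSmoothForm1 α) (m : M) :
    Continuous fun θ => ExtendedConnection.pull1 θ α m :=
  continuous_iff_continuousAt.2 fun θ => (hα.hasDerivAt_pull1 θ m).continuousAt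

theorem avg1_apply {α : Form1 M ℝ} (hα : IsSmoothForm1 α) (m : M) (u : E3) :
    avg1 α m u = mean fun θ => pull1 θ α m u := by
  have h := ContinuousLinearMap.intervalIntegral_comp_comm (𝕜 := ℝ)
    (ContinuousLinearMap.apply ℝ ℝ u : (E3 →L[ℝ] ℝ) →L[ℝ] ℝ)
    ((hα.continuous_pull1 m).intervalIntegrable (μ := MeasureTheory.volume) 0 (2 * Real.pi))
  simp only [ContinuousLinearMap.apply_apply] at h
  rw [mean, h]
  rfl

theorem isInvariant1_avg1 {α : Form1 M ℝ} (hα : IsSmoothForm1 α) : IsInvariant1 (avg1 α) :=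
  fun η => by
    funext m
    ext u
    have h (θ : ℝ) : pull1 θ α (rot η m) (dRot η m u) = pull1 (θ + η) α m u := by
      rw [← pull1_pull1]; rfl
    rw [pull1, ContinuousLinearMap.comp_apply, avg1_apply hα, avg1_apply hα]
    simp only [h]
    exact mean_shift (f := fun θ => pull1 θ α m u) (fun θ => by simp only [pull1_add_two_pi]) η

omit [IsManifold (𝓡 3) ∞ M] in
theorem isHorizontal1_pull1 {α : Form1 M F} (hα : IsHorizontal1 α) (θ : ℝ) :
    IsHorizontal1 (pull1 θ α) := fun m => by
  rw [pull1, ContinuousLinearMap.comp_apply, dRot_genR, hα]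

theorem isHorizontal1_avg1 {α : Form1 M ℝ} (hα : IsSmoothForm1 α) (h : IsHorizontal1 α) :
    IsHorizontal1 (avg1 α) := fun m => by
  rw [avg1_apply hα]
  simp only [isHorizontal1_pull1 h _ m, mean_const]

/-- The generator is invariant, so the whole curve `pull1 θ α m (genR m)` vanishes, and with it its
derivative. -/
theorem isHorizontal1_lie1 {α : Form1 M F} (hα : IsSmoothForm1 α) (h : IsHorizontal1 α) :
    IsHorizontal1 (lie1 α) := fun m => by
  have h1 := (hα.hasDerivAt_pull1 0 m).clm_apply (hasDerivAt_const 0 (genR m))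
  simp only [isHorizontal1_pull1 h _ m, pull1_zero, map_zero, add_zero] at h1
  exact h1.unique (hasDerivAt_const 0 0)

theorem chartRep_avg1 {α : Form1 M ℝ} (hα : IsSmoothForm1 α) {m : M} {y : E3}
    (hy : y ∈ (extChartAt (𝓡 3) m).target) :
    chartRep (avg1 α) m y = (2 * Real.pi)⁻¹ • ∫ θ in (0 : ℝ)..(2 * Real.pi),
      (pb (rotMap (extChartAt (𝓡 3) m).symm) α (θ, y)).comp
        (ContinuousLinearMap.inr ℝ ℝ E3) := by
  simp only [← chartRep_pull1 α _ hy]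
  let D : E3 →L[ℝ] E3 := mfderiv 𝓘(ℝ, E3) (𝓡 3) (extChartAt (𝓡 3) m).symm y
  have h := ContinuousLinearMap.intervalIntegral_comp_comm (𝕜 := ℝ)
    ((ContinuousLinearMap.compL ℝ E3 E3 ℝ).flip D)
    ((hα.continuous_pull1 ((extChartAt (𝓡 3) m).symm y)).intervalIntegrable
      (μ := MeasureTheory.volume) 0 (2 * Real.pi))
  simp only [ContinuousLinearMap.flip_apply, ContinuousLinearMap.compL_apply] at h
  exact congrArg ((2 * Real.pi)⁻¹ • ·) h.symm

theorem isSmoothForm1_avg1 {α : Form1 M ℝ} (hα : IsSmoothForm1 α) : IsSmoothForm1 (avg1 α) := by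
  refine (isSmoothForm1_iff _).2 fun m => ?_
  have h := (contDiffOn_intervalIntegral (isOpen_extChartAt_target m)
    (fun θ y hy => hα.contDiffAt_pull1_param θ hy) 0 (2 * Real.pi)).contDiffAt
    (extChartAt_target_mem_nhds m)
  refine (h.const_smul (2 * Real.pi)⁻¹).congr_of_eventuallyEq ?_
  filter_upwards [extChartAt_target_mem_nhds (I := 𝓡 3) m] with y hy using chartRep_avg1 hα hy

/-- Averaging commutes with the exterior derivative of one-forms. -/
theorem d1_avg1 {α : Form1 M ℝ} (hα : IsSmoothForm1 α) : d1 (avg1 α) = avg2 (d1 α) := by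
  funext m u v
  have hP := hasFDerivAt_intervalIntegral (isOpen_extChartAt_target m)
    (fun θ y hy => hα.contDiffAt_pull1_param θ hy) 0 (2 * Real.pi) (mem_extChartAt_target m)
  have hc : Continuous fun θ : ℝ => (fderiv ℝ (fun p : ℝ × E3 =>
        (pb (rotMap (extChartAt (𝓡 3) m).symm) α p).comp (ContinuousLinearMap.inr ℝ ℝ E3))
        (θ, extChartAt (𝓡 3) m m)).comp (ContinuousLinearMap.inr ℝ ℝ E3) :=
    continuous_iff_continuousAt.2 fun θ => ContinuousAt.comp (f := fun θ : ℝ => (θ, _))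
      ((((hα.contDiffAt_pull1_param θ (mem_extChartAt_target m)).fderiv_right (m := ∞)
        (by norm_cast)).clm_comp contDiffAt_const).continuousAt)
      (Continuous.prodMk_left _).continuousAt
  have e : chartRep (avg1 α) m =ᶠ[𝓝 (extChartAt (𝓡 3) m m)] fun y =>
      (2 * Real.pi)⁻¹ • ∫ θ in (0 : ℝ)..(2 * Real.pi),
        (pb (rotMap (extChartAt (𝓡 3) m).symm) α (θ, y)).comp
          (ContinuousLinearMap.inr ℝ ℝ E3) := by
    filter_upwards [extChartAt_target_mem_nhds (I := 𝓡 3) m] with y hy using chartRep_avg1 hα hy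
  -- Differentiation under the integral sign; the antisymmetrization is carried into the mean
  -- afterwards.
  have key (u v : E3) : fderiv ℝ (chartRep (avg1 α) m) (extChartAt (𝓡 3) m m) u v =
      mean fun θ => fderiv ℝ (chartRep (pull1 θ α) m) (extChartAt (𝓡 3) m m) u v := by
    have h0 : fderiv ℝ (fun y => (2 * Real.pi)⁻¹ • ∫ θ in (0 : ℝ)..(2 * Real.pi),
        (pb (rotMap (extChartAt (𝓡 3) m).symm) α (θ, y)).comp
          (ContinuousLinearMap.inr ℝ ℝ E3)) (extChartAt (𝓡 3) m m) = _ :=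
      (hP.const_smul (2 * Real.pi)⁻¹).fderiv
    rw [e.fderiv_eq, h0]
    simp only [mean, fderiv_chartRep_pull1 hα]
    exact congrArg ((2 * Real.pi)⁻¹ * ·) (intervalIntegral_apply₂ hc 0 (2 * Real.pi) u v)
  have hcont (u v : E3) : Continuous fun θ =>
      fderiv ℝ (chartRep (pull1 θ α) m) (extChartAt (𝓡 3) m m) u v := by
    simp only [fderiv_chartRep_pull1 hα]
    exact (hc.clm_apply continuous_const).clm_apply continuous_const
  rw [d1_eq_chartRep, key, key, ← mean_sub (hcont u v) (hcont v u), avg2_apply]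
  simp only [pull2_d1 hα, d1_eq_chartRep]

/-- Both claims come from the same parameter integral. The formula for `d` turns the differential of
the central cocycle, an averaged function, into an averaged one-form. -/
theorem contMDiff_avg0_and_d0 {f : M → ℝ} (hf : ContMDiff (𝓡 3) 𝓘(ℝ, ℝ) ∞ f) :
    ContMDiff (𝓡 3) 𝓘(ℝ, ℝ) ∞ (avg0 f) ∧ d0 (avg0 f) = avg1 (d0 f) := by
  have hG (m : M) (θ : ℝ) (y : E3) (hy : y ∈ (extChartAt (𝓡 3) m).target) :
      ContDiffAt ℝ ∞ (f ∘ rotMap (extChartAt (𝓡 3) m).symm) (θ, y) :=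
    contMDiffAt_iff_contDiffAt.1 (hf.contMDiffAt.comp _
      (contMDiffAt_rotMap (contMDiffAt_chart_symm hy)))
  have hs : ContMDiff (𝓡 3) 𝓘(ℝ, ℝ) ∞ (avg0 f) := fun m => by
    refine (contMDiffAt_iff_chart _ _).2 ?_
    have h := (contDiffOn_intervalIntegral (isOpen_extChartAt_target m) (hG m)
      0 (2 * Real.pi)).contDiffAt (extChartAt_target_mem_nhds m)
    exact contDiffAt_const.mul h
  refine ⟨hs, ?_⟩
  funext m
  ext u
  have hP := hasFDerivAt_intervalIntegral (isOpen_extChartAt_target m)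
    (hG m) 0 (2 * Real.pi) (mem_extChartAt_target m)
  rw [avg1_apply (isSmoothForm1_d0 hf), d0_eq_fderiv (hs m)]
  have h2 := hP.const_smul (2 * Real.pi)⁻¹
  have h3 : fderiv ℝ (avg0 f ∘ (extChartAt (𝓡 3) m).symm) (extChartAt (𝓡 3) m m) = _ := h2.fderiv
  have hc : Continuous fun θ : ℝ => (fderiv ℝ (f ∘ rotMap (extChartAt (𝓡 3) m).symm)
        (θ, extChartAt (𝓡 3) m m)).comp (ContinuousLinearMap.inr ℝ ℝ E3) :=
    continuous_iff_continuousAt.2 fun θ => ContinuousAt.comp (f := fun θ : ℝ => (θ, _))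
      ((((hG m θ _ (mem_extChartAt_target m)).fderiv_right (m := ∞)
        (by norm_cast)).clm_comp contDiffAt_const).continuousAt)
      (Continuous.prodMk_left _).continuousAt
  have h1 := ContinuousLinearMap.intervalIntegral_comp_comm (𝕜 := ℝ)
      (ContinuousLinearMap.apply ℝ ℝ u : (E3 →L[ℝ] ℝ) →L[ℝ] ℝ)
      (hc.intervalIntegrable (μ := MeasureTheory.volume) 0 (2 * Real.pi))
  rw [h3]
  refine (congrArg ((2 * Real.pi)⁻¹ * ·) h1.symm).trans ?_
  refine congrArg mean (funext fun θ => ?_)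
  have h4 := pb_d0 (Φ := rotMap (extChartAt (𝓡 3) m).symm) (y := (θ, extChartAt (𝓡 3) m m))
    (contMDiffAt_rotMap (contMDiffAt_chart_symm (mem_extChartAt_target m))) (hf _)
  rw [← h4, pull1_eq_param]
  rfl

theorem IsSmoothForm2.continuous_pull2 {β : Form2 M F} (hβ : IsSmoothForm2 β) (m : M) (u v : E3) :
    Continuous fun θ => pull2 θ β m u v := by
  obtain ⟨η, h1, h2⟩ := hβ.exists_pb2
  have hψ := contMDiffAt_chart_symm (mem_extChartAt_target (I := 𝓡 3) m)
  -- The rotated form at `m` is the pull-back along `rotMap` evaluated on purely spatial vectors,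
  -- and this depends smoothly on time.
  have e (θ : ℝ) : pull2 θ β m u v = pb2 (rotMap (extChartAt (𝓡 3) m).symm) η
      (θ, extChartAt (𝓡 3) m m) (0, u) (0, v) := by
    have hu (u : E3) := mfderiv_rotMap_inr (θ := θ) hψ u
    simp only [mfderiv_chart_symm_self, (extChartAt (𝓡 3) m).left_inv
      (mem_extChartAt_source m)] at hu
    rw [pull2, h1]
    refine Eq.symm (Eq.trans (congrArg₂ (fun a b => η (rotMap (extChartAt (𝓡 3) m).symm
      (θ, extChartAt (𝓡 3) m m)) a b) (hu u) (hu v)) ?_)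
    rw [rotMap, (extChartAt (𝓡 3) m).left_inv (mem_extChartAt_source m)]
    rfl
  simp only [e]
  refine continuous_iff_continuousAt.2 fun θ => ContinuousAt.comp (f := fun θ : ℝ => (θ, _))
    (g := fun p => pb2 (rotMap (extChartAt (𝓡 3) m).symm) η p (0, u) (0, v)) ?_
    (Continuous.prodMk_left _).continuousAt
  exact (((contDiffAt_pb2 h2 (contMDiffAt_rotMap hψ)).clm_apply contDiffAt_const).clm_apply
    contDiffAt_const).continuousAt

set_option synthInstance.maxHeartbeats 400000 in
theorem isSmoothForm2_avg2 {β : Form2 M ℝ} (hβ : IsSmoothForm2 β) : IsSmoothForm2 (avg2 β) := by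
  obtain ⟨η, h1, h2⟩ := hβ.exists_pb2
  refine isSmoothForm2_of_chart (fun m => ?_) fun m u => by
    simp only [avg2_apply, pull2, hβ.alt, mean_const]
  let Q : ℝ × E3 → E3 →L[ℝ] E3 →L[ℝ] ℝ := fun p =>
    (pb2 (rotMap (extChartAt (𝓡 3) m).symm) η p).bilinearComp (ContinuousLinearMap.inr ℝ ℝ E3)
      (ContinuousLinearMap.inr ℝ ℝ E3)
  have hQ (θ : ℝ) (y : E3) (hy : y ∈ (extChartAt (𝓡 3) m).target) : ContDiffAt ℝ ∞ Q (θ, y) := by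
    have h3 := contDiffAt_pb2 h2 (contMDiffAt_rotMap (θ := θ) (contMDiffAt_chart_symm hy))
    have h4 : ContDiffAt ℝ ∞ (fun p => (pb2 (rotMap (extChartAt (𝓡 3) m).symm) η p).comp
      (ContinuousLinearMap.inr ℝ ℝ E3)) (θ, y) := h3.clm_comp contDiffAt_const
    exact contDiffAt_flip ((contDiffAt_flip h4).clm_comp contDiffAt_const)
  refine ⟨fun y => (2 * Real.pi)⁻¹ • ∫ θ in (0 : ℝ)..(2 * Real.pi), Q (θ, y),
    ((contDiffOn_intervalIntegral (isOpen_extChartAt_target m) hQ 0 (2 * Real.pi)).contDiffAt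
      (extChartAt_target_mem_nhds m)).const_smul _, ?_⟩
  filter_upwards [extChartAt_target_mem_nhds (I := 𝓡 3) m] with y hy u v
  have hc : Continuous fun θ => Q (θ, y) := continuous_iff_continuousAt.2 fun θ =>
    ContinuousAt.comp (f := fun θ : ℝ => (θ, y)) (hQ θ y hy).continuousAt
      (Continuous.prodMk_left y).continuousAt
  refine (congrArg ((2 * Real.pi)⁻¹ * ·) (intervalIntegral_apply₂ hc 0 (2 * Real.pi) u v)).trans ?_
  refine congrArg mean (funext fun θ => ?_)
  have hu (u : E3) := mfderiv_rotMap_inr (θ := θ) (contMDiffAt_chart_symm hy) u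
  refine Eq.trans (congrArg₂ (fun a b => η (rotMap (extChartAt (𝓡 3) m).symm (θ, y)) a b)
    (hu u) (hu v)) (h1 _ _ _).symm

end Averages

/-! ### Lie derivatives of products, wedges and exterior derivatives. -/

section LieCalculus

variable {M : Type*} [TopologicalSpace M] [ChartedSpace E3 M]
variable {F : Type*} [NormedAddCommGroup F] [NormedSpace ℝ F]
variable {F₁ : Type*} [NormedAddCommGroup F₁] [NormedSpace ℝ F₁]
variable {F₂ : Type*} [NormedAddCommGroup F₂] [NormedSpace ℝ F₂]
variable {F₃ : Type*} [NormedAddCommGroup F₃] [NormedSpace ℝ F₃]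

theorem hasDerivAt_bilin (L : F₁ →L[ℝ] F₂ →L[ℝ] F₃) {f : ℝ → F₁} {g : ℝ → F₂} {f' : F₁} {g' : F₂}
    {t : ℝ} (hf : HasDerivAt f f' t) (hg : HasDerivAt g g' t) :
    HasDerivAt (fun t => L (f t) (g t)) (L f' (g t) + L (f t) g') t :=
  (L.hasFDerivAt.comp_hasDerivAt t hf).clm_apply hg

theorem contMDiff_bilin (L : F₁ →L[ℝ] F₂ →L[ℝ] F₃) {f : M → F₁} {g : M → F₂}
    (hf : ContMDiff (𝓡 3) 𝓘(ℝ, F₁) ∞ f) (hg : ContMDiff (𝓡 3) 𝓘(ℝ, F₂) ∞ g) :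
    ContMDiff (𝓡 3) 𝓘(ℝ, F₃) ∞ (fun m => L (f m) (g m)) :=
  ContDiff.comp_contMDiff (g := fun p : F₁ × F₂ => L p.1 p.2) L.isBoundedBilinearMap.contDiff
    (hf.prodMk_space hg)

theorem d0_add {f g : M → F} (hf : ContMDiff (𝓡 3) 𝓘(ℝ, F) ∞ f)
    (hg : ContMDiff (𝓡 3) 𝓘(ℝ, F) ∞ g) : d0 (fun m => f m + g m) = d0 f + d0 g := by
  funext m
  exact mfderiv_add (hf.mdifferentiable (by simp) m) (hg.mdifferentiable (by simp) m)

theorem d0_const_smul {f : M → F} (hf : ContMDiff (𝓡 3) 𝓘(ℝ, F) ∞ f) (c : ℝ) :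
    d0 (fun m => c • f m) = c • d0 f := by
  funext m
  exact const_smul_mfderiv (hf.mdifferentiable (by simp) m) c

variable [IsManifold (𝓡 3) ∞ M]

theorem IsSmoothForm1.sub {α β : Form1 M F} (hα : IsSmoothForm1 α) (hβ : IsSmoothForm1 β) :
    IsSmoothForm1 (α - β) := by
  have := hα.add (hβ.const_smul (-1))
  rwa [neg_one_smul, ← sub_eq_add_neg] at this

theorem d0_bilin (L : F₁ →L[ℝ] F₂ →L[ℝ] F₃) {f : M → F₁} {g : M → F₂}
    (hf : ContMDiff (𝓡 3) 𝓘(ℝ, F₁) ∞ f) (hg : ContMDiff (𝓡 3) 𝓘(ℝ, F₂) ∞ g) (m : M) (u : E3) :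
    d0 (fun m => L (f m) (g m)) m u = L (d0 f m u) (g m) + L (f m) (d0 g m u) := by
  have h1 := ((contMDiffAt_iff_chart f m).1 (hf m)).differentiableAt (by simp)
  have h2 := ((contMDiffAt_iff_chart g m).1 (hg m)).differentiableAt (by simp)
  have h3 := L.hasFDerivAt_of_bilinear h1.hasFDerivAt h2.hasFDerivAt
  have h4 := h3.fderiv
  have hs (f : M → F₁) : (f ∘ (extChartAt (𝓡 3) m).symm) (extChartAt (𝓡 3) m m) = f m := by
    rw [Function.comp_apply, (extChartAt (𝓡 3) m).left_inv (mem_extChartAt_source m)]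
  have hs' (f : M → F₂) : (f ∘ (extChartAt (𝓡 3) m).symm) (extChartAt (𝓡 3) m m) = f m := by
    rw [Function.comp_apply, (extChartAt (𝓡 3) m).left_inv (mem_extChartAt_source m)]
  rw [hs, hs'] at h4
  rw [d0_eq_fderiv (contMDiff_bilin L hf hg m), d0_eq_fderiv (hf m), d0_eq_fderiv (hg m)]
  refine (congrArg (· u) h4).trans ?_
  simp [add_comm]

variable [MulAction Circle M] [ContMDiffSMul (𝓡 1) (𝓡 3) ∞ Circle M]

omit [IsManifold (𝓡 3) ∞ M] in
theorem lie0_bilin (L : F₁ →L[ℝ] F₂ →L[ℝ] F₃) {f : M → F₁} {g : M → F₂}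
    (hf : ContMDiff (𝓡 3) 𝓘(ℝ, F₁) ∞ f) (hg : ContMDiff (𝓡 3) 𝓘(ℝ, F₂) ∞ g) (m : M) :
    lie0 (fun m => L (f m) (g m)) m = L (lie0 f m) (g m) + L (f m) (lie0 g m) := by
  have h1 := hasDerivAt_comp_rot hf 0 m
  have h2 := hasDerivAt_comp_rot hg 0 m
  have h3 := hasDerivAt_bilin L h1 h2
  simp only [rot_zero] at h3
  exact h3.deriv

omit [IsManifold (𝓡 3) ∞ M] in
theorem lie0_add {f g : M → F} (hf : ContMDiff (𝓡 3) 𝓘(ℝ, F) ∞ f)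
    (hg : ContMDiff (𝓡 3) 𝓘(ℝ, F) ∞ g) (m : M) :
    lie0 (fun m => f m + g m) m = lie0 f m + lie0 g m := by
  have h3 := (hasDerivAt_comp_rot hf 0 m).add (hasDerivAt_comp_rot hg 0 m)
  simp only [rot_zero] at h3
  exact h3.deriv

omit [IsManifold (𝓡 3) ∞ M] in
theorem lie0_sub {f g : M → F} (hf : ContMDiff (𝓡 3) 𝓘(ℝ, F) ∞ f)
    (hg : ContMDiff (𝓡 3) 𝓘(ℝ, F) ∞ g) (m : M) :
    lie0 (fun m => f m - g m) m = lie0 f m - lie0 g m := by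
  have h3 := (hasDerivAt_comp_rot hf 0 m).sub (hasDerivAt_comp_rot hg 0 m)
  simp only [rot_zero] at h3
  exact h3.deriv

omit [IsManifold (𝓡 3) ∞ M] in
theorem lie0_const_smul {f : M → F} (hf : ContMDiff (𝓡 3) 𝓘(ℝ, F) ∞ f) (c : ℝ) (m : M) :
    lie0 (fun m => c • f m) m = c • lie0 f m := by
  have h3 := (hasDerivAt_comp_rot hf 0 m).const_smul c
  simp only [rot_zero] at h3
  exact h3.deriv

omit [TopologicalSpace M] [ChartedSpace E3 M] [IsManifold (𝓡 3) ∞ M]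
  [ContMDiffSMul (𝓡 1) (𝓡 3) ∞ Circle M] in
theorem lie0_of_invariant {f : M → F} (h : ∀ (t : Circle) (m : M), f (t • m) = f m) :
    lie0 f = 0 := by
  funext m
  have e : (fun θ : ℝ => f (rot θ m)) = fun _ => f m := funext fun θ => h _ m
  rw [lie0, e, deriv_const]
  rfl

theorem lie1_apply_hasDerivAt {α : Form1 M F} (hα : IsSmoothForm1 α) (θ : ℝ) (m : M) (u : E3) :
    HasDerivAt (fun θ => pull1 θ α m u) (pull1 θ (lie1 α) m u) θ := by
  have h := (hα.hasDerivAt_pull1 θ m).clm_apply (hasDerivAt_const θ u)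
  simpa using h

theorem lie1_add {α β : Form1 M F} (hα : IsSmoothForm1 α) (hβ : IsSmoothForm1 β) :
    lie1 (α + β) = lie1 α + lie1 β := by
  funext m
  have h := (hα.hasDerivAt_pull1 0 m).add (hβ.hasDerivAt_pull1 0 m)
  simp only [pull1_zero] at h
  exact h.deriv

theorem lie1_const_smul {α : Form1 M F} (hα : IsSmoothForm1 α) (c : ℝ) :
    lie1 (c • α) = c • lie1 α := by
  funext m
  have h := (hα.hasDerivAt_pull1 0 m).const_smul c
  simp only [pull1_zero] at h
  exact h.deriv

theorem lie1_sub {α β : Form1 M F} (hα : IsSmoothForm1 α) (hβ : IsSmoothForm1 β) :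
    lie1 (α - β) = lie1 α - lie1 β := by
  funext m
  have h := (hα.hasDerivAt_pull1 0 m).sub (hβ.hasDerivAt_pull1 0 m)
  simp only [pull1_zero] at h
  exact h.deriv

theorem lie1_mulForm1 (L : F₁ →L[ℝ] F₂ →L[ℝ] F₃) {α : Form1 M F₁} {f : M → F₂}
    (hα : IsSmoothForm1 α) (hf : ContMDiff (𝓡 3) 𝓘(ℝ, F₂) ∞ f) :
    lie1 (mulForm1 L α f) = mulForm1 L (lie1 α) f + mulForm1 L α (lie0 f) := by
  funext m
  ext u
  have h := hasDerivAt_bilin L (lie1_apply_hasDerivAt hα 0 m u) (hasDerivAt_comp_rot hf 0 m)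
  have h' := lie1_apply_hasDerivAt (hα.mulForm1 L hf) 0 m u
  simp only [pull1_zero, rot_zero] at h h'
  exact h'.unique h

omit [ContMDiffSMul (𝓡 1) (𝓡 3) ∞ Circle M] [IsManifold (𝓡 3) ∞ M] in
theorem lie1_of_invariant {α : Form1 M F} (h : IsInvariant1 α) : lie1 α = 0 := by
  funext m
  simp only [lie1, h _, deriv_const]
  rfl

omit [IsManifold (𝓡 3) ∞ M] in
theorem isInvariant1_d0 {f : M → F} (hf : ContMDiff (𝓡 3) 𝓘(ℝ, F) ∞ f)
    (h : ∀ (t : Circle) (m : M), f (t • m) = f m) : IsInvariant1 (d0 f) := fun θ => by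
  rw [pull1_d0 hf]
  exact congrArg d0 (funext fun m => h _ m)

omit [IsManifold (𝓡 3) ∞ M] in
theorem isHorizontal1_d0 {f : M → F} (hf : ContMDiff (𝓡 3) 𝓘(ℝ, F) ∞ f)
    (h : ∀ (t : Circle) (m : M), f (t • m) = f m) : IsHorizontal1 (d0 f) := fun m => by
  rw [← lie0_eq hf, lie0_of_invariant h]
  rfl

theorem isInvariant2_d1 {α : Form1 M F} (hα : IsSmoothForm1 α) (h : IsInvariant1 α) :
    IsInvariant2 (d1 α) := fun θ => by rw [pull2_d1 hα, h]

/-- The two-form `γ'` is the Lie derivative of `γ` along the generator of the action. -/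
def IsLieDeriv2 (γ γ' : Form2 M F) : Prop :=
  ∀ m u v θ, HasDerivAt (fun θ => pull2 θ γ m u v) (pull2 θ γ' m u v) θ

omit [ContMDiffSMul (𝓡 1) (𝓡 3) ∞ Circle M] [IsManifold (𝓡 3) ∞ M] in
theorem IsLieDeriv2.add {β β' γ γ' : Form2 M F} (hβ : IsLieDeriv2 β β') (hγ : IsLieDeriv2 γ γ') :
    IsLieDeriv2 (β + γ) (β' + γ') := fun m u v θ => (hβ m u v θ).add (hγ m u v θ)

omit [ContMDiffSMul (𝓡 1) (𝓡 3) ∞ Circle M] [IsManifold (𝓡 3) ∞ M] in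
theorem IsLieDeriv2.sub {β β' γ γ' : Form2 M F} (hβ : IsLieDeriv2 β β') (hγ : IsLieDeriv2 γ γ') :
    IsLieDeriv2 (β - γ) (β' - γ') := fun m u v θ => (hβ m u v θ).sub (hγ m u v θ)

omit [ContMDiffSMul (𝓡 1) (𝓡 3) ∞ Circle M] [IsManifold (𝓡 3) ∞ M] in
theorem IsLieDeriv2.const_smul {γ γ' : Form2 M F} (hγ : IsLieDeriv2 γ γ') (c : ℝ) :
    IsLieDeriv2 (c • γ) (c • γ') := fun m u v θ => (hγ m u v θ).const_smul c

theorem isLieDeriv2_wedgeForm (L : F₁ →L[ℝ] F₂ →L[ℝ] F₃) {α : Form1 M F₁} {β : Form1 M F₂}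
    (hα : IsSmoothForm1 α) (hβ : IsSmoothForm1 β) :
    IsLieDeriv2 (wedgeForm L α β) (wedgeForm L (lie1 α) β + wedgeForm L α (lie1 β)) :=
  fun m u v θ => by
    have h1 := hasDerivAt_bilin L (lie1_apply_hasDerivAt hα θ m u)
      (lie1_apply_hasDerivAt hβ θ m v)
    have h2 := hasDerivAt_bilin L (lie1_apply_hasDerivAt hα θ m v)
      (lie1_apply_hasDerivAt hβ θ m u)
    refine (h1.sub h2).congr_deriv ?_
    simp only [pull2, pull1, Pi.add_apply, wedgeForm, ContinuousLinearMap.comp_apply]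
    abel

omit [IsManifold (𝓡 3) ∞ M] in
theorem isLieDeriv2_mulForm2 (L : F₁ →L[ℝ] F₂ →L[ℝ] F₃) {γ γ' : Form2 M F₁} {f : M → F₂}
    (hγ : IsLieDeriv2 γ γ') (hf : ContMDiff (𝓡 3) 𝓘(ℝ, F₂) ∞ f) :
    IsLieDeriv2 (mulForm2 L γ f) (mulForm2 L γ' f + mulForm2 L γ (lie0 f)) := fun m u v θ => by
  refine (hasDerivAt_bilin L (hγ m u v θ) (hasDerivAt_comp_rot hf θ m)).congr_deriv ?_
  rfl

/-- The group law carries `hasDerivAt_d1_pull1` from time `0` at `rot θ m` to time `θ` at `m`. -/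
theorem isLieDeriv2_d1 {α : Form1 M F} (hα : IsSmoothForm1 α) :
    IsLieDeriv2 (d1 α) (d1 (lie1 α)) := fun m u v θ => by
  have h0 := hasDerivAt_d1_pull1 hα (rot θ m) (dRot θ m u) (dRot θ m v)
  have e (s : ℝ) : d1 (pull1 s α) (rot θ m) (dRot θ m u) (dRot θ m v) =
      pull2 (s + θ) (d1 α) m u v := by
    rw [← pull2_d1 hα, ← pull2_pull2]; rfl
  simp only [e] at h0
  have h1 := HasDerivAt.comp_sub_const (f := fun s => pull2 (s + θ) (d1 α) m u v) θ θ
    (by rw [sub_self]; exact h0)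
  simp only [sub_add_cancel] at h1
  exact h1

end LieCalculus

/-! ### Integration by parts along the fibres. -/

section AverageCalculus

variable {M : Type*} [TopologicalSpace M] [ChartedSpace E3 M] [MulAction Circle M]
  [ContMDiffSMul (𝓡 1) (𝓡 3) ∞ Circle M]

theorem avg0_add {f g : M → ℝ} (hf : ContMDiff (𝓡 3) 𝓘(ℝ, ℝ) ∞ f)
    (hg : ContMDiff (𝓡 3) 𝓘(ℝ, ℝ) ∞ g) (m : M) :
    avg0 (fun m => f m + g m) m = avg0 f m + avg0 g m :=
  mean_add (continuous_rot_apply hf m) (continuous_rot_apply hg m)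

omit [TopologicalSpace M] [ChartedSpace E3 M] [ContMDiffSMul (𝓡 1) (𝓡 3) ∞ Circle M] in
theorem avg0_const_mul (c : ℝ) (f : M → ℝ) (m : M) :
    avg0 (fun m => c * f m) m = c * avg0 f m := mean_const_mul c _

variable [IsManifold (𝓡 3) ∞ M]

theorem avg0_lie0 {f : M → ℝ} (hf : ContMDiff (𝓡 3) 𝓘(ℝ, ℝ) ∞ f) (m : M) : avg0 (lie0 f) m = 0 :=
  mean_deriv (G := fun θ => f (rot θ m)) (fun θ => hasDerivAt_comp_rot hf θ m)
    (continuous_rot_apply (contMDiff_lie0 hf) m) fun θ => by simp only [rot_add_two_pi]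

theorem avg1_add {α β : Form1 M ℝ} (hα : IsSmoothForm1 α) (hβ : IsSmoothForm1 β) :
    avg1 (α + β) = avg1 α + avg1 β := by
  funext m
  ext u
  rw [avg1_apply (hα.add hβ), Pi.add_apply, add_apply, avg1_apply hα,
    avg1_apply hβ]
  exact mean_add ((hα.continuous_pull1 m).clm_apply continuous_const)
    ((hβ.continuous_pull1 m).clm_apply continuous_const)

theorem avg1_const_smul {α : Form1 M ℝ} (hα : IsSmoothForm1 α) (c : ℝ) :
    avg1 (c • α) = c • avg1 α := by
  funext m
  ext u
  rw [avg1_apply (hα.const_smul c), Pi.smul_apply, smul_apply,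
    avg1_apply hα]
  exact mean_const_mul c _

theorem avg1_lie1 {α : Form1 M ℝ} (hα : IsSmoothForm1 α) : avg1 (lie1 α) = 0 := by
  funext m
  ext u
  rw [avg1_apply hα.lie1]
  exact mean_deriv (G := fun θ => pull1 θ α m u) (fun θ => lie1_apply_hasDerivAt hα θ m u)
    ((hα.lie1.continuous_pull1 m).clm_apply continuous_const)
    fun θ => by simp only [pull1_add_two_pi]

theorem avg2_add {β γ : Form2 M ℝ} (hβ : IsSmoothForm2 β) (hγ : IsSmoothForm2 γ) :
    avg2 (β + γ) = avg2 β + avg2 γ := by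
  funext m u v
  exact mean_add (hβ.continuous_pull2 m u v) (hγ.continuous_pull2 m u v)

omit [ContMDiffSMul (𝓡 1) (𝓡 3) ∞ Circle M] [IsManifold (𝓡 3) ∞ M] in
theorem avg2_const_smul (c : ℝ) (β : Form2 M ℝ) : avg2 (c • β) = c • avg2 β := by
  funext m u v
  exact mean_const_mul c _

theorem avg2_sub {β γ : Form2 M ℝ} (hβ : IsSmoothForm2 β) (hγ : IsSmoothForm2 γ) :
    avg2 (β - γ) = avg2 β - avg2 γ := by
  funext m u v
  exact mean_sub (hβ.continuous_pull2 m u v) (hγ.continuous_pull2 m u v)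

theorem avg2_eq_zero_of_isLieDeriv2 {γ γ' : Form2 M ℝ}
    (h : IsLieDeriv2 γ γ') (hγ' : IsSmoothForm2 γ') : avg2 γ' = 0 := by
  funext m u v
  exact mean_deriv (G := fun θ => pull2 θ γ m u v) (h m u v) (hγ'.continuous_pull2 m u v)
    fun θ => by simp only [pull2_add_two_pi]

/-- Two-forms which differ by a Lie derivative have the same average. -/
theorem avg2_eq_of_isLieDeriv2 {β β' γ γ' : Form2 M ℝ} (h : IsLieDeriv2 γ γ')
    (hγ' : IsSmoothForm2 γ') (hβ' : IsSmoothForm2 β') (e : ∀ m u v, β m u v = β' m u v + γ' m u v) :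
    avg2 β = avg2 β' := by
  have : β = β' + γ' := by
    funext m u v
    exact e m u v
  rw [this, avg2_add hβ' hγ', avg2_eq_zero_of_isLieDeriv2 h hγ', add_zero]

omit [ContMDiffSMul (𝓡 1) (𝓡 3) ∞ Circle M] in
-- Pull-back does not change an invariant `κ`, so it is a constant under the mean and comes out of
-- it.
theorem avg2_wedge [ContMDiffSMul (𝓡 1) (𝓡 3) ∞ Circle M] {κ β : Form1 M ℝ} (h : IsInvariant1 κ)
    (hβ : IsSmoothForm1 β) : avg2 (wedge κ β) = wedge κ (avg1 β) := by
  funext m u v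
  have e (θ : ℝ) (u : E3) : κ (rot θ m) (dRot θ m u) = κ m u := by
    conv_rhs => rw [← h θ]
    rfl
  have hc (u : E3) : Continuous fun θ => pull1 θ β m u :=
    (hβ.continuous_pull1 m).clm_apply continuous_const
  simp only [wedge, avg2_apply, pull2, e, avg1_apply hβ]
  rw [← mean_const_mul, ← mean_const_mul]
  exact mean_sub (f := fun θ => κ m u * pull1 θ β m v) (g := fun θ => κ m v * pull1 θ β m u)
    (continuous_const.mul (hc v)) (continuous_const.mul (hc u))

omit [ContMDiffSMul (𝓡 1) (𝓡 3) ∞ Circle M] [IsManifold (𝓡 3) ∞ M] in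
theorem avg2_mul_invariant {x : M → ℝ} (h : ∀ (t : Circle) (m : M), x (t • m) = x m)
    (γ : Form2 M ℝ) (m : M) (u v : E3) :
    avg2 (fun m u v => x m * γ m u v) m u v = x m * avg2 γ m u v := by
  have e (θ : ℝ) : x (rot θ m) = x m := h _ _
  simp only [avg2_apply, pull2, e, mean_const_mul]

omit [ContMDiffSMul (𝓡 1) (𝓡 3) ∞ Circle M] [IsManifold (𝓡 3) ∞ M] in
theorem avg2_invariant_mul {γ : Form2 M ℝ} (h : IsInvariant2 γ) (f : M → ℝ) (m : M) (u v : E3) :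
    avg2 (fun m u v => γ m u v * f m) m u v = γ m u v * avg0 f m := by
  have e (θ : ℝ) : γ (rot θ m) (dRot θ m u) (dRot θ m v) = γ m u v := by
    conv_rhs => rw [← h θ]
    rfl
  simp only [avg2_apply, pull2, e, mean_const_mul, avg0_apply]

end AverageCalculus

/-! ### The extended Lie algebra. -/

section Structure

variable {𝔤 : Type*} [NormedLieRing 𝔤] [NormedLieAlgebra 𝔤] [FiniteDimensional ℝ 𝔤]

/-- A bilinear form on a finite-dimensional Lie algebra as a continuous bilinear map. -/
def pairL (B : LinearMap.BilinForm ℝ 𝔤) : 𝔤 →L[ℝ] 𝔤 →L[ℝ] ℝ :=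
  LinearMap.toContinuousBilinearMap B

/-- The Lie bracket as a continuous bilinear map. -/
def lieL : 𝔤 →L[ℝ] 𝔤 →L[ℝ] 𝔤 :=
  LinearMap.toContinuousBilinearMap (LieModule.toEnd ℝ 𝔤 𝔤 : 𝔤 →ₗ[ℝ] 𝔤 →ₗ[ℝ] 𝔤)

/-- Multiplication by scalars as a continuous bilinear map. -/
def smulL (F : Type*) [NormedAddCommGroup F] [NormedSpace ℝ F] : ℝ →L[ℝ] F →L[ℝ] F :=
  ContinuousLinearMap.lsmul ℝ ℝ

theorem pairL_apply (B : LinearMap.BilinForm ℝ 𝔤) (x y : 𝔤) : pairL B x y = B x y := rfl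

theorem lieL_apply (x y : 𝔤) : lieL x y = ⁅x, y⁆ := rfl

theorem smulL_apply {F : Type*} [NormedAddCommGroup F] [NormedSpace ℝ F] (c : ℝ) (x : F) :
    smulL F c x = c • x := rfl

omit [FiniteDimensional ℝ 𝔤] in
-- `lieInvariant` says that `ad x` is skew. The associative form is the rewriting rule that moves
-- every bracket into the second slot of `B`.
theorem lieInvariant_left {B : LinearMap.BilinForm ℝ 𝔤} (hBinv : B.lieInvariant 𝔤) (x y z : 𝔤) :
    B ⁅x, y⁆ z = B x ⁅y, z⁆ := by
  rw [← lie_skew, map_neg, LinearMap.neg_apply, hBinv, neg_neg]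

variable {M : Type*} [TopologicalSpace M] [ChartedSpace E3 M] [MulAction Circle M]
variable (ε : ℝ) (B : LinearMap.BilinForm ℝ 𝔤)

omit [MulAction Circle M] [TopologicalSpace M] [ChartedSpace E3 M] in
theorem pairForm1_apply (a : Form1 M 𝔤) (ξ : M → 𝔤) (m : M) (u : E3) :
    pairForm1 B a ξ m u = B (a m u) (ξ m) := rfl

theorem brGauge_apply (l : Triple M 𝔤) (X : Gauge M 𝔤) (m : M) (u : E3) :
    brGauge l X m u = ⁅l.2.1 m u, X.2.1 m⁆ - l.1 m u • lie0 X.2.1 m + X.1 m • lie1 l.2.1 m u := rfl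

/-- Each summand is a form times a function under a continuous bilinear map, so smoothness and the
Leibniz rules follow from those of `mulForm1`. -/
theorem brGauge_eq (l : Triple M 𝔤) (X : Gauge M 𝔤) : brGauge l X =
    mulForm1 lieL l.2.1 X.2.1 - mulForm1 (smulL 𝔤) l.1 (lie0 X.2.1) +
      mulForm1 (smulL 𝔤).flip (lie1 l.2.1) X.1 := rfl

/-- The triple consists of smooth forms. -/
def IsSmoothTriple [IsManifold (𝓡 3) ∞ M] (l : Triple M 𝔤) : Prop :=
  IsSmoothForm1 l.1 ∧ IsSmoothForm1 l.2.1 ∧ IsSmoothForm1 l.2.2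

section

variable [IsManifold (𝓡 3) ∞ M]

omit [FiniteDimensional ℝ 𝔤] in
theorem isSmoothTriple_of_mem_connections {l : Triple M 𝔤} (h : l ∈ connections M 𝔤) :
    IsSmoothTriple l := ⟨h.1.1, h.2.1.1, h.2.2.1⟩

omit [FiniteDimensional ℝ 𝔤] in
theorem isSmoothTriple_of_mem_variations {l : Triple M 𝔤} (h : l ∈ variations M 𝔤) :
    IsSmoothTriple l := ⟨h.1.1, h.2.1.1, h.2.2.1⟩

end

variable [ContMDiffSMul (𝓡 1) (𝓡 3) ∞ Circle M] [IsManifold (𝓡 3) ∞ M]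

theorem IsSmoothForm1.brGauge {l : Triple M 𝔤} (hl : IsSmoothTriple l) {X : Gauge M 𝔤}
    (hX : X ∈ gaugeAlgebra M 𝔤) : IsSmoothForm1 (brGauge l X) :=
  ((hl.2.1.mulForm1 lieL hX.2.2.1).sub (hl.1.mulForm1 (smulL 𝔤) (contMDiff_lie0 hX.2.2.1))).add
    (hl.2.1.lie1.mulForm1 (smulL 𝔤).flip hX.1)

/-- `L_R` is a derivation, and the terms in which it falls on `κ` or on `x` vanish by invariance. -/
theorem lie1_brGauge {l : Triple M 𝔤} (hl : IsSmoothTriple l) (hκ : IsInvariant1 l.1)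
    {X : Gauge M 𝔤} (hX : X ∈ gaugeAlgebra M 𝔤) (m : M) (u : E3) :
    lie1 (brGauge l X) m u = ⁅lie1 l.2.1 m u, X.2.1 m⁆ + ⁅l.2.1 m u, lie0 X.2.1 m⁆ -
      l.1 m u • lie0 (lie0 X.2.1) m + X.1 m • lie1 (lie1 l.2.1) m u := by
  have h1 := hl.2.1.mulForm1 lieL hX.2.2.1
  have h2 := hl.1.mulForm1 (smulL 𝔤) (contMDiff_lie0 hX.2.2.1)
  rw [brGauge_eq, lie1_add (h1.sub h2) (hl.2.1.lie1.mulForm1 _ hX.1), lie1_sub h1 h2,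
    lie1_mulForm1 _ hl.2.1 hX.2.2.1, lie1_mulForm1 _ hl.1 (contMDiff_lie0 hX.2.2.1),
    lie1_mulForm1 _ hl.2.1.lie1 hX.1, lie1_of_invariant hκ, lie0_of_invariant hX.2.1]
  simp [mulForm1_apply, lieL_apply, smulL_apply]

theorem IsSmoothForm1.pairForm1 {a : Form1 M 𝔤} {ξ : M → 𝔤} (ha : IsSmoothForm1 a)
    (hξ : ContMDiff (𝓡 3) 𝓘(ℝ, 𝔤) ∞ ξ) : IsSmoothForm1 (pairForm1 B a ξ) :=
  ha.mulForm1 (pairL B) hξ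

theorem lie1_pairForm1 {a : Form1 M 𝔤} {ξ : M → 𝔤} (ha : IsSmoothForm1 a)
    (hξ : ContMDiff (𝓡 3) 𝓘(ℝ, 𝔤) ∞ ξ) :
    lie1 (pairForm1 B a ξ) = pairForm1 B (lie1 a) ξ + pairForm1 B a (lie0 ξ) :=
  lie1_mulForm1 (pairL B) ha hξ

theorem contMDiff_pair {ξ η : M → 𝔤} (hξ : ContMDiff (𝓡 3) 𝓘(ℝ, 𝔤) ∞ ξ)
    (hη : ContMDiff (𝓡 3) 𝓘(ℝ, 𝔤) ∞ η) : ContMDiff (𝓡 3) 𝓘(ℝ, ℝ) ∞ fun m => B (ξ m) (η m) :=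
  contMDiff_bilin (pairL B) hξ hη

theorem contMDiff_bracket₂ {X Y : Gauge M 𝔤} (hX : X ∈ gaugeAlgebra M 𝔤)
    (hY : Y ∈ gaugeAlgebra M 𝔤) : ContMDiff (𝓡 3) 𝓘(ℝ, 𝔤) ∞ (bracket ε B X Y).2.1 :=
  ((contMDiff_bilin lieL hX.2.2.1 hY.2.2.1).sub
    (contMDiff_bilin (smulL 𝔤) hX.1 (contMDiff_lie0 hY.2.2.1))).add
      (contMDiff_bilin (smulL 𝔤) hY.1 (contMDiff_lie0 hX.2.2.1))

theorem lie0_bracket₂ {X Y : Gauge M 𝔤} (hX : X ∈ gaugeAlgebra M 𝔤)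
    (hY : Y ∈ gaugeAlgebra M 𝔤) (m : M) : lie0 (bracket ε B X Y).2.1 m =
      ⁅lie0 X.2.1 m, Y.2.1 m⁆ + ⁅X.2.1 m, lie0 Y.2.1 m⁆ - X.1 m • lie0 (lie0 Y.2.1) m +
        Y.1 m • lie0 (lie0 X.2.1) m := by
  have h1 := contMDiff_bilin lieL hX.2.2.1 hY.2.2.1
  have h2 := contMDiff_bilin (smulL 𝔤) hX.1 (contMDiff_lie0 hY.2.2.1)
  have h3 := contMDiff_bilin (smulL 𝔤) hY.1 (contMDiff_lie0 hX.2.2.1)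
  refine (lie0_add (h1.sub h2) h3 m).trans ?_
  refine (congrArg (· + _) (lie0_sub h1 h2 m)).trans ?_
  rw [lie0_bilin _ hX.2.2.1 hY.2.2.1, lie0_bilin _ hX.1 (contMDiff_lie0 hY.2.2.1),
    lie0_bilin _ hY.1 (contMDiff_lie0 hX.2.2.1), lie0_of_invariant hX.2.1, lie0_of_invariant hY.2.1]
  simp [lieL_apply, smulL_apply]

theorem bracket_mem {X Y : Gauge M 𝔤} (hX : X ∈ gaugeAlgebra M 𝔤) (hY : Y ∈ gaugeAlgebra M 𝔤) :
    bracket ε B X Y ∈ gaugeAlgebra M 𝔤 := by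
  refine ⟨contMDiff_const, fun _ _ => rfl, contMDiff_bracket₂ ε B hX hY, ?_, ?_⟩
  · exact contMDiff_const.mul
      (contMDiff_avg0_and_d0 (contMDiff_pair B hX.2.2.1 (contMDiff_lie0 hY.2.2.1))).1
  · exact fun t m => congrArg (ε * ·) (avg0_smul _ t m)

/-- The extended gauge algebra is a Lie algebra. -/
theorem isLieBracketOn_bracket (hBsymm : B.IsSymm) (hBinv : B.lieInvariant 𝔤) :
    IsLieBracketOn (gaugeAlgebra M 𝔤) (bracket ε B) where
  mem X hX Y hY := bracket_mem ε B hX hY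
  add_left X hX Y hY Z hZ := by
    have h := lie0_add hX.2.2.1 hY.2.2.1
    refine Prod.ext (by simp [bracket]) (Prod.ext ?_ ?_)
    · funext m
      have h' : lie0 (X.2.1 + Y.2.1) m = _ := h m
      simp only [bracket, Prod.fst_add, Prod.snd_add, Pi.add_apply, h', add_lie, add_smul, smul_add]
      abel
    · funext m
      have h' := avg0_add (contMDiff_pair B hX.2.2.1 (contMDiff_lie0 hZ.2.2.1))
        (contMDiff_pair B hY.2.2.1 (contMDiff_lie0 hZ.2.2.1)) m
      simp only [bracket, Prod.fst_add, Prod.snd_add, Pi.add_apply, map_add, LinearMap.add_apply, h',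
        mul_add]
  smul_left c X hX Y hY := by
    refine Prod.ext (by simp [bracket]) (Prod.ext ?_ ?_)
    · funext m
      have h' : lie0 (c • X.2.1) m = _ := lie0_const_smul hX.2.2.1 c m
      simp only [bracket, Prod.smul_fst, Prod.smul_snd, Pi.smul_apply, h', smul_lie, smul_eq_mul]
      module
    · funext m
      simp only [bracket, Prod.smul_fst, Prod.smul_snd, Pi.smul_apply, map_smul,
        LinearMap.smul_apply, smul_eq_mul, avg0_const_mul]
      ring
  skew X hX Y hY := by
    refine Prod.ext (by simp [bracket]) (Prod.ext ?_ ?_)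
    · funext m
      simp only [bracket, Prod.fst_neg, Prod.snd_neg, Pi.neg_apply]
      rw [← lie_skew]
      abel
    · funext m
      have h1 := contMDiff_pair B hX.2.2.1 (contMDiff_lie0 hY.2.2.1)
      have h2 := contMDiff_pair B hY.2.2.1 (contMDiff_lie0 hX.2.2.1)
      -- Skewness of the cocycle is integration by parts: `L_R ⟨ξ₁, ξ₂⟩` has mean zero.
      have h3 := avg0_lie0 (contMDiff_pair B hX.2.2.1 hY.2.2.1) m
      have h4 : lie0 (fun m => B (X.2.1 m) (Y.2.1 m)) =
          fun m => B (X.2.1 m) (lie0 Y.2.1 m) + B (Y.2.1 m) (lie0 X.2.1 m) := by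
        funext m
        refine (lie0_bilin (pairL B) hX.2.2.1 hY.2.2.1 m).trans ?_
        rw [add_comm, pairL_apply, pairL_apply, hBsymm.eq (lie0 X.2.1 m)]
      rw [h4, avg0_add h1 h2] at h3
      simp only [bracket, Prod.snd_neg, Pi.neg_apply]
      linear_combination ε * h3
  jacobi X hX Y hY Z hZ := by
    refine Prod.ext (by simp [bracket]) (Prod.ext ?_ ?_)
    · funext m
      have e (X Y Z : Gauge M 𝔤) (hX : X ∈ gaugeAlgebra M 𝔤) (hY : Y ∈ gaugeAlgebra M 𝔤)
          (hZ : Z ∈ gaugeAlgebra M 𝔤) : (bracket ε B X (bracket ε B Y Z)).2.1 m =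
          ⁅X.2.1 m, (bracket ε B Y Z).2.1 m⁆ - X.1 m • lie0 (bracket ε B Y Z).2.1 m := by
        simp [bracket]
      simp only [Prod.fst_add, Prod.snd_add, Pi.add_apply, e, hX, hY, hZ, lie0_bracket₂,
        Prod.fst_zero, Prod.snd_zero, Pi.zero_apply]
      simp only [bracket, lie_add, lie_sub, lie_smul]
      -- Since `L_R` is a derivation that kills the `x`-components, all terms with derivatives
      -- cancel in the cyclic sum; what remains is the Jacobi identity of `𝔤`.
      have j := lie_jacobi (X.2.1 m) (Y.2.1 m) (Z.2.1 m)
      rw [← lie_skew (lie0 X.2.1 m) (Y.2.1 m), ← lie_skew (lie0 Y.2.1 m) (Z.2.1 m),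
        ← lie_skew (lie0 Z.2.1 m) (X.2.1 m)]
      linear_combination (norm := module) j
    · funext m
      have e (X Y Z : Gauge M 𝔤) (hX : X ∈ gaugeAlgebra M 𝔤) (hY : Y ∈ gaugeAlgebra M 𝔤)
          (hZ : Z ∈ gaugeAlgebra M 𝔤) : (bracket ε B X (bracket ε B Y Z)).2.2 m =
          ε * avg0 (fun m => B (X.2.1 m) (lie0 (bracket ε B Y Z).2.1 m)) m := rfl
      have hs (X Y Z : Gauge M 𝔤) (hX : X ∈ gaugeAlgebra M 𝔤) (hY : Y ∈ gaugeAlgebra M 𝔤)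
          (hZ : Z ∈ gaugeAlgebra M 𝔤) := contMDiff_pair B hX.2.2.1
            (contMDiff_lie0 (contMDiff_bracket₂ ε B hY hZ))
      -- The cyclic sum of the cocycle is the mean of the `L_R`-derivative of `2⟨ξ₁, [ξ₂, ξ₃]⟩` plus
      -- the cyclic sum of `x₁ (⟨ξ₂, L_R ξ₃⟩ - ⟨ξ₃, L_R ξ₂⟩)`. In the derivative of the latter the
      -- products of two first derivatives cancel, leaving second derivatives only.
      have hq (X Y Z : Gauge M 𝔤) (hX : X ∈ gaugeAlgebra M 𝔤) (hY : Y ∈ gaugeAlgebra M 𝔤)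
          (hZ : Z ∈ gaugeAlgebra M 𝔤) : ContMDiff (𝓡 3) 𝓘(ℝ, ℝ) ∞ (fun m => X.1 m *
            (B (Y.2.1 m) (lie0 Z.2.1 m) - B (Z.2.1 m) (lie0 Y.2.1 m))) ∧
          ∀ m, lie0 (fun m => X.1 m *
            (B (Y.2.1 m) (lie0 Z.2.1 m) - B (Z.2.1 m) (lie0 Y.2.1 m))) m = X.1 m *
            (B (Y.2.1 m) (lie0 (lie0 Z.2.1) m) - B (Z.2.1 m) (lie0 (lie0 Y.2.1) m)) := by
        have h1 := contMDiff_lie0 hY.2.2.1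
        have h2 := contMDiff_lie0 hZ.2.2.1
        have h3 := contMDiff_pair B hY.2.2.1 h2
        have h4 := contMDiff_pair B hZ.2.2.1 h1
        refine ⟨hX.1.mul (h3.sub h4), fun m => (lie0_bilin (smulL ℝ) hX.1 (h3.sub h4) m).trans ?_⟩
        rw [lie0_of_invariant hX.2.1, show lie0 (fun m => B (Y.2.1 m) (lie0 Z.2.1 m) -
          B (Z.2.1 m) (lie0 Y.2.1 m)) m = _ from lie0_sub h3 h4 m,
          show lie0 (fun m => B (Y.2.1 m) (lie0 Z.2.1 m)) m = _ from
            lie0_bilin (pairL B) hY.2.2.1 h2 m,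
          show lie0 (fun m => B (Z.2.1 m) (lie0 Y.2.1 m)) m = _ from
            lie0_bilin (pairL B) hZ.2.2.1 h1 m]
        simp only [pairL_apply, smulL_apply, Pi.zero_apply, smul_eq_mul, zero_mul, zero_add,
          hBsymm.eq (lie0 Z.2.1 m)]
        ring
      have hT := contMDiff_pair B hX.2.2.1 (contMDiff_bilin lieL hY.2.2.1 hZ.2.2.1)
      have hT' (m : M) : lie0 (fun m => B (X.2.1 m) (lieL (Y.2.1 m) (Z.2.1 m))) m =
          B (lie0 X.2.1 m) ⁅Y.2.1 m, Z.2.1 m⁆ + B (X.2.1 m) (⁅lie0 Y.2.1 m, Z.2.1 m⁆ +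
            ⁅Y.2.1 m, lie0 Z.2.1 m⁆) :=
        (lie0_bilin (pairL B) hX.2.2.1 (contMDiff_bilin lieL hY.2.2.1 hZ.2.2.1) m).trans
          (by rw [lie0_bilin lieL hY.2.2.1 hZ.2.2.1]; rfl)
      have h1 := hq X Y Z hX hY hZ
      have h2 := hq Y Z X hY hZ hX
      have h3 := hq Z X Y hZ hX hY
      -- `hT` enters twice because each `L_R ξᵢ` occurs in two of the three cyclic terms.
      have h0 := avg0_lie0 ((((hT.add hT).add h1.1).add h2.1).add h3.1) m
      have ha {f g : M → ℝ} (hf : ContMDiff (𝓡 3) 𝓘(ℝ, ℝ) ∞ f) (hg : ContMDiff (𝓡 3) 𝓘(ℝ, ℝ) ∞ g) :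
          lie0 (f + g) = lie0 f + lie0 g := funext (lie0_add hf hg)
      rw [ha (((hT.add hT).add h1.1).add h2.1) h3.1, ha ((hT.add hT).add h1.1) h2.1,
        ha (hT.add hT) h1.1, ha hT hT] at h0
      simp only [Prod.snd_add, Pi.add_apply, e, hX, hY, hZ, Prod.snd_zero, Pi.zero_apply]
      rw [← mul_add, ← mul_add, ← avg0_add (hs X Y Z hX hY hZ) (hs Y Z X hY hZ hX)]
      refine mul_eq_zero_of_right _ (Eq.trans (avg0_add ((hs X Y Z hX hY hZ).add
        (hs Y Z X hY hZ hX)) (hs Z X Y hZ hX hY) m).symm (Eq.trans (congrArg (fun f => avg0 f m) ?_)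
          h0))
      funext m
      simp only [Pi.add_apply, h1.2, h2.2, h3.2, hT', lie0_bracket₂, hX, hY, hZ, map_add, map_sub, map_smul,
        smul_eq_mul]
      have r (x y z : 𝔤) : B x ⁅y, z⁆ = B y ⁅z, x⁆ := by
        rw [← lieInvariant_left hBinv, hBsymm.eq, ← lieInvariant_left hBinv, hBsymm.eq]
      linear_combination r (Z.2.1 m) (X.2.1 m) (lie0 Y.2.1 m) - r (X.2.1 m) (Y.2.1 m) (lie0 Z.2.1 m) +
        r (Y.2.1 m) (Z.2.1 m) (lie0 X.2.1 m) + 2 * r (Z.2.1 m) (lie0 X.2.1 m) (Y.2.1 m)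

omit [IsManifold (𝓡 3) ∞ M] [FiniteDimensional ℝ 𝔤] [ContMDiffSMul (𝓡 1) (𝓡 3) ∞ Circle M] in
theorem bracket_central (y : M → ℝ) (X : Gauge M 𝔤) : bracket ε B (0, 0, y) X = 0 := by
  have h : lie0 (0 : M → 𝔤) = 0 := by
    funext m
    exact deriv_const _ _
  refine Prod.ext rfl (Prod.ext ?_ ?_)
  · funext m
    simp [bracket, h]
  · funext m
    simp [bracket, avg0]

end Structure

/-! ### The action on extended connections. -/

section Action

variable {𝔤 : Type*} [NormedLieRing 𝔤] [NormedLieAlgebra 𝔤] [FiniteDimensional ℝ 𝔤]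
variable {M : Type*} [TopologicalSpace M] [ChartedSpace E3 M] [MulAction Circle M]
variable {F : Type*} [NormedAddCommGroup F] [NormedSpace ℝ F]
variable (ε : ℝ) (B : LinearMap.BilinForm ℝ 𝔤)

theorem contMDiff_const_smul {f : M → F} (hf : ContMDiff (𝓡 3) 𝓘(ℝ, F) ∞ f) (c : ℝ) :
    ContMDiff (𝓡 3) 𝓘(ℝ, F) ∞ fun m => c • f m :=
  contMDiff_bilin (smulL F) contMDiff_const hf

theorem d0_smul_add {f g : M → F} (hf : ContMDiff (𝓡 3) 𝓘(ℝ, F) ∞ f)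
    (hg : ContMDiff (𝓡 3) 𝓘(ℝ, F) ∞ g) (c : ℝ) : d0 (c • f + g) = c • d0 f + d0 g :=
  (d0_add (contMDiff_const_smul hf c) hg).trans (congrArg (· + _) (d0_const_smul hf c))

theorem deriv_line (p q : F) : deriv (fun t : ℝ => p + t • q) 0 = q := by
  have h := (((hasDerivAt_id (0 : ℝ)).smul_const q).const_add p).deriv
  rwa [one_smul] at h

theorem IsInvariant1.add {α β : Form1 M F} (hα : IsInvariant1 α) (hβ : IsInvariant1 β) :
    IsInvariant1 (α + β) := fun θ => by
  conv_rhs => rw [← hα θ, ← hβ θ]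
  rfl

theorem IsInvariant1.const_smul {α : Form1 M F} (hα : IsInvariant1 α) (c : ℝ) :
    IsInvariant1 (c • α) := fun θ => by
  conv_rhs => rw [← hα θ]
  rfl

theorem IsHorizontal1.add {α β : Form1 M F} (hα : IsHorizontal1 α) (hβ : IsHorizontal1 β) :
    IsHorizontal1 (α + β) := fun m => by
  rw [Pi.add_apply, add_apply, hα, hβ, add_zero]

theorem IsHorizontal1.const_smul {α : Form1 M F} (hα : IsHorizontal1 α) (c : ℝ) :
    IsHorizontal1 (c • α) := fun m => by
  rw [Pi.smul_apply, smul_apply, hα, smul_zero]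

theorem IsHorizontal1.pairForm1 {a : Form1 M 𝔤} (ha : IsHorizontal1 a) (ξ : M → 𝔤) :
    IsHorizontal1 (pairForm1 B a ξ) := fun m => by
  rw [pairForm1_apply, ha, map_zero, LinearMap.zero_apply]

variable [ContMDiffSMul (𝓡 1) (𝓡 3) ∞ Circle M] [IsManifold (𝓡 3) ∞ M]

theorem act_snd_fst_apply (X : Gauge M 𝔤) (l : Triple M 𝔤) (m : M) (u : E3) :
    (act ε B X l).2.1 m u = d0 X.2.1 m u + (⁅l.2.1 m u, X.2.1 m⁆ - l.1 m u • lie0 X.2.1 m +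
      X.1 m • lie1 l.2.1 m u) := rfl

theorem act_fst (X : Gauge M 𝔤) (l : Triple M 𝔤) : (act ε B X l).1 = d0 X.1 := add_zero _

theorem act_mem {X : Gauge M 𝔤} (hX : X ∈ gaugeAlgebra M 𝔤) {l : Triple M 𝔤}
    (hl : l ∈ connections M 𝔤) : act ε B X l ∈ variations M 𝔤 := by
  have hs := isSmoothTriple_of_mem_connections hl
  have hp := hs.2.1.pairForm1 B (contMDiff_lie0 hX.2.2.1)
  refine ⟨?_, ⟨(isSmoothForm1_d0 hX.2.2.1).add (IsSmoothForm1.brGauge hs hX), fun m => ?_⟩,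
    (isSmoothForm1_d0 hX.2.2.2.1).add ((isSmoothForm1_avg1 hp).const_smul ε),
    (isInvariant1_d0 hX.2.2.2.1 hX.2.2.2.2).add ((isInvariant1_avg1 hp).const_smul ε),
    (isHorizontal1_d0 hX.2.2.2.1 hX.2.2.2.2).add
      ((isHorizontal1_avg1 hp (hl.2.1.2.pairForm1 B _)).const_smul ε)⟩
  · rw [act_fst]
    exact ⟨isSmoothForm1_d0 hX.1, isInvariant1_d0 hX.1 hX.2.1, isHorizontal1_d0 hX.1 hX.2.1⟩
  -- On `R` the term `dξ(R) = L_R ξ` cancels against `κ(R) L_R ξ`, as `κ(R) = 1`.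
  · rw [act_snd_fst_apply, ← lie0_eq hX.2.2.1, hl.2.1.2, hl.1.2.2,
      isHorizontal1_lie1 hs.2.1 hl.2.1.2]
    simp

theorem act_linear {X Y : Gauge M 𝔤} (hX : X ∈ gaugeAlgebra M 𝔤) (hY : Y ∈ gaugeAlgebra M 𝔤)
    {l : Triple M 𝔤} (hl : IsSmoothTriple l) (c : ℝ) :
    act ε B (c • X + Y) l = c • act ε B X l + act ε B Y l := by
  have h0 : lie0 (c • X.2.1 + Y.2.1) = c • lie0 X.2.1 + lie0 Y.2.1 := by
    funext m
    exact (lie0_add (contMDiff_const_smul hX.2.2.1 c) hY.2.2.1 m).trans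
      (congrArg (· + _) (lie0_const_smul hX.2.2.1 c m))
  refine Prod.ext ?_ (Prod.ext ?_ ?_)
  · refine (add_zero _).trans ((d0_smul_add hX.1 hY.1 c).trans ?_)
    rw [Prod.fst_add, Prod.smul_fst, act_fst, act_fst]
  · funext m
    ext u
    have e : (c • act ε B X l + act ε B Y l).2.1 m u =
      c • (act ε B X l).2.1 m u + (act ε B Y l).2.1 m u := rfl
    have e1 : (c • X + Y).2.1 = c • X.2.1 + Y.2.1 := rfl
    rw [e, act_snd_fst_apply, act_snd_fst_apply, act_snd_fst_apply, e1, h0, d0_smul_add hX.2.2.1 hY.2.2.1]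
    have e2 : (c • X + Y).1 m = c * X.1 m + Y.1 m := rfl
    simp only [e2, Pi.add_apply, Pi.smul_apply, add_apply, smul_apply, lie_add, lie_smul]
    module
  · have e1 : (c • X + Y).2.1 = c • X.2.1 + Y.2.1 := rfl
    have e2 : pairForm1 B l.2.1 (c • lie0 X.2.1 + lie0 Y.2.1) =
        c • pairForm1 B l.2.1 (lie0 X.2.1) + pairForm1 B l.2.1 (lie0 Y.2.1) := by
      funext m
      ext u
      change B _ (c • _ + _) = c • B _ _ + B _ _
      rw [map_add, map_smul]
    have hp := hl.2.1.pairForm1 B (contMDiff_lie0 hX.2.2.1)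
    have hq := hl.2.1.pairForm1 B (contMDiff_lie0 hY.2.2.1)
    change d0 (c • X.2.2 + Y.2.2) + ε • avg1 (pairForm1 B l.2.1 (lie0 (c • X.2.1 + Y.2.1))) =
      c • (d0 X.2.2 + ε • avg1 (pairForm1 B l.2.1 (lie0 X.2.1))) +
        (d0 Y.2.2 + ε • avg1 (pairForm1 B l.2.1 (lie0 Y.2.1)))
    rw [h0, e2, avg1_add (hp.const_smul c) hq, avg1_const_smul hp, d0_smul_add hX.2.2.2.1 hY.2.2.2.1]
    module

/-- The vector fields of the action are affine. -/
theorem fieldDeriv_act {X : Gauge M 𝔤} (hX : X ∈ gaugeAlgebra M 𝔤) {l v : Triple M 𝔤}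
    (hl : IsSmoothTriple l) (hv : IsSmoothTriple v) :
    fieldDeriv (act ε B X) l v = formBracket1 ε B v X := by
  have hp := hl.2.1.pairForm1 B (contMDiff_lie0 hX.2.2.1)
  have hq := hv.2.1.pairForm1 B (contMDiff_lie0 hX.2.2.1)
  refine Prod.ext ?_ (Prod.ext ?_ ?_)
  · funext m
    exact deriv_const (0 : ℝ) ((act ε B X l).1 m)
  · funext m
    refine Eq.trans (congrArg (fun f : ℝ → (E3 →L[ℝ] 𝔤) => deriv f 0) (funext fun t => ?_))
      (deriv_line ((act ε B X l).2.1 m) (brGauge v X m))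
    ext u
    change (act ε B X (l + t • v)).2.1 m u = (act ε B X l).2.1 m u + t • brGauge v X m u
    rw [act_snd_fst_apply, act_snd_fst_apply, brGauge_apply]
    have e : (l + t • v).2.1 = l.2.1 + t • v.2.1 := rfl
    have e1 : (l + t • v).1 m u = l.1 m u + t * v.1 m u := rfl
    rw [e, e1, lie1_add hl.2.1 (hv.2.1.const_smul t), lie1_const_smul hv.2.1]
    simp only [Pi.add_apply, Pi.smul_apply, add_apply, smul_apply, add_lie, smul_lie]
    module
  · funext m
    refine Eq.trans (congrArg (fun f : ℝ → (E3 →L[ℝ] ℝ) => deriv f 0) (funext fun t => ?_))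
      (deriv_line ((act ε B X l).2.2 m) ((ε • avg1 (pairForm1 B v.2.1 (lie0 X.2.1))) m))
    have e2 : pairForm1 B (l.2.1 + t • v.2.1) (lie0 X.2.1) =
        pairForm1 B l.2.1 (lie0 X.2.1) + t • pairForm1 B v.2.1 (lie0 X.2.1) := by
      funext m
      ext u
      change B (_ + t • _) _ = B _ _ + t • B _ _
      rw [map_add, map_smul]
      rfl
    change d0 X.2.2 m + ε • avg1 (pairForm1 B (l.2.1 + t • v.2.1) (lie0 X.2.1)) m =
      d0 X.2.2 m + ε • avg1 (pairForm1 B l.2.1 (lie0 X.2.1)) m +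
        t • ε • avg1 (pairForm1 B v.2.1 (lie0 X.2.1)) m
    rw [e2, avg1_add hp (hq.const_smul t), avg1_const_smul hq]
    simp only [Pi.add_apply, Pi.smul_apply]
    module

theorem lie1_act {X : Gauge M 𝔤} (hX : X ∈ gaugeAlgebra M 𝔤) {l : Triple M 𝔤}
    (hl : IsSmoothTriple l) (hκ : IsInvariant1 l.1) (m : M) (u : E3) :
    lie1 (act ε B X l).2.1 m u = d0 (lie0 X.2.1) m u + (⁅lie1 l.2.1 m u, X.2.1 m⁆ +
      ⁅l.2.1 m u, lie0 X.2.1 m⁆ - l.1 m u • lie0 (lie0 X.2.1) m +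
        X.1 m • lie1 (lie1 l.2.1) m u) := by
  have e : (act ε B X l).2.1 = d0 X.2.1 + brGauge l X := rfl
  rw [e, lie1_add (isSmoothForm1_d0 hX.2.2.1) (IsSmoothForm1.brGauge hl hX), lie1_d0 hX.2.2.1,
    Pi.add_apply, add_apply, lie1_brGauge hl hκ hX]

theorem d0_bracket₂ {X Y : Gauge M 𝔤} (hX : X ∈ gaugeAlgebra M 𝔤)
    (hY : Y ∈ gaugeAlgebra M 𝔤) (m : M) (u : E3) : d0 (bracket ε B X Y).2.1 m u =
      ⁅d0 X.2.1 m u, Y.2.1 m⁆ + ⁅X.2.1 m, d0 Y.2.1 m u⁆ -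
        (d0 X.1 m u • lie0 Y.2.1 m + X.1 m • d0 (lie0 Y.2.1) m u) +
        (d0 Y.1 m u • lie0 X.2.1 m + Y.1 m • d0 (lie0 X.2.1) m u) := by
  have h1 := contMDiff_bilin lieL hX.2.2.1 hY.2.2.1
  have h2 := contMDiff_bilin (smulL 𝔤) hX.1 (contMDiff_lie0 hY.2.2.1)
  have h3 := contMDiff_bilin (smulL 𝔤) hY.1 (contMDiff_lie0 hX.2.2.1)
  have h4 : ContMDiff (𝓡 3) 𝓘(ℝ, 𝔤) ∞ fun m => (-1 : ℝ) • smulL 𝔤 (X.1 m) (lie0 Y.2.1 m) :=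
    contMDiff_const_smul h2 _
  have e : (bracket ε B X Y).2.1 = fun m => (lieL (X.2.1 m) (Y.2.1 m) +
      (-1 : ℝ) • smulL 𝔤 (X.1 m) (lie0 Y.2.1 m)) + smulL 𝔤 (Y.1 m) (lie0 X.2.1 m) := by
    funext m
    simp only [neg_one_smul, ← sub_eq_add_neg]
    rfl
  have h5 := (congrArg d0 e).trans ((d0_add (h1.add h4) h3).trans
    (congrArg (· + _) (d0_add h1 h4)))
  rw [h5, d0_const_smul h2]
  simp only [Pi.add_apply, add_apply, Pi.smul_apply, smul_apply]
  rw [d0_bilin _ hX.2.2.1 hY.2.2.1, d0_bilin _ hX.1 (contMDiff_lie0 hY.2.2.1),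
    d0_bilin _ hY.1 (contMDiff_lie0 hX.2.2.1)]
  simp only [lieL_apply, smulL_apply, neg_one_smul, sub_eq_add_neg]

/-- The vector fields of the action represent the extended gauge algebra. -/
theorem fieldDeriv_act_sub (hBsymm : B.IsSymm) (hBinv : B.lieInvariant 𝔤) {X Y : Gauge M 𝔤}
    (hX : X ∈ gaugeAlgebra M 𝔤) (hY : Y ∈ gaugeAlgebra M 𝔤) {l : Triple M 𝔤}
    (hl : l ∈ connections M 𝔤) :
    fieldDeriv (act ε B Y) l (act ε B X l) - fieldDeriv (act ε B X) l (act ε B Y l) =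
      act ε B (bracket ε B X Y) l := by
  have hs := isSmoothTriple_of_mem_connections hl
  have hsX := isSmoothTriple_of_mem_variations (act_mem ε B hX hl)
  have hsY := isSmoothTriple_of_mem_variations (act_mem ε B hY hl)
  rw [fieldDeriv_act ε B hY hs hsX, fieldDeriv_act ε B hX hs hsY]
  refine Prod.ext ?_ (Prod.ext ?_ ?_)
  · rw [act_fst]
    exact (sub_zero _).trans (d0_const (0 : ℝ)).symm
  · funext m
    ext u
    change brGauge (act ε B X l) Y m u - brGauge (act ε B Y l) X m u = _
    rw [act_snd_fst_apply, d0_bracket₂ ε B hX hY, lie0_bracket₂ ε B hX hY, brGauge_apply,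
      brGauge_apply, lie1_act ε B hX hs hl.1.2.1, lie1_act ε B hY hs hl.1.2.1, act_fst, act_fst,
      act_snd_fst_apply, act_snd_fst_apply]
    -- Here `leibniz_lie` is the Jacobi identity for `a`, `ξ₁`, `ξ₂`; the rest is bilinearity.
    simp only [bracket, add_lie, sub_lie, smul_lie, lie_add, lie_sub, lie_smul, Pi.zero_apply,
      zero_smul, leibniz_lie (l.2.1 m u) (X.2.1 m) (Y.2.1 m)]
    rw [← lie_skew (X.2.1 m) (d0 Y.2.1 m u), ← lie_skew (X.2.1 m) ⁅l.2.1 m u, Y.2.1 m⁆,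
      ← lie_skew (X.2.1 m) (lie0 Y.2.1 m)]
    module
  · have hX' := contMDiff_lie0 hX.2.2.1
    have hY' := contMDiff_lie0 hY.2.2.1
    have hp := contMDiff_pair B hX.2.2.1 hY'
    have hp1 := hsX.2.1.pairForm1 B hY'
    have hp2 := hsY.2.1.pairForm1 B hX'
    have hp3 := hs.2.1.pairForm1 B (contMDiff_lie0 (contMDiff_bracket₂ ε B hX hY))
    have hd0 := isSmoothForm1_d0 hp
    have h1 := hs.2.1.pairForm1 B hY'
    have h2 := hs.2.1.pairForm1 B hX'
    have h3 := (isSmoothForm1_d0 hY.2.2.1).pairForm1 B hX.2.2.1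
    have h1x := h1.mulForm1 (smulL ℝ).flip hX.1
    have h2x := h2.mulForm1 (smulL ℝ).flip hY.1
    have hN := (h1x.sub h2x).sub h3
    -- Before averaging, the central components agree up to the Lie derivative of `x₁⟨a, L_R ξ₂⟩ -
    -- x₂⟨a, L_R ξ₁⟩ - ⟨dξ₂, ξ₁⟩`. After averaging, `d⟨ξ₁, L_R ξ₂⟩` gives the differential of the
    -- cocycle.
    have key : pairForm1 B (act ε B X l).2.1 (lie0 Y.2.1) +
        (-1 : ℝ) • pairForm1 B (act ε B Y l).2.1 (lie0 X.2.1) =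
        d0 (fun m => B (X.2.1 m) (lie0 Y.2.1 m)) +
          pairForm1 B l.2.1 (lie0 (bracket ε B X Y).2.1) +
        lie1 (mulForm1 (smulL ℝ).flip (pairForm1 B l.2.1 (lie0 Y.2.1)) X.1 -
          mulForm1 (smulL ℝ).flip (pairForm1 B l.2.1 (lie0 X.2.1)) Y.1 -
          pairForm1 B (d0 Y.2.1) X.2.1) := by
      rw [lie1_sub (h1x.sub h2x) h3, lie1_sub h1x h2x, lie1_mulForm1 _ h1 hX.1,
        lie1_mulForm1 _ h2 hY.1, lie1_pairForm1 B (isSmoothForm1_d0 hY.2.2.1) hX.2.2.1,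
        lie1_pairForm1 B hs.2.1 hX', lie1_pairForm1 B hs.2.1 hY', lie0_of_invariant hX.2.1,
        lie0_of_invariant hY.2.1, lie1_d0 hY.2.2.1]
      funext m
      ext u
      have hb : d0 (fun m => B (X.2.1 m) (lie0 Y.2.1 m)) m u = _ :=
        d0_bilin (pairL B) hX.2.2.1 hY' m u
      simp only [Pi.add_apply, Pi.sub_apply, add_apply, sub_apply, Pi.smul_apply, smul_apply,
        mulForm1_apply, pairForm1_apply, hb, act_snd_fst_apply, lie0_bracket₂, hX, hY, pairL_apply,
        ContinuousLinearMap.flip_apply, smulL_apply, map_add, map_sub, map_smul,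
        LinearMap.add_apply, LinearMap.sub_apply, LinearMap.smul_apply, smul_eq_mul, Pi.zero_apply,
        lieInvariant_left hBinv]
      rw [hBsymm.eq (lie0 X.2.1 m) (lie0 Y.2.1 m), ← lie_skew (lie0 X.2.1 m) (Y.2.1 m), map_neg,
        hBsymm.eq (X.2.1 m) (d0 (lie0 Y.2.1) m u)]
      ring
    have hk := congrArg avg1 key
    rw [avg1_add hp1 (hp2.const_smul _), avg1_const_smul hp2, avg1_add (hd0.add hp3) hN.lie1,
      avg1_lie1 hN, add_zero, avg1_add hd0 hp3, ← (contMDiff_avg0_and_d0 hp).2] at hk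
    change ε • avg1 (pairForm1 B (act ε B X l).2.1 (lie0 Y.2.1)) -
      ε • avg1 (pairForm1 B (act ε B Y l).2.1 (lie0 X.2.1)) =
      d0 (fun m => ε • avg0 (fun m => B (X.2.1 m) (lie0 Y.2.1 m)) m) +
        ε • avg1 (pairForm1 B l.2.1 (lie0 (bracket ε B X Y).2.1))
    rw [show d0 (fun m => ε • avg0 (fun m => B (X.2.1 m) (lie0 Y.2.1 m)) m) = _ from
      d0_const_smul (contMDiff_avg0_and_d0 hp).1 ε, ← smul_add, ← hk]
    module

end Action

/-! ### Basic forms. -/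

section Basic

variable {M : Type*} [TopologicalSpace M] [ChartedSpace E3 M] [MulAction Circle M]
variable {F : Type*} [NormedAddCommGroup F] [NormedSpace ℝ F]
variable {F₁ : Type*} [NormedAddCommGroup F₁] [NormedSpace ℝ F₁]
variable {F₂ : Type*} [NormedAddCommGroup F₂] [NormedSpace ℝ F₂]

/-- A one-form which is smooth, horizontal and invariant. -/
structure IsBasic1 [IsManifold (𝓡 3) ∞ M] (α : Form1 M ℝ) : Prop where
  smooth : IsSmoothForm1 α
  horizontal : IsHorizontal1 α
  invariant : IsInvariant1 α

/-- A two-form which is smooth, horizontal and invariant. -/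
structure IsBasic2 [IsManifold (𝓡 3) ∞ M] (β : Form2 M ℝ) : Prop where
  smooth : IsSmoothForm2 β
  horizontal : IsHorizontal2 β
  invariant : IsInvariant2 β

theorem IsHorizontal2.add {β γ : Form2 M F} (hβ : IsHorizontal2 β) (hγ : IsHorizontal2 γ) :
    IsHorizontal2 (β + γ) := fun m v =>
  (congrArg₂ (· + ·) (hβ m v) (hγ m v)).trans (add_zero _)

theorem IsHorizontal2.const_smul {β : Form2 M F} (hβ : IsHorizontal2 β) (c : ℝ) :
    IsHorizontal2 (c • β) := fun m v => (congrArg (c • ·) (hβ m v)).trans (smul_zero c)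

theorem IsHorizontal2.mulForm2 (L : F₁ →L[ℝ] F₂ →L[ℝ] F) {β : Form2 M F₁} (hβ : IsHorizontal2 β)
    (f : M → F₂) : IsHorizontal2 (mulForm2 L β f) := fun m v => by
  simp only [ExtendedConnection.mulForm2, hβ m v, map_zero, zero_apply]

theorem isHorizontal2_wedgeForm (L : F₁ →L[ℝ] F₂ →L[ℝ] F) {α : Form1 M F₁} {β : Form1 M F₂}
    (hα : IsHorizontal1 α) (hβ : IsHorizontal1 β) : IsHorizontal2 (wedgeForm L α β) := fun m v => by
  simp only [wedgeForm, hα m, hβ m, map_zero, zero_apply, sub_zero]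

variable [IsManifold (𝓡 3) ∞ M]

theorem IsBasic2.add {β γ : Form2 M ℝ} (hβ : IsBasic2 β) (hγ : IsBasic2 γ) : IsBasic2 (β + γ) :=
  ⟨hβ.smooth.add hγ.smooth, hβ.horizontal.add hγ.horizontal, fun θ => by
    conv_rhs => rw [← hβ.invariant θ, ← hγ.invariant θ]
    rfl⟩

theorem IsBasic2.const_smul {β : Form2 M ℝ} (hβ : IsBasic2 β) (c : ℝ) : IsBasic2 (c • β) :=
  ⟨hβ.smooth.const_smul c, hβ.horizontal.const_smul c, fun θ => by
    conv_rhs => rw [← hβ.invariant θ]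
    rfl⟩

theorem IsBasic2.mul {β : Form2 M ℝ} (hβ : IsBasic2 β) {f : M → ℝ}
    (hf : ContMDiff (𝓡 3) 𝓘(ℝ, ℝ) ∞ f) (h : ∀ (t : Circle) (m : M), f (t • m) = f m) :
    IsBasic2 (fun m u v => β m u v * f m) :=
  ⟨hβ.smooth.mulForm2 (smulL ℝ) hf, hβ.horizontal.mulForm2 (smulL ℝ) f, fun θ => by
    conv_rhs => rw [← hβ.invariant θ]
    funext m u v
    exact congrArg (_ * ·) (h _ m)⟩

theorem IsBasic1.wedge {α β : Form1 M ℝ} (hα : IsBasic1 α) (hβ : IsBasic1 β) :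
    IsBasic2 (wedge α β) :=
  ⟨isSmoothForm2_wedgeForm (smulL ℝ) hα.smooth hβ.smooth,
    isHorizontal2_wedgeForm (smulL ℝ) hα.horizontal hβ.horizontal, fun θ => by
    conv_rhs => rw [← hα.invariant θ, ← hβ.invariant θ]
    rfl⟩

theorem IsBasic1.add {α β : Form1 M ℝ} (hα : IsBasic1 α) (hβ : IsBasic1 β) : IsBasic1 (α + β) :=
  ⟨hα.smooth.add hβ.smooth, hα.horizontal.add hβ.horizontal, hα.invariant.add hβ.invariant⟩

theorem IsBasic1.const_smul {α : Form1 M ℝ} (hα : IsBasic1 α) (c : ℝ) : IsBasic1 (c • α) :=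
  ⟨hα.smooth.const_smul c, hα.horizontal.const_smul c, hα.invariant.const_smul c⟩

theorem IsBasic1.mul {α : Form1 M ℝ} (hα : IsBasic1 α) {f : M → ℝ}
    (hf : ContMDiff (𝓡 3) 𝓘(ℝ, ℝ) ∞ f) (h : ∀ (t : Circle) (m : M), f (t • m) = f m) :
    IsBasic1 (mulForm1 (smulL ℝ) α f) :=
  ⟨hα.smooth.mulForm1 (smulL ℝ) hf, fun m => by rw [mulForm1_apply, hα.horizontal m, map_zero]; rfl,
    fun θ => by
    conv_rhs => rw [← hα.invariant θ]
    funext m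
    ext u
    exact congrArg (_ * ·) (h _ m)⟩

variable [ContMDiffSMul (𝓡 1) (𝓡 3) ∞ Circle M]

theorem isBasic2_avg2 {β : Form2 M ℝ} (hβ : IsSmoothForm2 β) (h : IsHorizontal2 β) :
    IsBasic2 (avg2 β) := ⟨isSmoothForm2_avg2 hβ, isHorizontal2_avg2 h, isInvariant2_avg2 β⟩

theorem isBasic1_avg1 {β : Form1 M ℝ} (hβ : IsSmoothForm1 β) (h : IsHorizontal1 β) :
    IsBasic1 (avg1 β) := ⟨isSmoothForm1_avg1 hβ, isHorizontal1_avg1 hβ h, isInvariant1_avg1 hβ⟩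

/-- Cartan's formula with `d(α(R)) = 0`. The constant is `1` for a connection form and `0` for a
horizontal form. -/
theorem d1_genR_of_const {α : Form1 M F} (hα : IsSmoothForm1 α) (c : F)
    (h : ∀ m, α m (genR m) = c) (m : M) (v : E3) : d1 α m (genR m) v = lie1 α m v := by
  rw [d1_genR hα, funext h, d0_const]
  exact sub_zero _

theorem isBasic2_d1 {α : Form1 M ℝ} (hα : IsSmoothForm1 α) (c : ℝ)
    (h : ∀ m, α m (genR m) = c) (hi : IsInvariant1 α) : IsBasic2 (d1 α) :=
  ⟨isSmoothForm2_d1 hα, fun m v => by rw [d1_genR_of_const hα c h, lie1_of_invariant hi]; rfl,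
    isInvariant2_d1 hα hi⟩

end Basic

/-! ### The curvature and its expansion along a line. -/

section Curvature

variable {𝔤 : Type*} [NormedLieRing 𝔤] [NormedLieAlgebra 𝔤] [FiniteDimensional ℝ 𝔤]
variable {M : Type*} [TopologicalSpace M] [ChartedSpace E3 M] [MulAction Circle M]
variable (ε : ℝ) (B : LinearMap.BilinForm ℝ 𝔤)
variable [ContMDiffSMul (𝓡 1) (𝓡 3) ∞ Circle M] [IsManifold (𝓡 3) ∞ M]

/-- In `[l ∧ l]` the term `κ ∧ L_R a` occurs twice, once from each mixed bracket, and the factor `1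
/ 2` leaves it once. -/
theorem curvature_eq (l : Triple M 𝔤) : curvature ε B l =
    (d1 l.1, curvatureG l.2.1 - smulWedge l.1 (lie1 l.2.1),
      d1 l.2.2 + (ε / 2) • avg2 (pairWedge B l.2.1 (lie1 l.2.1))) := by
  refine Prod.ext ?_ (Prod.ext ?_ ?_)
  · change d1 l.1 + (1 / 2 : ℝ) • (0 : Form2 M ℝ) = d1 l.1
    rw [smul_zero, add_zero]
  · change d1 l.2.1 + (1 / 2 : ℝ) • (lieWedge l.2.1 l.2.1 - smulWedge l.1 (lie1 l.2.1) -
      smulWedge l.1 (lie1 l.2.1)) = d1 l.2.1 + (1 / 2 : ℝ) • lieWedge l.2.1 l.2.1 -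
        smulWedge l.1 (lie1 l.2.1)
    module
  · change d1 l.2.2 + (1 / 2 : ℝ) • ε • avg2 (pairWedge B l.2.1 (lie1 l.2.1)) =
      d1 l.2.2 + (ε / 2) • avg2 (pairWedge B l.2.1 (lie1 l.2.1))
    module

/-- Triples of horizontal two-forms whose outer components are basic. -/
structure IsCurvatureTriple (f : Triple2 M 𝔤) : Prop where
  fst : IsBasic2 f.1
  smooth : IsSmoothForm2 f.2.1
  horizontal : IsHorizontal2 f.2.1
  snd : IsBasic2 f.2.2

theorem isBasic2_pairWedge {a b : Form1 M 𝔤} (ha : IsSmoothForm1 a) (hb : IsSmoothForm1 b)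
    (ha' : IsHorizontal1 a) (hb' : IsHorizontal1 b) : IsBasic2 (avg2 (pairWedge B a b)) :=
  isBasic2_avg2 (isSmoothForm2_wedgeForm (pairL B) ha hb)
    (isHorizontal2_wedgeForm (pairL B) ha' hb')

/-- The delicate point is horizontality in the middle: contracting `da` with `R` gives `L_R a` by
Cartan's formula, and the contraction of `κ ∧ L_R a` removes it because `κ(R) = 1`. -/
theorem isCurvatureTriple_curvature {l : Triple M 𝔤} (hl : l ∈ connections M 𝔤) :
    IsCurvatureTriple (curvature ε B l) := by
  have hs := isSmoothTriple_of_mem_connections hl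
  rw [curvature_eq]
  refine ⟨isBasic2_d1 hs.1 1 hl.1.2.2 hl.1.2.1, ?_, fun m v => ?_, ?_⟩
  · exact ((isSmoothForm2_d1 hs.2.1).add
      ((isSmoothForm2_wedgeForm lieL hs.2.1 hs.2.1).const_smul _)).sub
      (isSmoothForm2_wedgeForm (smulL 𝔤) hs.1 hs.2.1.lie1)
  · change d1 l.2.1 m (genR m) v + (1 / 2 : ℝ) • (⁅l.2.1 m (genR m), l.2.1 m v⁆ -
      ⁅l.2.1 m v, l.2.1 m (genR m)⁆) - (l.1 m (genR m) • lie1 l.2.1 m v -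
        l.1 m v • lie1 l.2.1 m (genR m)) = 0
    rw [d1_genR_of_const hs.2.1 0 hl.2.1.2, hl.2.1.2, hl.1.2.2,
      isHorizontal1_lie1 hs.2.1 hl.2.1.2]
    simp
  · exact (isBasic2_d1 hs.2.2 0 hl.2.2.2.2 hl.2.2.2.1).add
      ((isBasic2_pairWedge B hs.2.1 hs.2.1.lie1 hl.2.1.2
        (isHorizontal1_lie1 hs.2.1 hl.2.1.2)).const_smul _)

/-- The derivative of the curvature. -/
def dCurvature (l w : Triple M 𝔤) : Triple2 M 𝔤 := dTriple w + formBracket2 ε B l w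

theorem isCurvatureTriple_dCurvature {l w : Triple M 𝔤} (hl : l ∈ connections M 𝔤)
    (hw : w ∈ variations M 𝔤) : IsCurvatureTriple (dCurvature ε B l w) := by
  have hs := isSmoothTriple_of_mem_connections hl
  have ht := isSmoothTriple_of_mem_variations hw
  refine ⟨?_, ?_, fun m v => ?_, ?_⟩
  · change IsBasic2 (d1 w.1 + 0)
    rw [add_zero]
    exact isBasic2_d1 ht.1 0 hw.1.2.2 hw.1.2.1
  · exact (isSmoothForm2_d1 ht.2.1).add (((isSmoothForm2_wedgeForm lieL hs.2.1 ht.2.1).sub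
      (isSmoothForm2_wedgeForm (smulL 𝔤) hs.1 ht.2.1.lie1)).sub
      (isSmoothForm2_wedgeForm (smulL 𝔤) ht.1 hs.2.1.lie1))
  · change d1 w.2.1 m (genR m) v + ((⁅l.2.1 m (genR m), w.2.1 m v⁆ -
      ⁅l.2.1 m v, w.2.1 m (genR m)⁆) - (l.1 m (genR m) • lie1 w.2.1 m v -
        l.1 m v • lie1 w.2.1 m (genR m)) - (w.1 m (genR m) • lie1 l.2.1 m v -
        w.1 m v • lie1 l.2.1 m (genR m))) = 0
    rw [d1_genR_of_const ht.2.1 0 hw.2.1.2, hl.2.1.2, hl.1.2.2, hw.2.1.2, hw.1.2.2,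
      isHorizontal1_lie1 hs.2.1 hl.2.1.2, isHorizontal1_lie1 ht.2.1 hw.2.1.2]
    simp
  · exact (isBasic2_d1 ht.2.2 0 hw.2.2.2.2 hw.2.2.2.1).add
      ((isBasic2_pairWedge B hs.2.1 ht.2.1.lie1 hl.2.1.2
        (isHorizontal1_lie1 ht.2.1 hw.2.1.2)).const_smul _)

/-- This is the coefficient of `t ^ 2` in the curvature along a line; additivity of the surface
integral requires it to pair to a basic form by itself. -/
theorem isCurvatureTriple_formBracket2 {w : Triple M 𝔤} (hw : w ∈ variations M 𝔤) :
    IsCurvatureTriple ((1 / 2 : ℝ) • formBracket2 ε B w w) := by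
  have ht := isSmoothTriple_of_mem_variations hw
  have h1 := isHorizontal1_lie1 ht.2.1 hw.2.1.2
  refine ⟨?_, ?_, IsHorizontal2.const_smul (fun m v => ?_) _, ?_⟩
  · change IsBasic2 ((1 / 2 : ℝ) • (0 : Form2 M ℝ))
    rw [smul_zero, ← zero_smul ℝ (wedge w.1 w.1)]
    exact (IsBasic1.wedge ⟨ht.1, hw.1.2.2, hw.1.2.1⟩ ⟨ht.1, hw.1.2.2, hw.1.2.1⟩).const_smul 0
  · exact (((isSmoothForm2_wedgeForm lieL ht.2.1 ht.2.1).sub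
      (isSmoothForm2_wedgeForm (smulL 𝔤) ht.1 ht.2.1.lie1)).sub
      (isSmoothForm2_wedgeForm (smulL 𝔤) ht.1 ht.2.1.lie1)).const_smul _
  · change (⁅w.2.1 m (genR m), w.2.1 m v⁆ -
      ⁅w.2.1 m v, w.2.1 m (genR m)⁆) - (w.1 m (genR m) • lie1 w.2.1 m v -
        w.1 m v • lie1 w.2.1 m (genR m)) - (w.1 m (genR m) • lie1 w.2.1 m v -
        w.1 m v • lie1 w.2.1 m (genR m)) = 0
    rw [hw.2.1.2, hw.1.2.2, h1]
    simp
  · exact ((isBasic2_pairWedge B ht.2.1 ht.2.1.lie1 hw.2.1.2 h1).const_smul _).const_smul _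

theorem pairWedge_swap (hBsymm : B.IsSymm) (a b : Form1 M 𝔤) :
    pairWedge B a b = (-1 : ℝ) • pairWedge B b a := by
  funext m u v
  change B (a m u) (b m v) - B (a m v) (b m u) = -1 * (B (b m u) (a m v) - B (b m v) (a m u))
  rw [hBsymm.eq (a m u), hBsymm.eq (a m v)]
  ring

/-- Exchanging the two forms gives one sign and integrating by parts another, so `⟨a ∧ L_R b⟩` is
symmetric after averaging. Hence the two cross terms of the central component of the curvature
coincide. -/
theorem avg2_pairWedge_lie1 (hBsymm : B.IsSymm) {a b : Form1 M 𝔤} (ha : IsSmoothForm1 a)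
    (hb : IsSmoothForm1 b) :
    avg2 (pairWedge B b (lie1 a)) = avg2 (pairWedge B a (lie1 b)) := by
  refine avg2_eq_of_isLieDeriv2 (isLieDeriv2_wedgeForm (pairL B) hb ha)
    ((isSmoothForm2_wedgeForm _ hb.lie1 ha).add (isSmoothForm2_wedgeForm _ hb ha.lie1))
    (isSmoothForm2_wedgeForm (pairL B) ha hb.lie1) fun m u v => ?_
  rw [pairWedge_swap B hBsymm a]
  change _ = -1 * pairWedge B (lie1 b) a m u v + (pairWedge B (lie1 b) a m u v +
    pairWedge B b (lie1 a) m u v)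
  ring

/-- The curvature is a quadratic polynomial in the connection. Its middle component polarizes
pointwise, the central one only after averaging, by `avg2_pairWedge_lie1`. -/
theorem curvature_add_smul (hBsymm : B.IsSymm) {l w : Triple M 𝔤} (hl : IsSmoothTriple l)
    (hw : IsSmoothTriple w) (t : ℝ) : curvature ε B (l + t • w) = curvature ε B l +
      (t • dCurvature ε B l w + t ^ 2 • (1 / 2 : ℝ) • formBracket2 ε B w w) := by
  have hlie : lie1 (l.2.1 + t • w.2.1) = lie1 l.2.1 + t • lie1 w.2.1 := by
    rw [lie1_add hl.2.1 (hw.2.1.const_smul t), lie1_const_smul hw.2.1]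
  refine Prod.ext ?_ (Prod.ext ?_ ?_)
  · change d1 (l.1 + t • w.1) + (1 / 2 : ℝ) • (0 : Form2 M ℝ) = d1 l.1 + (1 / 2 : ℝ) • 0 +
      (t • (d1 w.1 + 0) + t ^ 2 • (1 / 2 : ℝ) • 0)
    rw [d1_add hl.1 (hw.1.const_smul t), d1_const_smul hw.1]
    module
  · funext m u v
    change d1 (l.2.1 + t • w.2.1) m u v + (1 / 2 : ℝ) •
      (⁅l.2.1 m u + t • w.2.1 m u, l.2.1 m v + t • w.2.1 m v⁆ -
        ⁅l.2.1 m v + t • w.2.1 m v, l.2.1 m u + t • w.2.1 m u⁆ -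
        ((l.1 m u + t • w.1 m u) • lie1 (l.2.1 + t • w.2.1) m v -
          (l.1 m v + t • w.1 m v) • lie1 (l.2.1 + t • w.2.1) m u) -
        ((l.1 m u + t • w.1 m u) • lie1 (l.2.1 + t • w.2.1) m v -
          (l.1 m v + t • w.1 m v) • lie1 (l.2.1 + t • w.2.1) m u)) =
      d1 l.2.1 m u v + (1 / 2 : ℝ) • (⁅l.2.1 m u, l.2.1 m v⁆ - ⁅l.2.1 m v, l.2.1 m u⁆ -
        (l.1 m u • lie1 l.2.1 m v - l.1 m v • lie1 l.2.1 m u) -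
        (l.1 m u • lie1 l.2.1 m v - l.1 m v • lie1 l.2.1 m u)) +
      (t • (d1 w.2.1 m u v + (⁅l.2.1 m u, w.2.1 m v⁆ - ⁅l.2.1 m v, w.2.1 m u⁆ -
        (l.1 m u • lie1 w.2.1 m v - l.1 m v • lie1 w.2.1 m u) -
        (w.1 m u • lie1 l.2.1 m v - w.1 m v • lie1 l.2.1 m u))) +
      t ^ 2 • (1 / 2 : ℝ) • (⁅w.2.1 m u, w.2.1 m v⁆ - ⁅w.2.1 m v, w.2.1 m u⁆ -
        (w.1 m u • lie1 w.2.1 m v - w.1 m v • lie1 w.2.1 m u) -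
        (w.1 m u • lie1 w.2.1 m v - w.1 m v • lie1 w.2.1 m u)))
    rw [hlie, d1_add hl.2.1 (hw.2.1.const_smul t), d1_const_smul hw.2.1]
    simp only [Pi.add_apply, Pi.smul_apply, add_apply, smul_apply, add_lie, lie_add, smul_lie,
      lie_smul, smul_eq_mul]
    rw [← lie_skew (l.2.1 m u) (w.2.1 m v), ← lie_skew (l.2.1 m v) (w.2.1 m u)]
    module
  · have e : pairWedge B (l.2.1 + t • w.2.1) (lie1 l.2.1 + t • lie1 w.2.1) =
        pairWedge B l.2.1 (lie1 l.2.1) + (t • (pairWedge B l.2.1 (lie1 w.2.1) +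
          pairWedge B w.2.1 (lie1 l.2.1)) + t ^ 2 • pairWedge B w.2.1 (lie1 w.2.1)) := by
      funext m u v
      simp only [pairWedge, Pi.add_apply, Pi.smul_apply, add_apply, smul_apply, map_add, map_smul,
        LinearMap.add_apply, LinearMap.smul_apply, smul_eq_mul]
      ring
    have h1 : IsSmoothForm2 (pairWedge B l.2.1 (lie1 l.2.1)) :=
      isSmoothForm2_wedgeForm (pairL B) hl.2.1 hl.2.1.lie1
    have h2 : IsSmoothForm2 (pairWedge B l.2.1 (lie1 w.2.1)) :=
      isSmoothForm2_wedgeForm (pairL B) hl.2.1 hw.2.1.lie1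
    have h3 : IsSmoothForm2 (pairWedge B w.2.1 (lie1 l.2.1)) :=
      isSmoothForm2_wedgeForm (pairL B) hw.2.1 hl.2.1.lie1
    have h4 : IsSmoothForm2 (pairWedge B w.2.1 (lie1 w.2.1)) :=
      isSmoothForm2_wedgeForm (pairL B) hw.2.1 hw.2.1.lie1
    change d1 (l.2.2 + t • w.2.2) + (1 / 2 : ℝ) • ε • avg2 (pairWedge B (l.2.1 + t • w.2.1)
      (lie1 (l.2.1 + t • w.2.1))) = d1 l.2.2 + (1 / 2 : ℝ) • ε •
        avg2 (pairWedge B l.2.1 (lie1 l.2.1)) + (t • (d1 w.2.2 + ε •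
        avg2 (pairWedge B l.2.1 (lie1 w.2.1))) + t ^ 2 • (1 / 2 : ℝ) • ε •
        avg2 (pairWedge B w.2.1 (lie1 w.2.1)))
    rw [hlie, e, d1_add hl.2.2 (hw.2.2.const_smul t), d1_const_smul hw.2.2,
      avg2_add h1 (((h2.add h3).const_smul t).add (h4.const_smul _)),
      avg2_add ((h2.add h3).const_smul t) (h4.const_smul _), avg2_const_smul, avg2_add h2 h3,
      avg2_const_smul, avg2_pairWedge_lie1 B hBsymm hl.2.1 hw.2.1]
    module

end Curvature

/-! ### Invariance of the pairing, the moment map identity and equivariance. -/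

section Pairing

variable {𝔤 : Type*} [NormedLieRing 𝔤] [NormedLieAlgebra 𝔤] [FiniteDimensional ℝ 𝔤]
variable {M : Type*} [TopologicalSpace M] [ChartedSpace E3 M] [MulAction Circle M]
variable (ε : ℝ) (B : LinearMap.BilinForm ℝ 𝔤)
variable [ContMDiffSMul (𝓡 1) (𝓡 3) ∞ Circle M] [IsManifold (𝓡 3) ∞ M]

theorem isBasic2_extPairWedge {v w : Triple M 𝔤} (hv : v ∈ variations M 𝔤)
    (hw : w ∈ variations M 𝔤) : IsBasic2 (extPairWedge ε B v w) :=
  (isBasic2_pairWedge B hv.2.1.1 hw.2.1.1 hv.2.1.2 hw.2.1.2).add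
    (((IsBasic1.wedge ⟨hv.1.1, hv.1.2.2, hv.1.2.1⟩ ⟨hw.2.2.1, hw.2.2.2.2, hw.2.2.2.1⟩).add
      (IsBasic1.wedge ⟨hv.2.2.1, hv.2.2.2.2, hv.2.2.2.1⟩ ⟨hw.1.1, hw.1.2.2, hw.1.2.1⟩)).const_smul ε)

theorem extPairWedge_swap (hBsymm : B.IsSymm) (v w : Triple M 𝔤) :
    extPairWedge ε B w v = (-1 : ℝ) • extPairWedge ε B v w := by
  rw [extPairWedge, extPairWedge, pairWedge_swap B hBsymm, avg2_const_smul]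
  funext m a b
  simp only [Pi.add_apply, Pi.smul_apply, wedge, smul_eq_mul]
  ring

theorem extPairWedge_smul_add {u v w : Triple M 𝔤} (hu : IsSmoothTriple u) (hv : IsSmoothTriple v)
    (hw : IsSmoothTriple w) (c : ℝ) :
    extPairWedge ε B (c • u + v) w = c • extPairWedge ε B u w + extPairWedge ε B v w := by
  have e : pairWedge B (c • u + v).2.1 w.2.1 =
      c • pairWedge B u.2.1 w.2.1 + pairWedge B v.2.1 w.2.1 := by
    funext m a b
    change B (c • u.2.1 m a + v.2.1 m a) (w.2.1 m b) - B (c • u.2.1 m b + v.2.1 m b) (w.2.1 m a) =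
      c * (B (u.2.1 m a) (w.2.1 m b) - B (u.2.1 m b) (w.2.1 m a)) +
        (B (v.2.1 m a) (w.2.1 m b) - B (v.2.1 m b) (w.2.1 m a))
    simp only [map_add, map_smul, LinearMap.add_apply, LinearMap.smul_apply, smul_eq_mul]
    ring
  have h1 : IsSmoothForm2 (pairWedge B u.2.1 w.2.1) := isSmoothForm2_wedgeForm (pairL B) hu.2.1 hw.2.1
  have h2 : IsSmoothForm2 (pairWedge B v.2.1 w.2.1) := isSmoothForm2_wedgeForm (pairL B) hv.2.1 hw.2.1
  rw [extPairWedge, extPairWedge, extPairWedge, e, avg2_add (h1.const_smul c) h2, avg2_const_smul]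
  funext m a b
  simp only [Pi.add_apply, Pi.smul_apply, Prod.fst_add, Prod.snd_add, Prod.smul_fst, Prod.smul_snd,
    wedge, smul_eq_mul, add_apply, smul_apply]
  ring

theorem isBasic2_extPair {f : Triple2 M 𝔤} (hf : IsCurvatureTriple f) {X : Gauge M 𝔤}
    (hX : X ∈ gaugeAlgebra M 𝔤) : IsBasic2 (extPair ε B f X) :=
  (isBasic2_avg2 (hf.smooth.mulForm2 (pairL B) hX.2.2.1)
    (hf.horizontal.mulForm2 (pairL B) X.2.1)).add
      (((hf.fst.mul hX.2.2.2.1 hX.2.2.2.2).add (hf.snd.mul hX.1 hX.2.1)).const_smul ε)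

theorem extPair_smul_add_right {f : Triple2 M 𝔤} (hf : IsSmoothForm2 f.2.1) {X Y : Gauge M 𝔤}
    (hX : X ∈ gaugeAlgebra M 𝔤) (hY : Y ∈ gaugeAlgebra M 𝔤) (c : ℝ) :
    extPair ε B f (c • X + Y) = c • extPair ε B f X + extPair ε B f Y := by
  have e : (fun m u v => B (f.2.1 m u v) ((c • X + Y).2.1 m)) =
      c • mulForm2 (pairL B) f.2.1 X.2.1 + mulForm2 (pairL B) f.2.1 Y.2.1 := by
    funext m a b
    change B _ (c • _ + _) = c * B _ _ + B _ _
    simp only [map_add, map_smul, smul_eq_mul]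
  rw [extPair, e, avg2_add ((hf.mulForm2 (pairL B) hX.2.2.1).const_smul c)
    (hf.mulForm2 (pairL B) hY.2.2.1), avg2_const_smul]
  funext m a b
  change (c * avg2 (mulForm2 (pairL B) f.2.1 X.2.1) m a b +
    avg2 (mulForm2 (pairL B) f.2.1 Y.2.1) m a b) + ε * (f.1 m a b * (c * X.2.2 m + Y.2.2 m) +
      f.2.2 m a b * (c * X.1 m + Y.1 m)) = c * (avg2 (mulForm2 (pairL B) f.2.1 X.2.1) m a b +
        ε * (f.1 m a b * X.2.2 m + f.2.2 m a b * X.1 m)) +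
        (avg2 (mulForm2 (pairL B) f.2.1 Y.2.1) m a b +
        ε * (f.1 m a b * Y.2.2 m + f.2.2 m a b * Y.1 m))
  ring

theorem extPair_smul_add_left {f g : Triple2 M 𝔤} (hf : IsSmoothForm2 f.2.1)
    (hg : IsSmoothForm2 g.2.1) {X : Gauge M 𝔤} (hX : X ∈ gaugeAlgebra M 𝔤) (c : ℝ) :
    extPair ε B (f + c • g) X = extPair ε B f X + c • extPair ε B g X := by
  have e : (fun m u v => B ((f + c • g).2.1 m u v) (X.2.1 m)) =
      mulForm2 (pairL B) f.2.1 X.2.1 + c • mulForm2 (pairL B) g.2.1 X.2.1 := by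
    funext m a b
    change B (_ + c • _) _ = B _ _ + c * B _ _
    simp only [map_add, map_smul, smul_eq_mul, LinearMap.add_apply, LinearMap.smul_apply]
  rw [extPair, e, avg2_add (hf.mulForm2 (pairL B) hX.2.2.1)
    ((hg.mulForm2 (pairL B) hX.2.2.1).const_smul c), avg2_const_smul]
  funext m a b
  change (avg2 (mulForm2 (pairL B) f.2.1 X.2.1) m a b +
    c * avg2 (mulForm2 (pairL B) g.2.1 X.2.1) m a b) + ε * ((f.1 m a b + c * g.1 m a b) * X.2.2 m +
      (f.2.2 m a b + c * g.2.2 m a b) * X.1 m) = (avg2 (mulForm2 (pairL B) f.2.1 X.2.1) m a b +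
        ε * (f.1 m a b * X.2.2 m + f.2.2 m a b * X.1 m)) +
        c * (avg2 (mulForm2 (pairL B) g.2.1 X.2.1) m a b +
        ε * (g.1 m a b * X.2.2 m + g.2.2 m a b * X.1 m))
  ring

/-- The product of a function and the wedge product of two one-forms with its Lie derivative. -/
theorem isLieDeriv2_mul_invariant {γ γ' : Form2 M ℝ} (h : IsLieDeriv2 γ γ') {x : M → ℝ}
    (hx : ∀ (t : Circle) (m : M), x (t • m) = x m) :
    IsLieDeriv2 (fun m u v => x m * γ m u v) (fun m u v => x m * γ' m u v) := fun m u v θ => by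
  have e (θ : ℝ) : x (rot θ m) = x m := hx _ _
  have h1 := (h m u v θ).const_mul (x m)
  simp only [pull2, e] at h1 ⊢
  exact h1

theorem isSmoothForm2_mul_left {γ : Form2 M ℝ} (h : IsSmoothForm2 γ) {x : M → ℝ}
    (hx : ContMDiff (𝓡 3) 𝓘(ℝ, ℝ) ∞ x) : IsSmoothForm2 (fun m u v => x m * γ m u v) :=
  h.mulForm2 (smulL ℝ).flip hx

/-- The vector fields of the action preserve the pairing of variations. -/
theorem extPairWedge_formBracket1 (hε : ε * ε = 1) (hBsymm : B.IsSymm) (hBinv : B.lieInvariant 𝔤)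
    {X : Gauge M 𝔤} (hX : X ∈ gaugeAlgebra M 𝔤) {v w : Triple M 𝔤} (hv : v ∈ variations M 𝔤)
    (hw : w ∈ variations M 𝔤) :
    extPairWedge ε B (formBracket1 ε B v X) w + extPairWedge ε B v (formBracket1 ε B w X) = 0 := by
  have sv := isSmoothTriple_of_mem_variations hv
  have sw := isSmoothTriple_of_mem_variations hw
  have hX' := contMDiff_lie0 hX.2.2.1
  have bv := IsSmoothForm1.brGauge sv hX
  have bw := IsSmoothForm1.brGauge sw hX
  have pv := sv.2.1.pairForm1 B hX'
  have pw := sw.2.1.pairForm1 B hX'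
  have h1 : IsSmoothForm2 (pairWedge B (brGauge v X) w.2.1) :=
    isSmoothForm2_wedgeForm (pairL B) bv sw.2.1
  have h2 : IsSmoothForm2 (pairWedge B v.2.1 (brGauge w X)) :=
    isSmoothForm2_wedgeForm (pairL B) sv.2.1 bw
  have h3 : IsSmoothForm2 (wedge w.1 (pairForm1 B v.2.1 (lie0 X.2.1))) :=
    isSmoothForm2_wedgeForm (smulL ℝ) sw.1 pv
  have h4 : IsSmoothForm2 (wedge v.1 (pairForm1 B w.2.1 (lie0 X.2.1))) :=
    isSmoothForm2_wedgeForm (smulL ℝ) sv.1 pw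
  -- The ad-terms cancel by invariance, and the terms with `x` add up to `x L_R ⟨v ∧ w⟩`, which
  -- averages to zero. Only terms with the first components of `v` and `w` survive.
  have key : avg2 (pairWedge B (brGauge v X) w.2.1 + pairWedge B v.2.1 (brGauge w X)) =
      avg2 (wedge w.1 (pairForm1 B v.2.1 (lie0 X.2.1)) -
        wedge v.1 (pairForm1 B w.2.1 (lie0 X.2.1))) := by
    refine avg2_eq_of_isLieDeriv2 (isLieDeriv2_mul_invariant
      (isLieDeriv2_wedgeForm (pairL B) sv.2.1 sw.2.1) hX.2.1) (isSmoothForm2_mul_left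
        ((isSmoothForm2_wedgeForm (pairL B) sv.2.1.lie1 sw.2.1).add
          (isSmoothForm2_wedgeForm (pairL B) sv.2.1 sw.2.1.lie1)) hX.1) (h3.sub h4) fun m a b => ?_
    simp only [Pi.add_apply, Pi.sub_apply, pairWedge, wedge, brGauge_apply, pairForm1_apply,
      wedgeForm, pairL_apply, map_add, map_sub, map_smul, LinearMap.add_apply, LinearMap.sub_apply,
      LinearMap.smul_apply, smul_eq_mul, lieInvariant_left hBinv]
    rw [← lie_skew (X.2.1 m) (w.2.1 m a), ← lie_skew (X.2.1 m) (w.2.1 m b), map_neg, map_neg,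
      hBsymm.eq (lie0 X.2.1 m), hBsymm.eq (lie0 X.2.1 m)]
    ring
  rw [avg2_add h1 h2, avg2_sub h3 h4, avg2_wedge hw.1.2.1 pv, avg2_wedge hv.1.2.1 pw] at key
  funext m a b
  have hk := congrFun (congrFun (congrFun key m) a) b
  simp only [Pi.add_apply, Pi.sub_apply, wedge] at hk
  simp only [extPairWedge, formBracket1, Pi.add_apply, Pi.smul_apply, smul_eq_mul, wedge,
    smul_apply, zero_apply, Pi.zero_apply]
  -- The surviving terms meet the central components of the brackets, which carry one `ε` from the
  -- cocycle and one from the pairing; they cancel since `ε * ε = 1`.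
  linear_combination hk + (w.1 m b * avg1 (pairForm1 B v.2.1 (lie0 X.2.1)) m a -
    w.1 m a * avg1 (pairForm1 B v.2.1 (lie0 X.2.1)) m b +
    v.1 m a * avg1 (pairForm1 B w.2.1 (lie0 X.2.1)) m b -
    v.1 m b * avg1 (pairForm1 B w.2.1 (lie0 X.2.1)) m a) * hε

/-- The one-form whose differential is the difference of the two sides of the moment map equation
before integration. -/
def momentForm (X : Gauge M 𝔤) (w : Triple M 𝔤) : Form1 M ℝ :=
  avg1 (pairForm1 B w.2.1 X.2.1) + ε • (mulForm1 (smulL ℝ) w.1 X.2.2 + mulForm1 (smulL ℝ) w.2.2 X.1)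

theorem isBasic1_momentForm {X : Gauge M 𝔤} (hX : X ∈ gaugeAlgebra M 𝔤) {w : Triple M 𝔤}
    (hw : w ∈ variations M 𝔤) : IsBasic1 (momentForm ε B X w) :=
  (isBasic1_avg1 (hw.2.1.1.pairForm1 B hX.2.2.1) (hw.2.1.2.pairForm1 B _)).add
    (((IsBasic1.mul ⟨hw.1.1, hw.1.2.2, hw.1.2.1⟩ hX.2.2.2.1 hX.2.2.2.2).add
      (IsBasic1.mul ⟨hw.2.2.1, hw.2.2.2.2, hw.2.2.2.1⟩ hX.1 hX.2.1)).const_smul ε)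

/-- The covariant Leibniz rule `d⟨w, X⟩ = ⟨d_l w, X⟩ - ⟨w ∧ d_l X⟩`, with the last term turned
around by skewness. The right side has a basic primitive, so it integrates to zero. -/
theorem extPair_dCurvature_add (hε : ε * ε = 1) (hBsymm : B.IsSymm) (hBinv : B.lieInvariant 𝔤)
    {X : Gauge M 𝔤} (hX : X ∈ gaugeAlgebra M 𝔤) {l w : Triple M 𝔤} (hl : l ∈ connections M 𝔤)
    (hw : w ∈ variations M 𝔤) :
    extPair ε B (dCurvature ε B l w) X + extPairWedge ε B (act ε B X l) w =
      d1 (momentForm ε B X w) := by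
  have sl := isSmoothTriple_of_mem_connections hl
  have sw := isSmoothTriple_of_mem_variations hw
  have sV := isSmoothTriple_of_mem_variations (act_mem ε B hX hl)
  have hX' := contMDiff_lie0 hX.2.2.1
  have p := sl.2.1.pairForm1 B hX'
  have q := sw.2.1.pairForm1 B hX.2.2.1
  have r := sl.2.1.pairForm1 B hX.2.2.1
  have h1 := (isCurvatureTriple_dCurvature ε B hl hw).smooth.mulForm2 (pairL B) hX.2.2.1
  have h2 : IsSmoothForm2 (pairWedge B (act ε B X l).2.1 w.2.1) :=
    isSmoothForm2_wedgeForm (pairL B) sV.2.1 sw.2.1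
  have h3 := isSmoothForm2_d1 q
  have h4 : IsSmoothForm2 (pairWedge B l.2.1 (lie1 w.2.1)) :=
    isSmoothForm2_wedgeForm (pairL B) sl.2.1 sw.2.1.lie1
  have h4x := isSmoothForm2_mul_left h4 hX.1
  have h5 : IsSmoothForm2 (wedge w.1 (pairForm1 B l.2.1 (lie0 X.2.1))) :=
    isSmoothForm2_wedgeForm (smulL ℝ) sw.1 p
  -- The discarded Lie derivative has primitive `x⟨a ∧ w⟩ - κ ∧ ⟨w, ξ⟩ - δκ ∧ ⟨a, ξ⟩`, where `w`
  -- stands for its middle component and `δκ` for its first.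
  have key : avg2 (mulForm2 (pairL B) (dCurvature ε B l w).2.1 X.2.1 +
        pairWedge B (act ε B X l).2.1 w.2.1) =
      avg2 ((d1 (pairForm1 B w.2.1 X.2.1) -
        fun m u v => X.1 m * pairWedge B l.2.1 (lie1 w.2.1) m u v) +
        wedge w.1 (pairForm1 B l.2.1 (lie0 X.2.1))) := by
    refine avg2_eq_of_isLieDeriv2 (((isLieDeriv2_mul_invariant
      (isLieDeriv2_wedgeForm (pairL B) sl.2.1 sw.2.1) hX.2.1).sub
        (isLieDeriv2_wedgeForm (smulL ℝ) sl.1 q)).sub (isLieDeriv2_wedgeForm (smulL ℝ) sw.1 r))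
      (((isSmoothForm2_mul_left ((isSmoothForm2_wedgeForm (pairL B) sl.2.1.lie1 sw.2.1).add h4)
        hX.1).sub ((isSmoothForm2_wedgeForm _ sl.1.lie1 q).add
          (isSmoothForm2_wedgeForm _ sl.1 q.lie1))).sub
          ((isSmoothForm2_wedgeForm _ sw.1.lie1 r).add (isSmoothForm2_wedgeForm _ sw.1 r.lie1)))
      ((h3.sub h4x).add h5) fun m a b => ?_
    have e1 : (dCurvature ε B l w).2.1 m a b = d1 w.2.1 m a b + (⁅l.2.1 m a, w.2.1 m b⁆ -
        ⁅l.2.1 m b, w.2.1 m a⁆ - (l.1 m a • lie1 w.2.1 m b - l.1 m b • lie1 w.2.1 m a) -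
        (w.1 m a • lie1 l.2.1 m b - w.1 m b • lie1 l.2.1 m a)) := rfl
    have e2 : d1 (pairForm1 B w.2.1 X.2.1) m a b = _ :=
      d1_mulForm1 (pairL B) sw.2.1 hX.2.2.1 m a b
    rw [lie1_of_invariant hl.1.2.1, lie1_of_invariant hw.1.2.1, lie1_pairForm1 B sw.2.1 hX.2.2.1,
      lie1_pairForm1 B sl.2.1 hX.2.2.1]
    simp only [Pi.add_apply, Pi.sub_apply, pairWedge, wedge, act_snd_fst_apply, pairForm1_apply,
      mulForm2, e1, e2, smulL_apply, add_apply, Pi.zero_apply, zero_apply, wedgeForm, pairL_apply]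
    simp only [map_add, map_sub, map_smul, LinearMap.add_apply, LinearMap.sub_apply,
      LinearMap.smul_apply, smul_eq_mul, lieInvariant_left hBinv]
    rw [← lie_skew (X.2.1 m) (w.2.1 m a), ← lie_skew (X.2.1 m) (w.2.1 m b), map_neg, map_neg,
      hBsymm.eq (lie0 X.2.1 m), hBsymm.eq (lie0 X.2.1 m), hBsymm.eq (d0 X.2.1 m a),
      hBsymm.eq (d0 X.2.1 m b)]
    ring
  rw [avg2_add h1 h2, avg2_add (h3.sub h4x) h5, avg2_sub h3 h4x, avg2_wedge hw.1.2.1 p,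
    ← d1_avg1 q] at key
  have m1 := sw.1.mulForm1 (smulL ℝ) hX.2.2.2.1
  have m2 := sw.2.2.mulForm1 (smulL ℝ) hX.1
  rw [momentForm, d1_add (isSmoothForm1_avg1 q) ((m1.add m2).const_smul ε),
    d1_const_smul (m1.add m2), d1_add m1 m2]
  funext m a b
  have hk := congrFun (congrFun (congrFun key m) a) b
  simp only [Pi.add_apply, Pi.sub_apply, wedge, avg2_mul_invariant hX.2.1] at hk
  have e3 : extPair ε B (dCurvature ε B l w) X m a b =
      avg2 (mulForm2 (pairL B) (dCurvature ε B l w).2.1 X.2.1) m a b + ε * ((d1 w.1 m a b + 0) *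
        X.2.2 m + (d1 w.2.2 m a b + ε * avg2 (pairWedge B l.2.1 (lie1 w.2.1)) m a b) * X.1 m) := rfl
  have e4 : extPairWedge ε B (act ε B X l) w m a b =
      avg2 (pairWedge B (act ε B X l).2.1 w.2.1) m a b + ε * ((d0 X.1 m a + 0) * w.2.2 m b -
        (d0 X.1 m b + 0) * w.2.2 m a + ((d0 X.2.2 m a + ε * avg1 (pairForm1 B l.2.1 (lie0 X.2.1)) m a)
          * w.1 m b - (d0 X.2.2 m b + ε * avg1 (pairForm1 B l.2.1 (lie0 X.2.1)) m b)
          * w.1 m a)) := rfl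
  simp only [Pi.add_apply, Pi.smul_apply, smul_eq_mul]
  rw [e3, e4, d1_mulForm1 _ sw.1 hX.2.2.2.1, d1_mulForm1 _ sw.2.2 hX.1]
  simp only [smulL_apply, smul_eq_mul]
  linear_combination hk + (X.1 m * avg2 (pairWedge B l.2.1 (lie1 w.2.1)) m a b +
    avg1 (pairForm1 B l.2.1 (lie0 X.2.1)) m a * w.1 m b -
    avg1 (pairForm1 B l.2.1 (lie0 X.2.1)) m b * w.1 m a) * hε

theorem d1_act {X : Gauge M 𝔤} (hX : X ∈ gaugeAlgebra M 𝔤) {l : Triple M 𝔤}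
    (hl : IsSmoothTriple l) (m : M) (u v : E3) : d1 (act ε B X l).2.1 m u v =
      (⁅d1 l.2.1 m u v, X.2.1 m⁆ - (⁅l.2.1 m u, d0 X.2.1 m v⁆ - ⁅l.2.1 m v, d0 X.2.1 m u⁆)) -
      (d1 l.1 m u v • lie0 X.2.1 m - (l.1 m u • d0 (lie0 X.2.1) m v -
        l.1 m v • d0 (lie0 X.2.1) m u)) + (X.1 m • d1 (lie1 l.2.1) m u v -
        (d0 X.1 m v • lie1 l.2.1 m u - d0 X.1 m u • lie1 l.2.1 m v)) := by
  have hX' := contMDiff_lie0 hX.2.2.1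
  have h1 := hl.2.1.mulForm1 lieL hX.2.2.1
  have h2 := hl.1.mulForm1 (smulL 𝔤) hX'
  have h3 := hl.2.1.lie1.mulForm1 (smulL 𝔤).flip hX.1
  have e : (act ε B X l).2.1 = d0 X.2.1 + ((mulForm1 lieL l.2.1 X.2.1 +
      (-1 : ℝ) • mulForm1 (smulL 𝔤) l.1 (lie0 X.2.1)) +
      mulForm1 (smulL 𝔤).flip (lie1 l.2.1) X.1) := by
    rw [neg_one_smul, ← sub_eq_add_neg]
    rfl
  rw [e, d1_add (isSmoothForm1_d0 hX.2.2.1) ((h1.add (h2.const_smul _)).add h3),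
    d1_add (h1.add (h2.const_smul _)) h3, d1_add h1 (h2.const_smul _), d1_const_smul h2,
    d1_d0 hX.2.2.1]
  simp only [Pi.add_apply, Pi.smul_apply, Pi.zero_apply]
  rw [d1_mulForm1 _ hl.2.1 hX.2.2.1, d1_mulForm1 _ hl.1 hX', d1_mulForm1 _ hl.2.1.lie1 hX.1]
  simp only [lieL_apply, smulL_apply, ContinuousLinearMap.flip_apply]
  module

theorem curvature_snd_fst_apply (l : Triple M 𝔤) (m : M) (u v : E3) :
    (curvature ε B l).2.1 m u v = d1 l.2.1 m u v + ⁅l.2.1 m u, l.2.1 m v⁆ -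
      (l.1 m u • lie1 l.2.1 m v - l.1 m v • lie1 l.2.1 m u) := by
  rw [curvature_eq]
  change d1 l.2.1 m u v + (1 / 2 : ℝ) • (⁅l.2.1 m u, l.2.1 m v⁆ - ⁅l.2.1 m v, l.2.1 m u⁆) -
    (l.1 m u • lie1 l.2.1 m v - l.1 m v • lie1 l.2.1 m u) = _
  rw [← lie_skew (l.2.1 m u) (l.2.1 m v)]
  module

/-- The Lie derivative of the middle component of the curvature. -/
def lieCurvature (l : Triple M 𝔤) : Form2 M 𝔤 :=
  d1 (lie1 l.2.1) + (1 / 2 : ℝ) • (wedgeForm lieL (lie1 l.2.1) l.2.1 +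
    wedgeForm lieL l.2.1 (lie1 l.2.1)) - (wedgeForm (smulL 𝔤) (lie1 l.1) (lie1 l.2.1) +
      wedgeForm (smulL 𝔤) l.1 (lie1 (lie1 l.2.1)))

theorem isSmoothForm2_lieCurvature {l : Triple M 𝔤} (hl : IsSmoothTriple l) :
    IsSmoothForm2 (lieCurvature l) :=
  ((isSmoothForm2_d1 hl.2.1.lie1).add (((isSmoothForm2_wedgeForm lieL hl.2.1.lie1 hl.2.1).add
    (isSmoothForm2_wedgeForm lieL hl.2.1 hl.2.1.lie1)).const_smul _)).sub
    ((isSmoothForm2_wedgeForm _ hl.1.lie1 hl.2.1.lie1).add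
      (isSmoothForm2_wedgeForm _ hl.1 hl.2.1.lie1.lie1))

theorem isLieDeriv2_curvature {l : Triple M 𝔤} (hl : IsSmoothTriple l) :
    IsLieDeriv2 (curvature ε B l).2.1 (lieCurvature l) := by
  rw [curvature_eq]
  exact ((isLieDeriv2_d1 hl.2.1).add ((isLieDeriv2_wedgeForm lieL hl.2.1 hl.2.1).const_smul
    (1 / 2))).sub (isLieDeriv2_wedgeForm (smulL 𝔤) hl.1 hl.2.1.lie1)

/-- The middle component of `d_l d_l X = [F_l, X]`. The differentials of `ξ`, `L_R ξ` and `x`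
cancel; the rest follows from the Jacobi identity and `L_R κ = 0`. -/
theorem dCurvature_act_snd_fst {X : Gauge M 𝔤} (hX : X ∈ gaugeAlgebra M 𝔤)
    {l : Triple M 𝔤} (hl : l ∈ connections M 𝔤) (m : M) (u v : E3) :
    (dCurvature ε B l (act ε B X l)).2.1 m u v = ⁅(curvature ε B l).2.1 m u v, X.2.1 m⁆ -
      d1 l.1 m u v • lie0 X.2.1 m + X.1 m • lieCurvature l m u v := by
  have sl := isSmoothTriple_of_mem_connections hl
  have e1 : (dCurvature ε B l (act ε B X l)).2.1 m u v = d1 (act ε B X l).2.1 m u v +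
      (⁅l.2.1 m u, (act ε B X l).2.1 m v⁆ - ⁅l.2.1 m v, (act ε B X l).2.1 m u⁆ -
      (l.1 m u • lie1 (act ε B X l).2.1 m v - l.1 m v • lie1 (act ε B X l).2.1 m u) -
      ((act ε B X l).1 m u • lie1 l.2.1 m v - (act ε B X l).1 m v • lie1 l.2.1 m u)) := rfl
  rw [e1, d1_act ε B hX sl, lie1_act ε B hX sl hl.1.2.1, lie1_act ε B hX sl hl.1.2.1,
    curvature_snd_fst_apply, act_fst, act_snd_fst_apply, act_snd_fst_apply, lieCurvature,
    lie1_of_invariant hl.1.2.1]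
  simp only [Pi.add_apply, Pi.sub_apply, Pi.smul_apply, Pi.zero_apply, zero_apply, wedgeForm,
    lieL_apply, smulL_apply, lie_add, lie_sub, add_lie, sub_lie, lie_smul, smul_lie,
    leibniz_lie (l.2.1 m u) (l.2.1 m v) (X.2.1 m), zero_smul]
  rw [← lie_skew (lie1 l.2.1 m u) (l.2.1 m v), ← lie_skew (lie1 l.2.1 m v) (l.2.1 m u)]
  module

/-- Up to the factor `ε` the left side is the central component of `d_l d_l X` and the right side
that of `[F_l, X]`. Before averaging they differ by the Lie derivative of `½⟨[a ∧ a], ξ⟩ + κ ∧ ⟨a,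
L_R ξ⟩ + x⟨a ∧ L_R a⟩`. -/
theorem avg2_d1_pairForm1_add (hBsymm : B.IsSymm) (hBinv : B.lieInvariant 𝔤)
    {X : Gauge M 𝔤} (hX : X ∈ gaugeAlgebra M 𝔤) {l : Triple M 𝔤} (hl : l ∈ connections M 𝔤) :
    avg2 (d1 (pairForm1 B l.2.1 (lie0 X.2.1))) + avg2 (pairWedge B l.2.1 (lie1 (act ε B X l).2.1)) =
      avg2 (mulForm2 (pairL B) (curvature ε B l).2.1 (lie0 X.2.1)) := by
  have sl := isSmoothTriple_of_mem_connections hl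
  have sV := isSmoothTriple_of_mem_variations (act_mem ε B hX hl)
  have hX' := contMDiff_lie0 hX.2.2.1
  have p := sl.2.1.pairForm1 B hX'
  have h1 := isSmoothForm2_d1 p
  have h2 : IsSmoothForm2 (pairWedge B l.2.1 (lie1 (act ε B X l).2.1)) :=
    isSmoothForm2_wedgeForm (pairL B) sl.2.1 sV.2.1.lie1
  have h3 := (isCurvatureTriple_curvature ε B hl).smooth.mulForm2 (pairL B) hX'
  have w1 := isSmoothForm2_wedgeForm lieL sl.2.1 sl.2.1
  have w2 := (isSmoothForm2_wedgeForm lieL sl.2.1.lie1 sl.2.1).add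
    (isSmoothForm2_wedgeForm lieL sl.2.1 sl.2.1.lie1)
  rw [← avg2_add h1 h2]
  refine avg2_eq_of_isLieDeriv2 ((((isLieDeriv2_mulForm2 (pairL B)
    (isLieDeriv2_wedgeForm lieL sl.2.1 sl.2.1) hX.2.2.1).const_smul (1 / 2)).add
    (isLieDeriv2_wedgeForm (smulL ℝ) sl.1 p)).add (isLieDeriv2_mul_invariant
      (isLieDeriv2_wedgeForm (pairL B) sl.2.1 sl.2.1.lie1) hX.2.1))
      (((((w2.mulForm2 _ hX.2.2.1).add (w1.mulForm2 _ hX')).const_smul _).add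
        ((isSmoothForm2_wedgeForm _ sl.1.lie1 p).add (isSmoothForm2_wedgeForm _ sl.1 p.lie1))).add
        (isSmoothForm2_mul_left ((isSmoothForm2_wedgeForm _ sl.2.1.lie1 sl.2.1.lie1).add
          (isSmoothForm2_wedgeForm _ sl.2.1 sl.2.1.lie1.lie1)) hX.1)) h3 fun m a b => ?_
  have e2 : d1 (pairForm1 B l.2.1 (lie0 X.2.1)) m a b = _ :=
      d1_mulForm1 (pairL B) sl.2.1 hX' m a b
  rw [lie1_of_invariant hl.1.2.1, lie1_pairForm1 B sl.2.1 hX']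
  have r (x y z : 𝔤) : B x ⁅y, z⁆ = B y ⁅z, x⁆ := by
    rw [← lieInvariant_left hBinv, hBsymm.eq, ← lieInvariant_left hBinv, hBsymm.eq]
  simp only [Pi.add_apply, Pi.smul_apply, pairWedge, pairForm1_apply, mulForm2, e2, smulL_apply,
    add_apply, Pi.zero_apply, zero_apply, wedgeForm, lieL_apply, pairL_apply,
    lie1_act ε B hX sl hl.1.2.1, curvature_snd_fst_apply]
  simp only [map_add, map_sub, map_smul, LinearMap.add_apply, LinearMap.sub_apply,
    LinearMap.smul_apply, smul_eq_mul, lieInvariant_left hBinv]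
  -- The invariant triple product is alternating; fixing the order of its arguments lets `ring`
  -- close the identity.
  have s1 (x y : 𝔤) (ξ : 𝔤) : B x ⁅y, ξ⁆ = -B y ⁅x, ξ⁆ := by
    rw [r, ← lie_skew, map_neg]
  rw [hBsymm.eq (lie1 l.2.1 m b) (lie1 l.2.1 m a), s1 (l.2.1 m b) (l.2.1 m a),
    s1 (l.2.1 m b) (lie1 l.2.1 m a), s1 (lie1 l.2.1 m b) (l.2.1 m a)]
  ring

/-- The curvature is equivariant. -/
theorem extPair_dCurvature_act (hε : ε * ε = 1) (hBsymm : B.IsSymm) (hBinv : B.lieInvariant 𝔤)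
    {X Y : Gauge M 𝔤} (hX : X ∈ gaugeAlgebra M 𝔤) (hY : Y ∈ gaugeAlgebra M 𝔤) {l : Triple M 𝔤}
    (hl : l ∈ connections M 𝔤) :
    extPair ε B (dCurvature ε B l (act ε B X l)) Y =
      extPair ε B (curvature ε B l) (bracket ε B X Y) := by
  have sl := isSmoothTriple_of_mem_connections hl
  have hV := act_mem ε B hX hl
  have hX' := contMDiff_lie0 hX.2.2.1
  have hY' := contMDiff_lie0 hY.2.2.1
  have hF := isCurvatureTriple_curvature ε B hl
  have hdF := isCurvatureTriple_dCurvature ε B hl hV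
  have hB := contMDiff_bracket₂ ε B hX hY
  have g1 := hF.smooth.mulForm2 (pairL B) hB
  have g2 := hF.smooth.mulForm2 (pairL B) hX'
  have g2y := isSmoothForm2_mul_left g2 hY.1
  have g3 := (isSmoothForm2_d1 sl.1).mulForm2 (smulL ℝ) (contMDiff_pair B hX.2.2.1 hY')
  have g4 := (isSmoothForm2_d1 sl.1).mulForm2 (smulL ℝ) (contMDiff_pair B hX.2.2.1 hY.2.2.1)
  have p := sl.2.1.pairForm1 B hX'
  have lF := isLieDeriv2_curvature ε B sl
  -- By `dCurvature_act_snd_fst` the left side is `⟨[F, X], η⟩`, where `F` and `η` are the middle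
  -- components of the curvature and of `Y`. Moving `L_R` onto `η` discards the Lie derivative of
  -- `x⟨F, η⟩ - dκ⟨ξ, η⟩`.
  have key : avg2 (mulForm2 (pairL B) (dCurvature ε B l (act ε B X l)).2.1 Y.2.1) =
      avg2 ((mulForm2 (pairL B) (curvature ε B l).2.1 (bracket ε B X Y).2.1 -
        fun m u v => Y.1 m * mulForm2 (pairL B) (curvature ε B l).2.1 (lie0 X.2.1) m u v) +
        mulForm2 (smulL ℝ) (d1 l.1) fun m => B (X.2.1 m) (lie0 Y.2.1 m)) := by
    refine avg2_eq_of_isLieDeriv2 ((isLieDeriv2_mul_invariant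
      (isLieDeriv2_mulForm2 (pairL B) lF hY.2.2.1) hX.2.1).sub (isLieDeriv2_mulForm2 (smulL ℝ)
        (isLieDeriv2_d1 sl.1) (contMDiff_pair B hX.2.2.1 hY.2.2.1)))
      ((isSmoothForm2_mul_left (((isSmoothForm2_lieCurvature sl).mulForm2 _ hY.2.2.1).add
        (hF.smooth.mulForm2 _ hY')) hX.1).sub (((isSmoothForm2_d1 sl.1.lie1).mulForm2 _
          (contMDiff_pair B hX.2.2.1 hY.2.2.1)).add ((isSmoothForm2_d1 sl.1).mulForm2 _
            (contMDiff_lie0 (contMDiff_pair B hX.2.2.1 hY.2.2.1)))))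
      ((g1.sub g2y).add g3) fun m a b => ?_
    have h0 : d1 (lie1 l.1) = 0 := by
      rw [lie1_of_invariant hl.1.2.1, ← d1_d0 (contMDiff_const (c := (0 : ℝ))), d0_const]
    have h1 : lie0 (fun m => B (X.2.1 m) (Y.2.1 m)) m = _ :=
      lie0_bilin (pairL B) hX.2.2.1 hY.2.2.1 m
    simp only [Pi.add_apply, Pi.sub_apply, mulForm2, h0, h1, dCurvature_act_snd_fst ε B hX hl,
      smulL_apply, pairL_apply, Pi.zero_apply, bracket]
    simp only [map_add, map_sub, map_smul, LinearMap.add_apply, LinearMap.sub_apply,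
      LinearMap.smul_apply, smul_eq_mul, lieInvariant_left hBinv, zero_mul]
    ring
  rw [avg2_add (g1.sub g2y) g3, avg2_sub g1 g2y] at key
  funext m a b
  have hk := congrFun (congrFun (congrFun key m) a) b
  have hA := congrFun (congrFun (congrFun (avg2_d1_pairForm1_add ε B hBsymm hBinv hX hl) m) a) b
  have e0 : avg2 (mulForm2 (smulL ℝ) (d1 l.1) fun m => B (X.2.1 m) (lie0 Y.2.1 m)) m a b =
      d1 l.1 m a b * avg0 (fun m => B (X.2.1 m) (lie0 Y.2.1 m)) m :=
    avg2_invariant_mul (isInvariant2_d1 sl.1 hl.1.2.1) _ m a b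
  simp only [Pi.add_apply, Pi.sub_apply, avg2_mul_invariant hY.2.1, e0] at hk hA
  have h1 : d1 (act ε B X l).1 = 0 := by rw [act_fst, d1_d0 hX.1]
  have h3 : d1 (act ε B X l).2.2 = ε • avg2 (d1 (pairForm1 B l.2.1 (lie0 X.2.1))) := by
    have e : (act ε B X l).2.2 = d0 X.2.2 + ε • avg1 (pairForm1 B l.2.1 (lie0 X.2.1)) := rfl
    rw [e, d1_add (isSmoothForm1_d0 hX.2.2.2.1) ((isSmoothForm1_avg1 p).const_smul ε),
      d1_d0 hX.2.2.2.1, zero_add, d1_const_smul (isSmoothForm1_avg1 p), d1_avg1 p]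
  have e3 : extPair ε B (dCurvature ε B l (act ε B X l)) Y m a b =
      avg2 (mulForm2 (pairL B) (dCurvature ε B l (act ε B X l)).2.1 Y.2.1) m a b +
        ε * ((d1 (act ε B X l).1 m a b + 0) * Y.2.2 m + (d1 (act ε B X l).2.2 m a b +
          ε * avg2 (pairWedge B l.2.1 (lie1 (act ε B X l).2.1)) m a b) * Y.1 m) := rfl
  have e4 : extPair ε B (curvature ε B l) (bracket ε B X Y) m a b =
      avg2 (mulForm2 (pairL B) (curvature ε B l).2.1 (bracket ε B X Y).2.1) m a b +
        ε * ((curvature ε B l).1 m a b * (ε * avg0 (fun m => B (X.2.1 m) (lie0 Y.2.1 m)) m) +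
          (curvature ε B l).2.2 m a b * 0) := rfl
  have e5 : (curvature ε B l).1 = d1 l.1 := by rw [curvature_eq]
  rw [e3, e4, e5, h1, h3]
  simp only [Pi.zero_apply, Pi.smul_apply, smul_eq_mul]
  -- `hA` accounts for the central component of `d_l d_l X`, and the cocycle in `bracket ε B X Y`
  -- absorbs the term with `dκ`; both come with `ε * ε = 1`.
  linear_combination hk + Y.1 m * hA + (Y.1 m * (avg2 (d1 (pairForm1 B l.2.1 (lie0 X.2.1))) m a b +
    avg2 (pairWedge B l.2.1 (lie1 (act ε B X l).2.1)) m a b) -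
      d1 l.1 m a b * avg0 (fun m => B (X.2.1 m) (lie0 Y.2.1 m)) m) * hε

end Pairing

end ExtendedConnection

end

noncomputable section

open Filter Set

set_option linter.unusedSectionVars false

namespace ExtendedConnection

/-! ### Local lifts, fibres and descent along the projection. -/

section Projection

variable {S : Type*} [TopologicalSpace S] [ChartedSpace E2 S] [IsManifold (𝓡 2) ∞ S]
variable {M : Type*} [TopologicalSpace M] [ChartedSpace E3 M] [IsManifold (𝓡 3) ∞ M]
  [MulAction Circle M] {π : M → S}

/-- The differential of the projection. -/
def dProj (π : M → S) (m : M) : E3 →L[ℝ] E2 := mfderiv (𝓡 3) (𝓡 2) π m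

/-- The differential of a map from the plane to the total space. -/
def dLift (Ψ : E2 → M) (y : E2) : E2 →L[ℝ] E3 := mfderiv 𝓘(ℝ, E2) (𝓡 3) Ψ y

/-- The differential of the inverse of the preferred chart at a point of the surface. -/
def dChartSymm (i : S) (y : E2) : E2 →L[ℝ] E2 :=
  mfderiv 𝓘(ℝ, E2) (𝓡 2) (extChartAt (𝓡 2) i).symm y

/-- The differential of the preferred chart at a point of the surface. -/
def dChart (i : S) (p : S) : E2 →L[ℝ] E2 := mfderiv (𝓡 2) 𝓘(ℝ, E2) (extChartAt (𝓡 2) i) p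

/-- The given local section is rotated by the constant element `τ m` so that it passes through `m`.
-/
theorem IsPrincipalCircleBundle.exists_section (hπ : IsPrincipalCircleBundle π) (m : M) :
    ∃ U : Set S, IsOpen U ∧ π m ∈ U ∧ ∃ σ : S → M, ContMDiffOn (𝓡 2) (𝓡 3) ∞ σ U ∧
      (∀ q ∈ U, π (σ q) = q) ∧ σ (π m) = m := by
  have := hπ.smooth_action
  obtain ⟨U, hU, hm, s, τ, hs, hτ, h1, h2, h3⟩ := hπ.locally_trivial (π m)
  obtain ⟨θ, hθ⟩ := exists_rot (M := M) (τ m)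
  refine ⟨U, hU, hm, fun q => τ m • s q, ?_, fun q hq => ?_, h2 m hm⟩
  · simp only [hθ]
    exact (contMDiff_rot θ).comp_contMDiffOn hs
  · rw [hπ.map_smul, h1 q hq]

theorem IsPrincipalCircleBundle.exists_rot_eq (hπ : IsPrincipalCircleBundle π) {m m' : M}
    (h : π m = π m') : ∃ θ, m' = rot θ m := by
  obtain ⟨U, hU, hm, s, τ, hs, hτ, h1, h2, h3⟩ := hπ.locally_trivial (π m)
  obtain ⟨θ, hθ⟩ := exists_rot (M := M) (τ m' * (τ m)⁻¹)
  refine ⟨θ, ?_⟩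
  rw [← hθ, mul_smul]
  have e := h2 m hm
  have e' := h2 m' (by rw [mem_preimage, ← h]; exact hm)
  rw [← h] at e'
  have e'' : (τ m)⁻¹ • m = s (π m) := by
    conv_lhs => rw [← e]
    rw [h2 m hm, ← e, ← mul_smul, e, inv_mul_cancel, one_smul]
  rw [e'', e']

theorem IsPrincipalCircleBundle.surjective (hπ : IsPrincipalCircleBundle π) :
    Function.Surjective π := fun p => by
  obtain ⟨U, hU, hm, s, τ, hs, hτ, h1, -⟩ := hπ.locally_trivial p
  exact ⟨s p, h1 p hm⟩

theorem IsPrincipalCircleBundle.dProj_dRot (hπ : IsPrincipalCircleBundle π) (θ : ℝ) (m : M)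
    (u : E3) : dProj π (rot θ m) (dRot θ m u) = dProj π m u := by
  have := hπ.smooth_action
  have h : π ∘ rot θ = π := funext fun x => hπ.map_smul _ x
  have h1 := mfderiv_comp m (hπ.smooth.mdifferentiable (by simp) (rot θ m))
    (mdifferentiable_rot θ m)
  rw [h] at h1
  exact (congrArg (fun f : E3 →L[ℝ] E2 => f u) h1).symm

theorem IsPrincipalCircleBundle.dProj_genR (hπ : IsPrincipalCircleBundle π) (m : M) :
    dProj π m (genR m) = 0 := by
  have := hπ.smooth_action
  have h : π ∘ (fun θ : ℝ => rot θ m) = fun _ => π m := funext fun x => hπ.map_smul _ m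
  have h1 := mfderiv_comp (0 : ℝ) (g := π) (f := fun θ : ℝ => rot θ m)
    (hπ.smooth.mdifferentiable (by simp) _) ((contMDiff_orbit m).mdifferentiable (by simp) _)
  rw [h, mfderiv_const] at h1
  have h2 : dProj π (rot 0 m) (genR m) = 0 :=
    (congrArg (fun f : ℝ →L[ℝ] E2 => f 1) h1).symm
  rwa [rot_zero] at h2

theorem contMDiffAt_chart_symm₂ {i : S} {y : E2} (hy : y ∈ (extChartAt (𝓡 2) i).target) :
    ContMDiffAt 𝓘(ℝ, E2) (𝓡 2) ∞ (extChartAt (𝓡 2) i).symm y :=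
  (contMDiffOn_extChartAt_symm i).contMDiffAt ((isOpen_extChartAt_target i).mem_nhds hy)

/-- Near a point of the domain of a chart, the inverse of the chart lifts to the total space. -/
theorem IsPrincipalCircleBundle.exists_lift (hπ : IsPrincipalCircleBundle π) {i : S} {y : E2}
    (hy : y ∈ (extChartAt (𝓡 2) i).target) {m : M} (hm : π m = (extChartAt (𝓡 2) i).symm y) :
    ∃ Ψ : E2 → M, ContMDiffAt 𝓘(ℝ, E2) (𝓡 3) ∞ Ψ y ∧ Ψ y = m ∧
      ∀ᶠ z in 𝓝 y, π (Ψ z) = (extChartAt (𝓡 2) i).symm z := by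
  obtain ⟨U, hU, hmU, σ, hσ, h1, h2⟩ := hπ.exists_section m
  have hψ := contMDiffAt_chart_symm₂ hy
  refine ⟨σ ∘ (extChartAt (𝓡 2) i).symm, ContMDiffAt.comp y ?_ hψ, ?_, ?_⟩
  · rw [← hm]
    exact hσ.contMDiffAt (hU.mem_nhds hmU)
  · rw [Function.comp_apply, ← hm, h2]
  · have : ∀ᶠ z in 𝓝 y, (extChartAt (𝓡 2) i).symm z ∈ U :=
      hψ.continuousAt.eventually_mem (by rw [← hm]; exact hU.mem_nhds hmU)
    filter_upwards [this] with z hz using h1 _ hz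

theorem IsPrincipalCircleBundle.dProj_dLift (hπ : IsPrincipalCircleBundle π) {i : S} {y : E2}
    {Ψ : E2 → M} (hΨ : MDifferentiableAt 𝓘(ℝ, E2) (𝓡 3) Ψ y)
    (h : ∀ᶠ z in 𝓝 y, π (Ψ z) = (extChartAt (𝓡 2) i).symm z) (u : E2) :
    dProj π (Ψ y) (dLift Ψ y u) = dChartSymm i y u := by
  have h1 := mfderiv_comp y (hπ.smooth.mdifferentiable (by simp) (Ψ y)) hΨ
  have h2 : mfderiv 𝓘(ℝ, E2) (𝓡 2) (π ∘ Ψ) y =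
    mfderiv 𝓘(ℝ, E2) (𝓡 2) (extChartAt (𝓡 2) i).symm y := Filter.EventuallyEq.mfderiv_eq h
  exact (congrArg (fun f : E2 →L[ℝ] E2 => f u) (h2.symm.trans h1)).symm

theorem dChart_dChartSymm {i : S} {y : E2} (hy : y ∈ (extChartAt (𝓡 2) i).target) (u : E2) :
    dChart i ((extChartAt (𝓡 2) i).symm y) (dChartSymm i y u) = u := by
  have : IsManifold (𝓡 2) 1 S := IsManifold.of_le (n := ∞) (by norm_cast)
  have h := mfderiv_extChartAt_comp_mfderivWithin_extChartAt_symm (I := 𝓡 2) (x := i) hy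
  rw [ModelWithCorners.range_eq_univ, mfderivWithin_univ] at h
  exact congrArg (fun f : E2 →L[ℝ] E2 => f u) h

theorem dChartSymm_dChart {i : S} {y : E2} (hy : y ∈ (extChartAt (𝓡 2) i).target) (u : E2) :
    dChartSymm i y (dChart i ((extChartAt (𝓡 2) i).symm y) u) = u := by
  have : IsManifold (𝓡 2) 1 S := IsManifold.of_le (n := ∞) (by norm_cast)
  have h := mfderivWithin_extChartAt_symm_comp_mfderiv_extChartAt (I := 𝓡 2) (x := i) hy
  rw [ModelWithCorners.range_eq_univ, mfderivWithin_univ] at h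
  exact congrArg (fun f : E2 →L[ℝ] E2 => f u) h

/-- A local lift of the inverse chart splits the projection up to the chart, whose differential is
invertible. -/
theorem IsPrincipalCircleBundle.dProj_surjective (hπ : IsPrincipalCircleBundle π) (m : M) :
    Function.Surjective (dProj π m) := fun w => by
  have hy := mem_extChartAt_target (I := 𝓡 2) (π m)
  have hs : π m = (extChartAt (𝓡 2) (π m)).symm (extChartAt (𝓡 2) (π m) (π m)) :=
    ((extChartAt (𝓡 2) (π m)).left_inv (mem_extChartAt_source _)).symm
  obtain ⟨Ψ, h1, h2, h3⟩ := hπ.exists_lift hy hs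
  let w' := dChart (π m) ((extChartAt (𝓡 2) (π m)).symm (extChartAt (𝓡 2) (π m) (π m))) w
  refine ⟨dLift Ψ (extChartAt (𝓡 2) (π m) (π m)) w', ?_⟩
  have := hπ.dProj_dLift (h1.mdifferentiableAt (by simp)) h3 w'
  rw [h2] at this
  rw [this, dChartSymm_dChart hy]

/-- The kernel of `dProj π m` has dimension `3 - 2 = 1` and contains the nonzero vector `R`. -/
theorem IsPrincipalCircleBundle.exists_smul_genR (hπ : IsPrincipalCircleBundle π) {m : M}
    (hR : genR m ≠ 0) {u : E3} (hu : dProj π m u = 0) : ∃ c : ℝ, u = c • genR m := by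
  have h1 := LinearMap.finrank_range_add_finrank_ker (dProj π m : E3 →ₗ[ℝ] E2)
  have h2 : LinearMap.range (dProj π m : E3 →ₗ[ℝ] E2) = ⊤ :=
    LinearMap.range_eq_top.2 (hπ.dProj_surjective m)
  rw [h2, finrank_top, finrank_euclideanSpace_fin, finrank_euclideanSpace_fin] at h1
  have h3 : Module.finrank ℝ (LinearMap.ker (dProj π m : E3 →ₗ[ℝ] E2)) = 1 := by omega
  let r : LinearMap.ker (dProj π m : E3 →ₗ[ℝ] E2) := ⟨genR m, hπ.dProj_genR m⟩
  have hr : r ≠ 0 := fun h => hR (congrArg Subtype.val h)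
  obtain ⟨c, hc⟩ := (finrank_eq_one_iff_of_nonzero' r hr).1 h3 ⟨u, hu⟩
  exact ⟨c, (congrArg Subtype.val hc).symm⟩

section Basic

variable (hR : ∀ m : M, genR m ≠ 0)
include hR

/-- Points of one fibre differ by a rotation, which preserves `α`; vectors with the same projection
then differ by a multiple of `R`, which `α` kills. -/
theorem IsPrincipalCircleBundle.basic1_congr (hπ : IsPrincipalCircleBundle π) {α : Form1 M ℝ}
    (hα : IsHorizontal1 α) (hi : IsInvariant1 α) {m m' : M} (h : π m = π m') {u u' : E3}
    (hu : dProj π m u = dProj π m' u') : α m u = α m' u' := by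
  obtain ⟨θ, rfl⟩ := hπ.exists_rot_eq h
  have e : α m u = α (rot θ m) (dRot θ m u) := by
    conv_lhs => rw [← hi θ]
    rfl
  obtain ⟨c, hc⟩ := hπ.exists_smul_genR (hR (rot θ m)) (u := dRot θ m u - u')
    (by rw [map_sub, hπ.dProj_dRot, hu, sub_self])
  have e2 : α (rot θ m) (dRot θ m u) - α (rot θ m) u' = 0 := by
    rw [← map_sub, hc, _root_.map_smul, hα, smul_zero]
  rw [e, sub_eq_zero.1 e2]

theorem IsPrincipalCircleBundle.horizontal2_congr (hπ : IsPrincipalCircleBundle π)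
    {β : Form2 M ℝ} (hβ : IsSmoothForm2 β) (hh : IsHorizontal2 β) {m : M} {u u' v v' : E3}
    (hu : dProj π m u = dProj π m u') (hv : dProj π m v = dProj π m v') :
    β m u v = β m u' v' := by
  obtain ⟨η, -, hη, ha⟩ := hβ
  have a1 (u v w : E3) : η m (u + v) w = η m u w + η m v w :=
    congrArg (fun f : E3 →L[ℝ] ℝ => f w) ((η m).map_add u v)
  have a2 (c : ℝ) (u w : E3) : η m (c • u) w = c * η m u w :=
    congrArg (fun f : E3 →L[ℝ] ℝ => f w) ((η m).map_smul c u)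
  have a3 (u v w : E3) : η m w (u + v) = η m w u + η m w v := (η m w).map_add u v
  have a4 (c : ℝ) (u w : E3) : η m w (c • u) = c * η m w u := (η m w).map_smul c u
  have hskew (u v : E3) : η m u v = -η m v u := by
    have h := ha m (u + v)
    rw [hη, a1, a3, a3, ← hη m u u, ← hη m v v, ha, ha] at h
    linarith
  obtain ⟨c, hc⟩ := hπ.exists_smul_genR (hR m) (u := u - u') (by rw [map_sub, hu, sub_self])
  obtain ⟨d, hd⟩ := hπ.exists_smul_genR (hR m) (u := v - v') (by rw [map_sub, hv, sub_self])
  have e1 (v : E3) : η m (genR m) v = 0 := by rw [← hη]; exact hh m v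
  rw [sub_eq_iff_eq_add.1 hc, sub_eq_iff_eq_add.1 hd, hη, hη, a1, a3, a3, a4, a4, a2, a2, e1, e1,
    hskew u', e1]
  ring

theorem IsPrincipalCircleBundle.basic2_congr (hπ : IsPrincipalCircleBundle π) {β : Form2 M ℝ}
    (hβ : IsBasic2 β) {m m' : M} (h : π m = π m') {u u' v v' : E3}
    (hu : dProj π m u = dProj π m' u') (hv : dProj π m v = dProj π m' v') :
    β m u v = β m' u' v' := by
  obtain ⟨θ, rfl⟩ := hπ.exists_rot_eq h
  have e : β m u v = β (rot θ m) (dRot θ m u) (dRot θ m v) := by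
    conv_lhs => rw [← hβ.invariant θ]
    rfl
  rw [e]
  exact hπ.horizontal2_congr hR hβ.smooth hβ.horizontal (by rw [hπ.dProj_dRot, hu])
    (by rw [hπ.dProj_dRot, hv])

/-- `descend` is a choice by `Classical.epsilon`, so only existence of a descended form is at stake:
points and vectors are lifted arbitrarily, and `basic2_congr` makes the lifts irrelevant. -/
theorem IsPrincipalCircleBundle.descend_apply (hπ : IsPrincipalCircleBundle π) {β : Form2 M ℝ}
    (hβ : IsBasic2 β) (m : M) (u v : E3) :
    descend π β (π m) (dProj π m u) (dProj π m v) = β m u v := by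
  have hex : ∃ η : S → E2 → E2 → ℝ, ∀ (m : M) (u v : E3),
      β m u v = η (π m) (dProj π m u) (dProj π m v) := by
    choose f hf using hπ.surjective
    choose g hg using fun p => hπ.dProj_surjective (f p)
    refine ⟨fun p u v => β (f p) (g p u) (g p v), fun m u v => ?_⟩
    exact hπ.basic2_congr hR hβ (hf (π m)).symm (hg _ _).symm (hg _ _).symm
  exact (Classical.epsilon_spec hex m u v).symm

end Basic

end Projection

/-! ### Linear algebra and integration in the plane. -/

section Plane

/-- The first basis vector of the plane. -/
abbrev e₀ : E2 := EuclideanSpace.single 0 1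

/-- The second basis vector of the plane. -/
abbrev e₁ : E2 := EuclideanSpace.single 1 1

theorem eq_smul_add_smul (u : E2) : u = u 0 • e₀ + u 1 • e₁ := by
  ext i
  fin_cases i <;> simp

theorem det_eq_of_plane (A : E2 →L[ℝ] E2) : A.det = A e₀ 0 * A e₁ 1 - A e₁ 0 * A e₀ 1 := by
  have h := LinearMap.det_toMatrix (EuclideanSpace.basisFun (Fin 2) ℝ).toBasis (A : E2 →ₗ[ℝ] E2)
  rw [ContinuousLinearMap.det, ← h, Matrix.det_fin_two]
  simp [LinearMap.toMatrix_apply]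

/-- Alternating forms on the plane are multiples of the determinant; this supplies the Jacobian in a
change of charts. -/
theorem bilin_comp_det (η : E3 →L[ℝ] E3 →L[ℝ] ℝ) (hη : ∀ u, η u u = 0) (L : E2 →L[ℝ] E3)
    (A : E2 →L[ℝ] E2) : η (L (A e₀)) (L (A e₁)) = A.det * η (L e₀) (L e₁) := by
  have hskew : η (L e₁) (L e₀) = -η (L e₀) (L e₁) := by
    have h := hη (L e₀ + L e₁)
    simp only [map_add, add_apply, hη] at h
    linarith
  rw [det_eq_of_plane]
  conv_lhs => rw [eq_smul_add_smul (A e₀), eq_smul_add_smul (A e₁)]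
  simp only [map_add, map_smul, add_apply, smul_apply, hη, hskew, smul_eq_mul]
  ring

/-- Integration by parts against the constant function `1`. -/
theorem integral_fderiv_eq_zero {f : E2 → ℝ} (hf : ContDiff ℝ 1 f) (hc : HasCompactSupport f)
    (v : E2) : ∫ y, fderiv ℝ f y v = 0 := by
  have h1 : Continuous fun y => fderiv ℝ f y v :=
    (hf.continuous_fderiv (by norm_num)).clm_apply continuous_const
  have h2 : HasCompactSupport fun y => fderiv ℝ f y v := hc.fderiv_apply (𝕜 := ℝ) v
  have h := integral_mul_fderiv_eq_neg_fderiv_mul_of_integrable (μ := MeasureTheory.volume)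
    (f := fun _ : E2 => (1 : ℝ)) (g := f) (v := v) (by simp)
    (by simpa using h1.integrable_of_hasCompactSupport h2)
    (by simpa using hf.continuous.integrable_of_hasCompactSupport hc)
    (fun x _ => differentiableAt_const _)
    (fun x _ => hf.differentiable (by norm_num) x)
  simpa using h

end Plane

/-! ### Coordinate expressions through local lifts. -/

section Coordinates

variable {S : Type*} [TopologicalSpace S] [ChartedSpace E2 S] [IsManifold (𝓡 2) ∞ S]
variable {M : Type*} [TopologicalSpace M] [ChartedSpace E3 M] [IsManifold (𝓡 3) ∞ M]
  [MulAction Circle M] {π : M → S}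

/-- The coordinate expression of the two-form on the surface given by a basic two-form. -/
def coord (π : M → S) (i : S) (β : Form2 M ℝ) (y : E2) : ℝ :=
  descend π β ((extChartAt (𝓡 2) i).symm y) (dChartSymm i y e₀) (dChartSymm i y e₁)

/-- `Ψ` lifts the inverse of the chart at `i` near `y`. -/
structure IsLift (π : M → S) (i : S) (Ψ : E2 → M) (y : E2) : Prop where
  mem : y ∈ (extChartAt (𝓡 2) i).target
  mdifferentiableAt : MDifferentiableAt 𝓘(ℝ, E2) (𝓡 3) Ψ y
  eventually_eq : ∀ᶠ z in 𝓝 y, π (Ψ z) = (extChartAt (𝓡 2) i).symm z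

theorem IsLift.eq {i : S} {Ψ : E2 → M} {y : E2} (h : IsLift π i Ψ y) :
    π (Ψ y) = (extChartAt (𝓡 2) i).symm y := h.eventually_eq.self_of_nhds

theorem IsLift.of_contMDiffAt {i : S} {Ψ : E2 → M} {y : E2}
    (hy : y ∈ (extChartAt (𝓡 2) i).target) (h : ContMDiffAt 𝓘(ℝ, E2) (𝓡 3) ∞ Ψ y)
    (h' : ∀ᶠ z in 𝓝 y, π (Ψ z) = (extChartAt (𝓡 2) i).symm z) : ∀ᶠ z in 𝓝 y, IsLift π i Ψ z := by
  filter_upwards [eventually_contMDiffAt h, h'.eventually_nhds,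
    extChartAt_target_mem_nhds' hy] with z h1 h2 h3 using ⟨h3, h1, h2⟩

theorem IsPrincipalCircleBundle.exists_isLift (hπ : IsPrincipalCircleBundle π) {i : S} {y : E2}
    (hy : y ∈ (extChartAt (𝓡 2) i).target) {m : M} (hm : π m = (extChartAt (𝓡 2) i).symm y) :
    ∃ Ψ : E2 → M, ContMDiffAt 𝓘(ℝ, E2) (𝓡 3) ∞ Ψ y ∧ Ψ y = m ∧ ∀ᶠ z in 𝓝 y, IsLift π i Ψ z := by
  obtain ⟨Ψ, h1, h2, h3⟩ := hπ.exists_lift hy hm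
  exact ⟨Ψ, h1, h2, IsLift.of_contMDiffAt hy h1 h3⟩

theorem IsPrincipalCircleBundle.exists_isLift' (hπ : IsPrincipalCircleBundle π) {i : S} {y : E2}
    (hy : y ∈ (extChartAt (𝓡 2) i).target) :
    ∃ Ψ : E2 → M, ContMDiffAt 𝓘(ℝ, E2) (𝓡 3) ∞ Ψ y ∧ ∀ᶠ z in 𝓝 y, IsLift π i Ψ z := by
  obtain ⟨m, hm⟩ := hπ.surjective ((extChartAt (𝓡 2) i).symm y)
  obtain ⟨Ψ, h1, -, h3⟩ := hπ.exists_isLift hy hm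
  exact ⟨Ψ, h1, h3⟩

variable (hπ : IsPrincipalCircleBundle π) (hR : ∀ m : M, genR m ≠ 0)
include hπ hR

/-- Any local lift of the inverse chart computes the coordinate expression from the form on `M`.
Linearity, continuity and the change of charts become statements about `β`, with no regularity asked
of the descended form. -/
theorem coord_eq {β : Form2 M ℝ} (hβ : IsBasic2 β) {i : S} {Ψ : E2 → M} {y : E2}
    (h : IsLift π i Ψ y) : coord π i β y = β (Ψ y) (dLift Ψ y e₀) (dLift Ψ y e₁) := by
  rw [coord, ← h.eq, ← hπ.dProj_dLift h.mdifferentiableAt h.eventually_eq,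
    ← hπ.dProj_dLift h.mdifferentiableAt h.eventually_eq, hπ.descend_apply hR hβ]

theorem coord_add {β γ : Form2 M ℝ} (hβ : IsBasic2 β) (hγ : IsBasic2 γ) {i : S} {y : E2}
    (hy : y ∈ (extChartAt (𝓡 2) i).target) :
    coord π i (β + γ) y = coord π i β y + coord π i γ y := by
  obtain ⟨Ψ, -, h⟩ := hπ.exists_isLift' hy
  rw [coord_eq hπ hR hβ h.self_of_nhds, coord_eq hπ hR hγ h.self_of_nhds,
    coord_eq hπ hR (hβ.add hγ) h.self_of_nhds]
  rfl

theorem coord_const_smul {β : Form2 M ℝ} (hβ : IsBasic2 β) (c : ℝ) {i : S} {y : E2}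
    (hy : y ∈ (extChartAt (𝓡 2) i).target) : coord π i (c • β) y = c * coord π i β y := by
  obtain ⟨Ψ, -, h⟩ := hπ.exists_isLift' hy
  rw [coord_eq hπ hR hβ h.self_of_nhds, coord_eq hπ hR (hβ.const_smul c) h.self_of_nhds]
  rfl

theorem coord_eq_zero {β : Form2 M ℝ} (hβ : IsBasic2 β) {K : Set S}
    (h0 : ∀ m, π m ∉ K → ∀ u v, β m u v = 0) {i : S} {y : E2}
    (hy : y ∈ (extChartAt (𝓡 2) i).target) (hK : (extChartAt (𝓡 2) i).symm y ∉ K) :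
    coord π i β y = 0 := by
  obtain ⟨Ψ, -, h⟩ := hπ.exists_isLift' hy
  rw [coord_eq hπ hR hβ h.self_of_nhds, h0]
  rwa [h.self_of_nhds.eq]

theorem continuousOn_coord {β : Form2 M ℝ} (hβ : IsBasic2 β) (i : S) :
    ContinuousOn (coord π i β) (extChartAt (𝓡 2) i).target := fun y hy => by
  obtain ⟨Ψ, h1, h⟩ := hπ.exists_isLift' hy
  obtain ⟨η, h2, h3⟩ := hβ.smooth.exists_pb2
  have h4 : ContinuousAt (fun z => pb2 Ψ η z e₀ e₁) y :=
    (((contDiffAt_pb2 h3 h1).clm_apply contDiffAt_const).clm_apply contDiffAt_const).continuousAt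
  refine (h4.congr ?_).continuousWithinAt
  filter_upwards [h] with z hz
  rw [coord_eq hπ hR hβ hz, h2]
  rfl

theorem coord_change {β : Form2 M ℝ} (hβ : IsBasic2 β) {i j : S} {y : E2}
    (hy : y ∈ (extChartAt (𝓡 2) i).target)
    (hj : (extChartAt (𝓡 2) i).symm y ∈ (extChartAt (𝓡 2) j).source) :
    DifferentiableAt ℝ (extChartAt (𝓡 2) j ∘ (extChartAt (𝓡 2) i).symm) y ∧ coord π i β y =
      (fderiv ℝ (extChartAt (𝓡 2) j ∘ (extChartAt (𝓡 2) i).symm) y : E2 →L[ℝ] E2).det *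
        coord π j β (extChartAt (𝓡 2) j ((extChartAt (𝓡 2) i).symm y)) := by
  set T : E2 → E2 := extChartAt (𝓡 2) j ∘ (extChartAt (𝓡 2) i).symm with hT
  have hψ := contMDiffAt_chart_symm₂ hy
  have hφ : ContMDiffAt (𝓡 2) 𝓘(ℝ, E2) ∞ (extChartAt (𝓡 2) j) ((extChartAt (𝓡 2) i).symm y) :=
    contMDiffAt_extChartAt' (by rwa [extChartAt_source] at hj)
  have hTs : ContMDiffAt 𝓘(ℝ, E2) 𝓘(ℝ, E2) ∞ T y := ContMDiffAt.comp y hφ hψ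
  have hTy : T y ∈ (extChartAt (𝓡 2) j).target := (extChartAt (𝓡 2) j).map_source hj
  have hjT : (extChartAt (𝓡 2) j).symm (T y) = (extChartAt (𝓡 2) i).symm y :=
    (extChartAt (𝓡 2) j).left_inv hj
  obtain ⟨Ψ, h1, h⟩ := hπ.exists_isLift' hTy
  have hm1 : MDifferentiableAt 𝓘(ℝ, E2) 𝓘(ℝ, E2) T y := hTs.mdifferentiableAt (by simp)
  -- A lift over chart `j` composed with the transition map is a lift over chart `i`, so both
  -- coordinate expressions evaluate `β` at the same point of `M`.
  have hl : IsLift π i (Ψ ∘ T) y := by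
    refine ⟨hy, MDifferentiableAt.comp y h.self_of_nhds.mdifferentiableAt hm1, ?_⟩
    have e1 : ∀ᶠ z in 𝓝 y, π (Ψ (T z)) = (extChartAt (𝓡 2) j).symm (T z) :=
      hTs.continuousAt.eventually h.self_of_nhds.eventually_eq
    have e2 : ∀ᶠ z in 𝓝 y, (extChartAt (𝓡 2) i).symm z ∈ (extChartAt (𝓡 2) j).source :=
      hψ.continuousAt.eventually_mem ((isOpen_extChartAt_source j).mem_nhds hj)
    filter_upwards [e1, e2] with z hz1 hz2
    exact hz1.trans ((extChartAt (𝓡 2) j).left_inv hz2)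
  refine ⟨hm1.differentiableAt, ?_⟩
  have hd : dLift (Ψ ∘ T) y = (dLift Ψ (T y)).comp (fderiv ℝ T y) := by
    have := mfderiv_comp y h.self_of_nhds.mdifferentiableAt hm1
    rw [mfderiv_eq_fderiv] at this
    exact this
  obtain ⟨η, h2, h3⟩ := hβ.smooth.exists_pb2
  change _ = _ * coord π j β (T y)
  rw [coord_eq hπ hR hβ hl, coord_eq hπ hR hβ h.self_of_nhds, hd, h2, h2]
  refine bilin_comp_det (η (Ψ (T y))) (fun u => ?_) (dLift Ψ (T y)) (fderiv ℝ T y)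
  rw [← h2, hβ.smooth.alt]

end Coordinates

/-! ### Integration over the surface. -/

section Integral

variable {S : Type*} [TopologicalSpace S] [ChartedSpace E2 S] [IsManifold (𝓡 2) ∞ S]
  [T2Space S] [CompactSpace S]
variable {M : Type*} [TopologicalSpace M] [ChartedSpace E3 M] [IsManifold (𝓡 3) ∞ M]
  [MulAction Circle M] {π : M → S}

theorem finite_chartPartition (S : Type*) [TopologicalSpace S] [ChartedSpace E2 S]
    [IsManifold (𝓡 2) ∞ S] [T2Space S] [CompactSpace S] :
    {i : S | (Function.support (chartPartition S i)).Nonempty}.Finite :=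
  (chartPartition S).locallyFinite.finite_nonempty_of_compact

/-- The indices of the nonzero functions of the partition of unity. -/
def chartIndices (S : Type*) [TopologicalSpace S] [ChartedSpace E2 S]
    [IsManifold (𝓡 2) ∞ S] [T2Space S] [CompactSpace S] : Finset S :=
  (finite_chartPartition S).toFinset

theorem chartPartition_eq_zero {i : S} (hi : i ∉ chartIndices S) (p : S) :
    chartPartition S i p = 0 := by
  by_contra h
  exact hi ((finite_chartPartition S).mem_toFinset.2 ⟨p, h⟩)

theorem sum_chartPartition (p : S) : ∑ i ∈ chartIndices S, chartPartition S i p = 1 := by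
  rw [← (chartPartition S).sum_eq_one (mem_univ p)]
  refine (finsum_eq_sum_of_support_subset _ fun i hi => ?_).symm
  by_contra h
  exact hi (chartPartition_eq_zero h p)

theorem tsupport_chartPartition_subset (i : S) :
    tsupport (chartPartition S i) ⊆ (extChartAt (𝓡 2) i).source := by
  rw [extChartAt_source]
  exact (SmoothPartitionOfUnity.exists_isSubordinate_chartAt_source (𝓡 2) S).choose_spec i

theorem chartPartition_eq_zero_of_notMem {i p : S} (h : p ∉ (extChartAt (𝓡 2) i).source) :
    chartPartition S i p = 0 :=
  image_eq_zero_of_notMem_tsupport fun h' => h (tsupport_chartPartition_subset i h')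

theorem surfaceIntegral_eq_sum (β : Form2 M ℝ) : surfaceIntegral π β =
    ∑ i ∈ chartIndices S, ∫ y in (extChartAt (𝓡 2) i).target,
      chartPartition S i ((extChartAt (𝓡 2) i).symm y) * coord π i β y := by
  refine finsum_eq_sum_of_support_subset _ fun i hi => ?_
  by_contra h
  refine hi ?_
  simp only [chartPartition_eq_zero h, zero_mul, MeasureTheory.integral_zero]

theorem isCompact_image_chart {i : S} {K : Set S} (hK : IsCompact K)
    (h : K ⊆ (extChartAt (𝓡 2) i).source) : IsCompact (extChartAt (𝓡 2) i '' K) :=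
  hK.image_of_continuousOn ((continuousOn_extChartAt i).mono h)

theorem integrableOn_target {i : S} {K : Set S} (hK : IsCompact K)
    (h : K ⊆ (extChartAt (𝓡 2) i).source) {f : E2 → ℝ}
    (hf : ContinuousOn f (extChartAt (𝓡 2) i).target)
    (h0 : ∀ y ∈ (extChartAt (𝓡 2) i).target, (extChartAt (𝓡 2) i).symm y ∉ K → f y = 0) :
    MeasureTheory.IntegrableOn f (extChartAt (𝓡 2) i).target := by
  have hsub : extChartAt (𝓡 2) i '' K ⊆ (extChartAt (𝓡 2) i).target := by
    rintro _ ⟨p, hp, rfl⟩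
    exact (extChartAt (𝓡 2) i).map_source (h hp)
  refine ((hf.mono hsub).integrableOn_compact (isCompact_image_chart hK h)).of_forall_sdiff_eq_zero
    (isOpen_extChartAt_target i).measurableSet fun y hy => h0 y hy.1 fun hyK => hy.2 ?_
  exact ⟨_, hyK, (extChartAt (𝓡 2) i).right_inv hy.1⟩

theorem continuousOn_chartPartition (i j : S) : ContinuousOn
    (fun y => chartPartition S i ((extChartAt (𝓡 2) j).symm y)) (extChartAt (𝓡 2) j).target :=
  (chartPartition S i).contMDiff.continuous.comp_continuousOn (continuousOn_extChartAt_symm j)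

variable (hπ : IsPrincipalCircleBundle π) (hR : ∀ m : M, genR m ≠ 0)
include hπ hR

theorem integrableOn_partition_coord {β : Form2 M ℝ} (hβ : IsBasic2 β) (i : S) :
    MeasureTheory.IntegrableOn (fun y => chartPartition S i ((extChartAt (𝓡 2) i).symm y) *
      coord π i β y) (extChartAt (𝓡 2) i).target := by
  refine integrableOn_target (isClosed_tsupport (chartPartition S i)).isCompact
    (tsupport_chartPartition_subset i)
    ((continuousOn_chartPartition i i).mul (continuousOn_coord hπ hR hβ i)) fun y hy h => ?_
  rw [image_eq_zero_of_notMem_tsupport h, zero_mul]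

theorem surfaceIntegral_add {β γ : Form2 M ℝ} (hβ : IsBasic2 β) (hγ : IsBasic2 γ) :
    surfaceIntegral π (β + γ) = surfaceIntegral π β + surfaceIntegral π γ := by
  rw [surfaceIntegral_eq_sum, surfaceIntegral_eq_sum, surfaceIntegral_eq_sum,
    ← Finset.sum_add_distrib]
  refine Finset.sum_congr rfl fun i _ => ?_
  rw [← MeasureTheory.integral_add (integrableOn_partition_coord hπ hR hβ i)
    (integrableOn_partition_coord hπ hR hγ i)]
  refine MeasureTheory.setIntegral_congr_fun (isOpen_extChartAt_target i).measurableSet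
    fun y hy => ?_
  simp only [coord_add hπ hR hβ hγ hy, mul_add]

theorem surfaceIntegral_const_smul {β : Form2 M ℝ} (hβ : IsBasic2 β) (c : ℝ) :
    surfaceIntegral π (c • β) = c * surfaceIntegral π β := by
  rw [surfaceIntegral_eq_sum, surfaceIntegral_eq_sum, Finset.mul_sum]
  refine Finset.sum_congr rfl fun i _ => ?_
  rw [← MeasureTheory.integral_const_mul]
  refine MeasureTheory.setIntegral_congr_fun (isOpen_extChartAt_target i).measurableSet
    fun y hy => ?_
  simp only [coord_const_smul hπ hR hβ c hy]
  ring

/-- A form with support in the domain of a chart can be integrated in that chart. -/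
theorem surfaceIntegral_eq_setIntegral (hS : IsOrientedAtlas S) {β : Form2 M ℝ} (hβ : IsBasic2 β)
    {j : S} {K : Set S} (hK : IsCompact K) (hKj : K ⊆ (extChartAt (𝓡 2) j).source)
    (h0 : ∀ m, π m ∉ K → ∀ u v, β m u v = 0) :
    surfaceIntegral π β = ∫ y in (extChartAt (𝓡 2) j).target, coord π j β y := by
  -- Each summand of the integral is moved from chart `i` to chart `j`; there the partition
  -- functions add up to one.
  have key (i : S) : ∫ y in (extChartAt (𝓡 2) i).target,
      chartPartition S i ((extChartAt (𝓡 2) i).symm y) * coord π i β y =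
      ∫ y in (extChartAt (𝓡 2) j).target,
        chartPartition S i ((extChartAt (𝓡 2) j).symm y) * coord π j β y := by
    set T : E2 → E2 := extChartAt (𝓡 2) j ∘ (extChartAt (𝓡 2) i).symm with hT
    let A : Set E2 := (extChartAt (𝓡 2) i).target ∩
      (extChartAt (𝓡 2) i).symm ⁻¹' (extChartAt (𝓡 2) j).source
    have hA : IsOpen A := (continuousOn_extChartAt_symm i).isOpen_inter_preimage
      (isOpen_extChartAt_target i) (isOpen_extChartAt_source j)
    have hTA : T '' A = (extChartAt (𝓡 2) j).target ∩
        (extChartAt (𝓡 2) j).symm ⁻¹' (extChartAt (𝓡 2) i).source := by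
      ext z
      constructor
      · rintro ⟨y, ⟨hy, hy'⟩, rfl⟩
        refine ⟨(extChartAt (𝓡 2) j).map_source hy', ?_⟩
        rw [mem_preimage, hT, Function.comp_apply, (extChartAt (𝓡 2) j).left_inv hy']
        exact (extChartAt (𝓡 2) i).map_target hy
      · rintro ⟨hz, hz'⟩
        refine ⟨extChartAt (𝓡 2) i ((extChartAt (𝓡 2) j).symm z),
          ⟨(extChartAt (𝓡 2) i).map_source hz', ?_⟩, ?_⟩
        · rw [mem_preimage, (extChartAt (𝓡 2) i).left_inv hz']
          exact (extChartAt (𝓡 2) j).map_target hz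
        · rw [hT, Function.comp_apply, (extChartAt (𝓡 2) i).left_inv hz',
            (extChartAt (𝓡 2) j).right_inv hz]
    have hinj : InjOn T A := fun y hy z hz h => by
      have h1 := (extChartAt (𝓡 2) j).injOn hy.2 hz.2 h
      exact (extChartAt (𝓡 2) i).symm.injOn hy.1 hz.1 h1
    -- Both integrals reduce to the overlap: on the `i` side because `β` vanishes off `K`, on the
    -- `j` side because the partition function vanishes off its chart.
    have e1 := MeasureTheory.setIntegral_eq_of_subset_of_forall_sdiff_eq_zero
      (μ := MeasureTheory.volume) (isOpen_extChartAt_target (I := 𝓡 2) i).measurableSet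
      (inter_subset_left : A ⊆ _)
      (f := fun y => chartPartition S i ((extChartAt (𝓡 2) i).symm y) * coord π i β y)
      fun y hy => by
        have : (extChartAt (𝓡 2) i).symm y ∉ K := fun h => hy.2 ⟨hy.1, hKj h⟩
        simp only [coord_eq_zero hπ hR hβ h0 hy.1 this, mul_zero]
    have e2 := MeasureTheory.setIntegral_eq_of_subset_of_forall_sdiff_eq_zero
      (μ := MeasureTheory.volume) (isOpen_extChartAt_target (I := 𝓡 2) j).measurableSet
      (inter_subset_left : (extChartAt (𝓡 2) j).target ∩
        (extChartAt (𝓡 2) j).symm ⁻¹' (extChartAt (𝓡 2) i).source ⊆ _)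
      (f := fun y => chartPartition S i ((extChartAt (𝓡 2) j).symm y) * coord π j β y)
      fun y hy => by
        have : (extChartAt (𝓡 2) j).symm y ∉ (extChartAt (𝓡 2) i).source :=
          fun h => hy.2 ⟨hy.1, h⟩
        simp only [chartPartition_eq_zero_of_notMem this, zero_mul]
    rw [e1, e2, ← hTA, MeasureTheory.integral_image_eq_integral_abs_det_fderiv_smul
      MeasureTheory.volume hA.measurableSet (f' := fun y => fderiv ℝ T y)
      (fun y hy => (coord_change hπ hR hβ hy.1 hy.2).1.hasFDerivAt.hasFDerivWithinAt) hinj]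
    refine MeasureTheory.setIntegral_congr_fun hA.measurableSet fun y hy => ?_
    -- Orientation removes the absolute value in the change of variables formula.
    have hdet : 0 < (fderiv ℝ T y : E2 →L[ℝ] E2).det := hS i j y hy
    have h1 : coord π i β y = (fderiv ℝ T y : E2 →L[ℝ] E2).det * coord π j β (T y) :=
      (coord_change hπ hR hβ hy.1 hy.2).2
    have h2 : (extChartAt (𝓡 2) j).symm (T y) = (extChartAt (𝓡 2) i).symm y :=
      (extChartAt (𝓡 2) j).left_inv hy.2
    change _ = |(fderiv ℝ T y : E2 →L[ℝ] E2).det| •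
      (chartPartition S i ((extChartAt (𝓡 2) j).symm (T y)) * coord π j β (T y))
    simp only [h1, h2, abs_of_pos hdet, smul_eq_mul]
    ring
  have hc := continuousOn_coord hπ hR hβ j
  have hint (i : S) : MeasureTheory.IntegrableOn (fun y =>
      chartPartition S i ((extChartAt (𝓡 2) j).symm y) * coord π j β y)
      (extChartAt (𝓡 2) j).target :=
    integrableOn_target hK hKj ((continuousOn_chartPartition i j).mul hc) fun y hy h => by
      simp only [coord_eq_zero hπ hR hβ h0 hy h, mul_zero]
  rw [surfaceIntegral_eq_sum, Finset.sum_congr rfl fun i _ => key i,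
    ← MeasureTheory.integral_finsetSum _ fun i _ => hint i]
  refine MeasureTheory.setIntegral_congr_fun (isOpen_extChartAt_target j).measurableSet
    fun y hy => ?_
  simp only [← Finset.sum_mul, sum_chartPartition, one_mul]

end Integral

/-! ### Stokes' theorem for basic one-forms. -/

section Stokes

variable {S : Type*} [TopologicalSpace S] [ChartedSpace E2 S] [IsManifold (𝓡 2) ∞ S]
variable {M : Type*} [TopologicalSpace M] [ChartedSpace E3 M] [IsManifold (𝓡 3) ∞ M]
  [MulAction Circle M] {π : M → S}

open Classical in
/-- The coordinate expression of the one-form on the surface given by a basic one-form, extended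
by zero. -/
def coord1 (π : M → S) (i : S) (α : Form1 M ℝ) (y : E2) : E2 →L[ℝ] ℝ :=
  if h : ∃ Ψ, IsLift π i Ψ y then pb h.choose α y else 0

theorem coord1_of_notMem {i : S} (α : Form1 M ℝ) {y : E2}
    (hy : y ∉ (extChartAt (𝓡 2) i).target) : coord1 π i α y = 0 :=
  dif_neg fun ⟨_, h⟩ => hy h.mem

variable (hπ : IsPrincipalCircleBundle π) (hR : ∀ m : M, genR m ≠ 0)
include hπ hR

/-- Two lifts give the same one-form by `basic1_congr`, so the choice in `coord1` is harmless and
smoothness can be tested with one smooth lift. -/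
theorem coord1_eq {α : Form1 M ℝ} (hα : IsBasic1 α) {i : S} {Ψ : E2 → M} {y : E2}
    (h : IsLift π i Ψ y) : coord1 π i α y = pb Ψ α y := by
  have hex : ∃ Ψ, IsLift π i Ψ y := ⟨Ψ, h⟩
  rw [coord1, dif_pos hex]
  have h' := hex.choose_spec
  ext1 u
  exact hπ.basic1_congr hR hα.horizontal hα.invariant (h'.eq.trans h.eq.symm)
    ((hπ.dProj_dLift h'.mdifferentiableAt h'.eventually_eq u).trans
      (hπ.dProj_dLift h.mdifferentiableAt h.eventually_eq u).symm)

theorem contDiffAt_coord1 {α : Form1 M ℝ} (hα : IsBasic1 α) {i : S} {y : E2}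
    (hy : y ∈ (extChartAt (𝓡 2) i).target) : ContDiffAt ℝ ∞ (coord1 π i α) y := by
  obtain ⟨Ψ, h1, h⟩ := hπ.exists_isLift' hy
  refine (hα.smooth.contDiffAt_pb h1).congr_of_eventuallyEq ?_
  filter_upwards [h] with z hz using coord1_eq hπ hR hα hz

theorem coord1_eq_zero {α : Form1 M ℝ} (hα : IsBasic1 α) {K : Set S}
    (h0 : ∀ m, π m ∉ K → α m = 0) {i : S} {y : E2} (hy : y ∉ extChartAt (𝓡 2) i '' K) :
    coord1 π i α y = 0 := by
  by_cases ht : y ∈ (extChartAt (𝓡 2) i).target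
  · obtain ⟨Ψ, -, h⟩ := hπ.exists_isLift' ht
    have h1 : α (Ψ y) = 0 := h0 _ (by
      rw [h.self_of_nhds.eq]
      exact fun hK => hy ⟨_, hK, (extChartAt (𝓡 2) i).right_inv ht⟩)
    rw [coord1_eq hπ hR hα h.self_of_nhds]
    ext1 u
    exact congrArg (fun f : E3 →L[ℝ] ℝ => f (dLift Ψ y u)) h1
  · exact coord1_of_notMem α ht

theorem coord_d1 {α : Form1 M ℝ} (hα : IsBasic1 α) (hd : IsBasic2 (d1 α)) {i : S} {y : E2}
    (hy : y ∈ (extChartAt (𝓡 2) i).target) : coord π i (d1 α) y =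
      fderiv ℝ (coord1 π i α) y e₀ e₁ - fderiv ℝ (coord1 π i α) y e₁ e₀ := by
  obtain ⟨Ψ, h1, h⟩ := hπ.exists_isLift' hy
  have e : coord1 π i α =ᶠ[𝓝 y] pb Ψ α := by
    filter_upwards [h] with z hz using coord1_eq hπ hR hα hz
  rw [coord_eq hπ hR hd h.self_of_nhds, e.fderiv_eq]
  exact d1_pb hα.smooth h1 e₀ e₁

variable [T2Space S] [CompactSpace S]

/-- Extended by zero, the coordinate components are smooth with compact support in the plane, so
their partial derivatives integrate to zero. -/
theorem surfaceIntegral_d1_of_support (hS : IsOrientedAtlas S) {α : Form1 M ℝ} (hα : IsBasic1 α)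
    (hd : IsBasic2 (d1 α)) {j : S} {K : Set S} (hK : IsCompact K)
    (hKj : K ⊆ (extChartAt (𝓡 2) j).source) (h0 : ∀ m, π m ∉ K → α m = 0)
    (h0' : ∀ m, π m ∉ K → ∀ u v, d1 α m u v = 0) : surfaceIntegral π (d1 α) = 0 := by
  have hc := isCompact_image_chart hK hKj
  have hz (y : E2) (hy : y ∉ extChartAt (𝓡 2) j '' K) : coord1 π j α =ᶠ[𝓝 y] 0 := by
    filter_upwards [hc.isClosed.isOpen_compl.mem_nhds hy] with z hz
      using coord1_eq_zero hπ hR hα h0 hz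
  have hs : ContDiff ℝ ∞ (coord1 π j α) := contDiff_iff_contDiffAt.2 fun y => by
    by_cases hy : y ∈ (extChartAt (𝓡 2) j).target
    · exact contDiffAt_coord1 hπ hR hα hy
    · refine contDiffAt_const.congr_of_eventuallyEq (hz y ?_)
      rintro ⟨p, hp, rfl⟩
      exact hy ((extChartAt (𝓡 2) j).map_source (hKj hp))
  have hs1 (u : E2) : ContDiff ℝ 1 fun y => coord1 π j α y u :=
    (hs.of_le (by norm_cast)).clm_apply contDiff_const
  have hs2 (u : E2) : HasCompactSupport fun y => coord1 π j α y u :=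
    HasCompactSupport.intro hc fun y hy => by
      rw [coord1_eq_zero hπ hR hα h0 hy]
      rfl
  have hs3 (u v : E2) : MeasureTheory.Integrable fun y => fderiv ℝ (fun y => coord1 π j α y u) y v :=
    (((hs1 u).continuous_fderiv (by norm_num)).clm_apply
      continuous_const).integrable_of_hasCompactSupport ((hs2 u).fderiv_apply (𝕜 := ℝ) v)
  have hs4 (u v y : E2) : fderiv ℝ (fun y => coord1 π j α y u) y v =
      fderiv ℝ (coord1 π j α) y v u := by
    have := (hs.differentiable (by norm_num) y).hasFDerivAt.clm_apply (hasFDerivAt_const u y)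
    rw [this.fderiv]
    simp
  rw [surfaceIntegral_eq_setIntegral hπ hR hS hd hK hKj h0',
    MeasureTheory.setIntegral_congr_fun (g := fun y => fderiv ℝ (fun y => coord1 π j α y e₁) y e₀ -
      fderiv ℝ (fun y => coord1 π j α y e₀) y e₁) (isOpen_extChartAt_target j).measurableSet
      fun y hy => by simp only [coord_d1 hπ hR hα hd hy, hs4],
    MeasureTheory.setIntegral_eq_integral_of_forall_compl_eq_zero,
    MeasureTheory.integral_sub (hs3 _ _) (hs3 _ _), integral_fderiv_eq_zero (hs1 _) (hs2 _),
    integral_fderiv_eq_zero (hs1 _) (hs2 _), sub_zero]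
  intro y hy
  rw [hs4, hs4, (hz y _).fderiv_eq]
  · simp
  · rintro ⟨p, hp, rfl⟩
    exact hy ((extChartAt (𝓡 2) j).map_source (hKj hp))

/-- Stokes' theorem. -/
theorem surfaceIntegral_d1 [ContMDiffSMul (𝓡 1) (𝓡 3) ∞ Circle M] (hS : IsOrientedAtlas S)
    {α : Form1 M ℝ} (hα : IsBasic1 α) : surfaceIntegral π (d1 α) = 0 := by
  have hd {α : Form1 M ℝ} (hα : IsBasic1 α) : IsBasic2 (d1 α) :=
    isBasic2_d1 hα.smooth 0 hα.horizontal hα.invariant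
  -- The partition of unity is pulled back to `M`, where its functions are invariant and
  -- multiplication by them preserves basic forms.
  let f (j : S) (m : M) : ℝ := chartPartition S j (π m)
  have hf (j : S) : ContMDiff (𝓡 3) 𝓘(ℝ, ℝ) ∞ (f j) :=
    (chartPartition S j).contMDiff.comp hπ.smooth
  have hfi (j : S) (t : Circle) (m : M) : f j (t • m) = f j m :=
    congrArg (chartPartition S j) (hπ.map_smul t m)
  have hz (j : S) (m : M) (hm : π m ∉ tsupport (chartPartition S j)) : f j =ᶠ[𝓝 m] fun _ => 0 := by
    filter_upwards [hπ.smooth.continuous.continuousAt.eventually_mem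
      ((isClosed_tsupport _).isOpen_compl.mem_nhds hm)] with z hz
      using image_eq_zero_of_notMem_tsupport (f := chartPartition S j) hz
  have h1 (j : S) : surfaceIntegral π (d1 (mulForm1 (smulL ℝ) α (f j))) = 0 := by
    have hb := hα.mul (hf j) (hfi j)
    refine surfaceIntegral_d1_of_support hπ hR hS hb (hd hb)
      (isClosed_tsupport (chartPartition S j)).isCompact (tsupport_chartPartition_subset j)
      (fun m hm => ?_) fun m hm u v => ?_
    · ext1 u
      rw [mulForm1_apply, (hz j m hm).self_of_nhds, map_zero]
      rfl
    · have e : d0 (f j) m = 0 := (hz j m hm).mfderiv_eq.trans mfderiv_const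
      rw [d1_mulForm1 _ hα.smooth (hf j), (hz j m hm).self_of_nhds, e]
      simp
  have h2 (s : Finset S) : ContMDiff (𝓡 3) 𝓘(ℝ, ℝ) ∞ (fun m => ∑ j ∈ s, f j m) :=
    contMDiff_finsetSum fun j _ => hf j
  -- The integral is additive for two basic forms at a time, hence the induction over finite sets of
  -- indices.
  have h3 (s : Finset S) :
      surfaceIntegral π (d1 (mulForm1 (smulL ℝ) α fun m => ∑ j ∈ s, f j m)) = 0 := by
    classical
    induction s using Finset.induction_on with
    | empty =>
      have e : mulForm1 (smulL ℝ) α (fun m => ∑ j ∈ (∅ : Finset S), f j m) = (0 : ℝ) • α := by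
        funext m
        ext1 u
        simp [mulForm1_apply]
      rw [e, d1_const_smul hα.smooth, surfaceIntegral_const_smul hπ hR (hd hα), zero_mul]
    | insert j s hj ih =>
      have e : mulForm1 (smulL ℝ) α (fun m => ∑ j ∈ insert j s, f j m) =
          mulForm1 (smulL ℝ) α (f j) + mulForm1 (smulL ℝ) α fun m => ∑ j ∈ s, f j m := by
        funext m
        ext1 u
        simp [mulForm1_apply, Finset.sum_insert hj]
      have b1 := hα.mul (hf j) (hfi j)
      have b2 := hα.mul (h2 s) fun t m => Finset.sum_congr rfl fun j _ => hfi j t m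
      rw [e, d1_add b1.smooth b2.smooth, surfaceIntegral_add hπ hR (hd b1) (hd b2), h1, ih, zero_add]
  have e : mulForm1 (smulL ℝ) α (fun m => ∑ j ∈ chartIndices S, f j m) = α := by
    funext m
    ext1 u
    rw [mulForm1_apply]
    simp [f, sum_chartPartition, smulL]
  rw [← e]
  exact h3 _

end Stokes

/-! ### Detecting horizontal one-forms by test functions. -/

section Nondegenerate

variable {S : Type*} [TopologicalSpace S] [ChartedSpace E2 S] [IsManifold (𝓡 2) ∞ S]
variable {M : Type*} [TopologicalSpace M] [ChartedSpace E3 M] [IsManifold (𝓡 3) ∞ M]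

/-- A chart agrees near its centre with a globally defined smooth function. -/
theorem exists_contMDiff_eq_extChartAt [T2Space S] (p : S) :
    ∃ H : S → E2, ContMDiff (𝓡 2) 𝓘(ℝ, E2) ∞ H ∧ H =ᶠ[𝓝 p] extChartAt (𝓡 2) p := by
  obtain ⟨f⟩ : Nonempty (SmoothBumpFunction (𝓡 2) p) := inferInstance
  refine ⟨fun x => f x • extChartAt (𝓡 2) p x, f.contMDiff_smul contMDiffOn_extChartAt, ?_⟩
  filter_upwards [f.eventuallyEq_one] with x hx
  rw [hx, Pi.one_apply, one_smul]

theorem chartRep_apply_of_mem {F : Type*} [NormedAddCommGroup F] [NormedSpace ℝ F] (β : Form1 M F)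
    {m x : M} (hx : x ∈ (extChartAt (𝓡 3) m).source) (w : E3) :
    chartRep β m (extChartAt (𝓡 3) m x) w = β x ((mfderiv 𝓘(ℝ, E3) (𝓡 3)
      (extChartAt (𝓡 3) m).symm (extChartAt (𝓡 3) m x) : E3 →L[ℝ] E3) w) :=
  congrArg (fun y => β y _) ((extChartAt (𝓡 3) m).left_inv hx)

/-- If a one-form `α` factors through `A`, the values of `α` on the vectors with prescribed value
of `A` vary continuously. -/
theorem eventually_pos_of_factors {A : Form1 M E2} (hA : IsSmoothForm1 A) {α : Form1 M ℝ}
    (hα : IsSmoothForm1 α) {m : M} (hs : Function.Surjective (A m))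
    (hk : ∀ᶠ x in 𝓝 m, ∀ u, A x u = 0 → α x u = 0) {u : E3} (hu : α m u ≠ 0) :
    ∀ᶠ x in 𝓝 m, ∀ v, A x v = A m u → 0 < α m u * α x v := by
  obtain ⟨L₀, hL₀⟩ := (A m : E3 →ₗ[ℝ] E2).exists_rightInverse_of_surjective
    (LinearMap.range_eq_top.2 hs)
  let L : E2 →L[ℝ] E3 := LinearMap.toContinuousLinearMap L₀
  have hL (w : E2) : A m (L w) = w := congrArg (fun f : E2 →ₗ[ℝ] E2 => f w) hL₀
  let z₀ : E3 := extChartAt (𝓡 3) m m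
  -- `P` restricts `A` to the range of the fixed right inverse `L`. It is the identity at the
  -- centre, hence invertible nearby, and its inverse yields a continuous choice `e` of vectors with
  -- prescribed value of `A`.
  let P (z : E3) : E2 →L[ℝ] E2 := (chartRep A m z).comp L
  have hP : ContinuousAt P z₀ :=
    ((isSmoothForm1_iff A).1 hA m).continuousAt.clm_comp continuousAt_const
  have hP0 : P z₀ = ((1 : (E2 →L[ℝ] E2)ˣ) : E2 →L[ℝ] E2) := by
    ext1 w
    change chartRep A m z₀ (L w) = w
    rw [chartRep_self, hL]
  have hinv : ContinuousAt (fun z => Ring.inverse (P z)) z₀ := by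
    refine ContinuousAt.comp (g := Ring.inverse) ?_ hP
    rw [hP0]
    exact NormedRing.inverse_continuousAt _
  let e (z : E3) : E3 := L (Ring.inverse (P z) (A m u))
  have he : ContinuousAt e z₀ :=
    L.continuous.continuousAt.comp (hinv.clm_apply continuousAt_const)
  have hF : ContinuousAt (fun z => α m u * chartRep α m z (e z)) z₀ :=
    continuousAt_const.mul (((isSmoothForm1_iff α).1 hα m).continuousAt.clm_apply he)
  have hF0 : 0 < α m u * chartRep α m z₀ (e z₀) := by
    have h1 : e z₀ = L (A m u) := by
      change L (Ring.inverse (P z₀) (A m u)) = _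
      rw [hP0, Ring.inverse_unit]
      rfl
    have h2 := hk.self_of_nhds (L (A m u) - u) (by rw [map_sub, hL, sub_self])
    rw [map_sub, sub_eq_zero] at h2
    rw [chartRep_self, h1, h2]
    exact mul_self_pos.2 hu
  have hunit : ∀ᶠ z in 𝓝 z₀, IsUnit (P z) := by
    refine hP.eventually (p := fun x => IsUnit x) ?_
    rw [hP0]
    exact Units.isOpen.mem_nhds ⟨1, rfl⟩
  have hcont : ContinuousAt (extChartAt (𝓡 3) m) m := continuousAt_extChartAt m
  filter_upwards [hk, hcont.eventually (hF.eventually_const_lt hF0), hcont.eventually hunit,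
    extChartAt_source_mem_nhds (I := 𝓡 3) m] with x hkx hpos hux hx v hv
  let w : E3 := (mfderiv 𝓘(ℝ, E3) (𝓡 3) (extChartAt (𝓡 3) m).symm (extChartAt (𝓡 3) m x) :
    E3 →L[ℝ] E3) (e (extChartAt (𝓡 3) m x))
  have h1 : chartRep A m (extChartAt (𝓡 3) m x) (e (extChartAt (𝓡 3) m x)) = A m u :=
    congrArg (fun f : E2 →L[ℝ] E2 => f (A m u)) (Ring.mul_inverse_cancel _ hux)
  rw [chartRep_apply_of_mem A hx] at h1
  rw [chartRep_apply_of_mem α hx] at hpos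
  -- Any other such vector differs from the chosen one by an element of the kernel of `A`, where `α`
  -- vanishes.
  have h2 := hkx (v - w) (by rw [map_sub, hv]; exact sub_eq_zero.2 h1.symm)
  rw [map_sub, sub_eq_zero] at h2
  rwa [h2]

variable [MulAction Circle M] {π : M → S}

theorem IsPrincipalCircleBundle.d0_comp_apply (hπ : IsPrincipalCircleBundle π) {H : S → E2}
    (hH : ContMDiff (𝓡 2) 𝓘(ℝ, E2) ∞ H) {p : S} {m : M}
    (h : H =ᶠ[𝓝 (π m)] extChartAt (𝓡 2) p) (u : E3) :
    d0 (H ∘ π) m u = dChart p (π m) (dProj π m u) := by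
  have h1 := mfderiv_comp m (hH.mdifferentiable (by simp) (π m))
    (hπ.smooth.mdifferentiable (by simp) m)
  rw [h.mfderiv_eq] at h1
  exact congrArg (fun f : E3 →L[ℝ] E2 => f u) h1

theorem IsPrincipalCircleBundle.d0_comp_dLift (hπ : IsPrincipalCircleBundle π) {H : S → E2}
    (hH : ContMDiff (𝓡 2) 𝓘(ℝ, E2) ∞ H) {p : S} {Ψ : E2 → M} {y : E2} (h : IsLift π p Ψ y)
    (h' : H =ᶠ[𝓝 (π (Ψ y))] extChartAt (𝓡 2) p) (u : E2) :
    d0 (H ∘ π) (Ψ y) (dLift Ψ y u) = u := by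
  rw [hπ.d0_comp_apply hH h', hπ.dProj_dLift h.mdifferentiableAt h.eventually_eq, h.eq,
    dChart_dChartSymm h.mem]

/-- Suppose `α m u ≠ 0`. For a suitable linear function `f` of coordinates near `π m`, the value of
`α ∧ df` on a lifted frame is the value of `α` on a vector with the same coordinates as `u`, so it
keeps the sign of `α m u` near `m`. A bump function localizes the integrand there; it lives on `M`
because `α` need not be invariant. -/
theorem IsPrincipalCircleBundle.eq_zero_of_surfaceIntegral [T2Space S] [CompactSpace S]
    [T2Space M] (hπ : IsPrincipalCircleBundle π) (hR : ∀ m : M, genR m ≠ 0)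
    (hS : IsOrientedAtlas S) {α : Form1 M ℝ} (hα : IsSmoothForm1 α) (hh : IsHorizontal1 α)
    (h : ∀ g : M → ℝ, ContMDiff (𝓡 3) 𝓘(ℝ, ℝ) ∞ g → ∀ f : S → ℝ, ContMDiff (𝓡 2) 𝓘(ℝ, ℝ) ∞ f →
      surfaceIntegral π (avg2 (mulForm2 (smulL ℝ) (wedge α (d0 (f ∘ π))) g)) = 0) : α = 0 := by
  have := hπ.smooth_action
  by_contra hne
  obtain ⟨m, hm⟩ := Function.ne_iff.1 hne
  obtain ⟨u, hu⟩ : ∃ u, α m u ≠ 0 := by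
    by_contra! h0
    exact hm (ContinuousLinearMap.ext h0)
  obtain ⟨H, hH, hHp⟩ := exists_contMDiff_eq_extChartAt (π m)
  let y₀ : E2 := extChartAt (𝓡 2) (π m) (π m)
  have hy₀ : y₀ ∈ (extChartAt (𝓡 2) (π m)).target := mem_extChartAt_target _
  obtain ⟨Ψ₀, -, hΨm, hΨ₀⟩ := hπ.exists_isLift hy₀
    ((extChartAt (𝓡 2) (π m)).left_inv (mem_extChartAt_source (π m))).symm
  have hHπ : ContMDiff (𝓡 3) 𝓘(ℝ, E2) ∞ (H ∘ π) := hH.comp hπ.smooth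
  let A : Form1 M E2 := d0 (H ∘ π)
  have hA : IsSmoothForm1 A := isSmoothForm1_d0 hHπ
  have hAR (θ : ℝ) (x : M) (v : E3) : A (rot θ x) (dRot θ x v) = A x v := by
    have h1 := pull1_d0 hHπ θ
    have h2 : (fun x => (H ∘ π) (rot θ x)) = H ∘ π := funext fun x =>
      congrArg H (hπ.map_smul _ x)
    rw [h2] at h1
    exact congrArg (fun β : Form1 M E2 => β x v) h1
  have hnear : ∀ᶠ x in 𝓝 m, H =ᶠ[𝓝 (π x)] extChartAt (𝓡 2) (π m) :=
    hπ.smooth.continuous.continuousAt.eventually hHp.eventually_nhds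
  have hs : Function.Surjective (A m) := fun w => ⟨dLift Ψ₀ y₀ w, by
    have := hπ.d0_comp_dLift hH hΨ₀.self_of_nhds (by rw [hΨm]; exact hHp) w
    rwa [hΨm] at this⟩
  have hsrc : ∀ᶠ x in 𝓝 m, π x ∈ (extChartAt (𝓡 2) (π m)).source :=
    hπ.smooth.continuous.continuousAt.eventually_mem (extChartAt_source_mem_nhds (π m))
  have hk : ∀ᶠ x in 𝓝 m, ∀ v, A x v = 0 → α x v = 0 := by
    filter_upwards [hnear, hsrc] with x hx hx' v hv
    have e1 : dChart (π m) (π x) (dProj π x v) = 0 := (hπ.d0_comp_apply hH hx v).symm.trans hv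
    have e2 := dChartSymm_dChart ((extChartAt (𝓡 2) (π m)).map_source hx') (dProj π x v)
    rw [(extChartAt (𝓡 2) (π m)).left_inv hx', e1, map_zero] at e2
    obtain ⟨c, hc⟩ := hπ.exists_smul_genR (hR x) e2.symm
    rw [hc, _root_.map_smul, hh, smul_zero]
  have hpos := eventually_pos_of_factors hA hα hs hk hu
  obtain ⟨K, hKc, hKn, hKs⟩ : ∃ K : Set S, IsCompact K ∧ K ∈ 𝓝 (π m) ∧
      K ⊆ (extChartAt (𝓡 2) (π m)).source := by
    obtain ⟨K, h1, h2, h3⟩ := local_compact_nhds (extChartAt_source_mem_nhds (I := 𝓡 2) (π m))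
    exact ⟨K, h3, h1, h2⟩
  have hKm : ∀ᶠ x in 𝓝 m, π x ∈ K := hπ.smooth.continuous.continuousAt.eventually_mem hKn
  have hN := hpos.and (hnear.and hKm)
  obtain ⟨g, hg, hgs⟩ := (SmoothBumpFunction.nhds_basis_support (I := 𝓡 3) hN).mem_iff.1
    hN
  let a : E2 := A m u
  -- If `A v = e₀` and `A w = e₁`, this choice gives `α ∧ df (v, w) = α (a 0 • v + a 1 • w)`, and
  -- that vector has the same image under `A` as `u`.
  let l : E2 →L[ℝ] ℝ := a 0 • EuclideanSpace.proj 1 - a 1 • EuclideanSpace.proj 0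
  let f : S → ℝ := fun p => l (H p)
  have hf : ContMDiff (𝓡 2) 𝓘(ℝ, ℝ) ∞ f := l.contMDiff.comp hH
  have hd (x : M) (v : E3) : d0 (f ∘ π) x v = l (A x v) := by
    have h1 := mfderiv_comp x (l.contMDiff.mdifferentiable (by simp : (∞ : WithTop ℕ∞) ≠ 0) _)
      (hHπ.mdifferentiable (by simp) x)
    have h2 : mfderiv 𝓘(ℝ, E2) 𝓘(ℝ, ℝ) l ((H ∘ π) x) = l := by
      rw [mfderiv_eq_fderiv]
      exact l.fderiv
    rw [h2] at h1
    exact congrArg (fun F : E3 →L[ℝ] ℝ => F v) h1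
  let γ : Form2 M ℝ := wedge α (d0 (f ∘ π))
  have hγ (x : M) (hx : g x ≠ 0) (v w : E3) (hv : A x v = e₀) (hw : A x w = e₁) :
      0 < α m u * γ x v w := by
    have e : γ x v w = α x (a 0 • v + a 1 • w) := by
      simp only [γ, wedge, hd, hv, hw, map_add, l]
      simp
      ring
    rw [e]
    refine (hgs hx).1 _ ?_
    rw [map_add, _root_.map_smul, _root_.map_smul, hv, hw]
    exact (eq_smul_add_smul a).symm
  have hfπ : ContMDiff (𝓡 3) 𝓘(ℝ, ℝ) ∞ (f ∘ π) := hf.comp hπ.smooth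
  have hγ1 : IsSmoothForm2 γ := isSmoothForm2_wedgeForm (smulL ℝ) hα (isSmoothForm1_d0 hfπ)
  have hγ2 : IsHorizontal2 γ := isHorizontal2_wedgeForm (smulL ℝ) hh
    (isHorizontal1_d0 hfπ fun t x => congrArg f (hπ.map_smul t x))
  have hβ1 : IsSmoothForm2 (mulForm2 (smulL ℝ) γ g) := hγ1.mulForm2 _ g.contMDiff
  have hβ : IsBasic2 (avg2 (mulForm2 (smulL ℝ) γ g)) := isBasic2_avg2 hβ1 (hγ2.mulForm2 _ _)
  have hout (x : M) (hx : π x ∉ K) (v w : E3) : avg2 (mulForm2 (smulL ℝ) γ g) x v w = 0 := by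
    have e (θ : ℝ) : pull2 θ (mulForm2 (smulL ℝ) γ g) x v w = 0 := by
      have : g (rot θ x) = 0 := by
        by_contra h0
        exact hx (by rw [← hπ.map_smul (Circle.exp θ) x]; exact (hgs h0).2.2)
      simp [pull2, mulForm2, this]
    rw [avg2_apply]
    simp only [e, mean_const]
  have hnn (Ψ : E2 → M) (y : E2) (hl : IsLift π (π m) Ψ y) (θ : ℝ) :
      0 ≤ α m u * pull2 θ (mulForm2 (smulL ℝ) γ g) (Ψ y) (dLift Ψ y e₀) (dLift Ψ y e₁) ∧
      (0 < g (rot θ (Ψ y)) → 0 < α m u * pull2 θ (mulForm2 (smulL ℝ) γ g) (Ψ y)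
        (dLift Ψ y e₀) (dLift Ψ y e₁)) := by
    have e : α m u * pull2 θ (mulForm2 (smulL ℝ) γ g) (Ψ y) (dLift Ψ y e₀) (dLift Ψ y e₁) =
        (α m u * γ (rot θ (Ψ y)) (dRot θ (Ψ y) (dLift Ψ y e₀)) (dRot θ (Ψ y) (dLift Ψ y e₁))) *
          g (rot θ (Ψ y)) := (mul_assoc _ _ _).symm
    have key (h0 : g (rot θ (Ψ y)) ≠ 0) : 0 < α m u * γ (rot θ (Ψ y))
        (dRot θ (Ψ y) (dLift Ψ y e₀)) (dRot θ (Ψ y) (dLift Ψ y e₁)) := by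
      have h1 := (hgs h0).2.1
      rw [show π (rot θ (Ψ y)) = π (Ψ y) from hπ.map_smul _ _] at h1
      exact hγ _ h0 _ _ ((hAR _ _ _).trans (hπ.d0_comp_dLift hH hl h1 _))
        ((hAR _ _ _).trans (hπ.d0_comp_dLift hH hl h1 _))
    rw [e]
    refine ⟨?_, fun h0 => mul_pos (key h0.ne') h0⟩
    by_cases h0 : g (rot θ (Ψ y)) = 0
    · rw [h0, mul_zero]
    · exact mul_nonneg (key h0).le g.nonneg
  have hmean (Ψ : E2 → M) (y : E2) (hl : IsLift π (π m) Ψ y) :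
      α m u * coord π (π m) (avg2 (mulForm2 (smulL ℝ) γ g)) y =
      mean fun θ => α m u * pull2 θ (mulForm2 (smulL ℝ) γ g) (Ψ y) (dLift Ψ y e₀)
        (dLift Ψ y e₁) := by
    rw [coord_eq hπ hR hβ hl, mean_const_mul, avg2_apply]
  have hc : ContinuousOn (fun y => α m u * coord π (π m) (avg2 (mulForm2 (smulL ℝ) γ g)) y)
      (extChartAt (𝓡 2) (π m)).target := continuousOn_const.mul (continuousOn_coord hπ hR hβ _)
  have hint := integrableOn_target hKc hKs hc fun y hy hyK => by
    rw [coord_eq_zero hπ hR hβ hout hy hyK, mul_zero]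
  -- At `θ = 0` the lift sits at `m`, where the bump function is one; the integrand is nonnegative
  -- at all other angles.
  have hpos₀ : 0 < α m u * coord π (π m) (avg2 (mulForm2 (smulL ℝ) γ g)) y₀ := by
    rw [hmean Ψ₀ y₀ hΨ₀.self_of_nhds]
    refine mean_pos (continuous_const.mul (hβ1.continuous_pull2 _ _ _))
      (fun θ => (hnn Ψ₀ y₀ hΨ₀.self_of_nhds θ).1) ((hnn Ψ₀ y₀ hΨ₀.self_of_nhds 0).2 ?_)
    rw [rot_zero, hΨm, g.eq_one]
    exact one_pos
  have h1 : 0 < ∫ y in (extChartAt (𝓡 2) (π m)).target,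
      α m u * coord π (π m) (avg2 (mulForm2 (smulL ℝ) γ g)) y := by
    refine (MeasureTheory.setIntegral_pos_iff_support_of_nonneg_ae
      ((MeasureTheory.ae_restrict_iff' (isOpen_extChartAt_target _).measurableSet).2
        (Eventually.of_forall fun y hy => ?_)) hint).2 ?_
    · obtain ⟨Ψ, -, hl⟩ := hπ.exists_isLift' hy
      change 0 ≤ _
      rw [hmean Ψ y hl.self_of_nhds]
      exact mean_nonneg fun θ => (hnn Ψ y hl.self_of_nhds θ).1
    · refine lt_of_lt_of_le (IsOpen.measure_pos MeasureTheory.volume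
        (hc.isOpen_inter_preimage (isOpen_extChartAt_target _) isOpen_Ioi) ⟨y₀, hy₀, hpos₀⟩)
        (MeasureTheory.measure_mono fun y hy => ⟨(ne_of_gt hy.2 : _ ≠ (0 : ℝ)), hy.1⟩)
  rw [MeasureTheory.integral_const_mul, ← surfaceIntegral_eq_setIntegral hπ hR hS hβ hKc hKs hout,
    h _ g.contMDiff _ hf, mul_zero] at h1
  exact lt_irrefl _ h1

end Nondegenerate

/-! ### The symplectic form and the moment map. -/

section Moment

variable {𝔤 : Type*} [NormedLieRing 𝔤] [NormedLieAlgebra 𝔤] [FiniteDimensional ℝ 𝔤]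
variable {S : Type*} [TopologicalSpace S] [ChartedSpace E2 S] [IsManifold (𝓡 2) ∞ S]
  [T2Space S] [CompactSpace S]
variable {M : Type*} [TopologicalSpace M] [ChartedSpace E3 M] [IsManifold (𝓡 3) ∞ M]
  [MulAction Circle M] {π : M → S}
variable (ε : ℝ) (B : LinearMap.BilinForm ℝ 𝔤)

omit [FiniteDimensional ℝ 𝔤] in
-- Nonvanishing of `R`, which descent to the surface relies on, is read off from `κ(R) = 1`.
theorem genR_ne_zero {l : Triple M 𝔤} (hl : l ∈ connections M 𝔤) (m : M) : genR m ≠ 0 := fun h => by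
  have := hl.1.2.2 m
  rw [h, map_zero] at this
  exact zero_ne_one this

omit [FiniteDimensional ℝ 𝔤] in
theorem smul_add_mem_variations [ContMDiffSMul (𝓡 1) (𝓡 3) ∞ Circle M] {v w : Triple M 𝔤}
    (hv : v ∈ variations M 𝔤) (hw : w ∈ variations M 𝔤) (c : ℝ) : c • v + w ∈ variations M 𝔤 :=
  ⟨⟨(hv.1.1.const_smul c).add hw.1.1, (hv.1.2.1.const_smul c).add hw.1.2.1,
      (hv.1.2.2.const_smul c).add hw.1.2.2⟩,
    ⟨(hv.2.1.1.const_smul c).add hw.2.1.1, (hv.2.1.2.const_smul c).add hw.2.1.2⟩,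
    (hv.2.2.1.const_smul c).add hw.2.2.1, (hv.2.2.2.1.const_smul c).add hw.2.2.2.1,
    (hv.2.2.2.2.const_smul c).add hw.2.2.2.2⟩

theorem formBracket1_mem [ContMDiffSMul (𝓡 1) (𝓡 3) ∞ Circle M] {v : Triple M 𝔤}
    (hv : v ∈ variations M 𝔤) {X : Gauge M 𝔤} (hX : X ∈ gaugeAlgebra M 𝔤) :
    formBracket1 ε B v X ∈ variations M 𝔤 := by
  have hs := isSmoothTriple_of_mem_variations hv
  have hb : IsBasic1 (ε • avg1 (pairForm1 B v.2.1 (lie0 X.2.1))) :=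
    (isBasic1_avg1 (hs.2.1.pairForm1 B (contMDiff_lie0 hX.2.2.1))
      (hv.2.1.2.pairForm1 B _)).const_smul ε
  refine ⟨⟨IsSmoothForm1.zero, fun θ => ?_, fun m => rfl⟩, ⟨IsSmoothForm1.brGauge hs hX, fun m => ?_⟩,
    hb.smooth, hb.invariant, hb.horizontal⟩
  · funext m
    rfl
  · change brGauge v X m (genR m) = 0
    rw [brGauge_apply, hv.2.1.2, hv.1.2.2, isHorizontal1_lie1 hs.2.1 hv.2.1.2]
    simp

/-- The pairing of variations is already skew, so antisymmetrizing doubles it and the factor `1 / 2`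
restores it. -/
theorem Omega_eq [ContMDiffSMul (𝓡 1) (𝓡 3) ∞ Circle M] (hπ : IsPrincipalCircleBundle π)
    (hR : ∀ m : M, genR m ≠ 0) (hBsymm : B.IsSymm) (l : Triple M 𝔤) {v w : Triple M 𝔤}
    (hv : v ∈ variations M 𝔤) (hw : w ∈ variations M 𝔤) :
    Omega ε B π l v w = surfaceIntegral π (extPairWedge ε B v w) := by
  have e : extPairWedge ε B v w - extPairWedge ε B w v = (2 : ℝ) • extPairWedge ε B v w := by
    rw [extPairWedge_swap ε B hBsymm v w]
    module
  rw [Omega, e, surfaceIntegral_const_smul hπ hR (isBasic2_extPairWedge ε B hv hw)]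
  ring

theorem Omega_formBracket1 (hε : ε * ε = 1) (hπ : IsPrincipalCircleBundle π) (hBsymm : B.IsSymm)
    (hBinv : B.lieInvariant 𝔤) {X : Gauge M 𝔤} (hX : X ∈ gaugeAlgebra M 𝔤) {l v w : Triple M 𝔤}
    (hl : l ∈ connections M 𝔤) (hv : v ∈ variations M 𝔤) (hw : w ∈ variations M 𝔤) :
    Omega ε B π l (formBracket1 ε B v X) w + Omega ε B π l v (formBracket1 ε B w X) = 0 := by
  have := hπ.smooth_action
  have hR := genR_ne_zero hl
  have h1 := formBracket1_mem ε B hv hX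
  have h2 := formBracket1_mem ε B hw hX
  have h3 := isBasic2_extPairWedge ε B hv hw
  rw [Omega_eq ε B hπ hR hBsymm l h1 hw, Omega_eq ε B hπ hR hBsymm l hv h2,
    ← surfaceIntegral_add hπ hR (isBasic2_extPairWedge ε B h1 hw) (isBasic2_extPairWedge ε B hv h2),
    extPairWedge_formBracket1 ε B hε hBsymm hBinv hX hv hw,
    ← zero_smul ℝ (extPairWedge ε B v w), surfaceIntegral_const_smul hπ hR h3, zero_mul]

/-- The pairing couples the first component with the third and the middle one with itself.
Variations `g df` in an outer slot detect the opposite component; `g c df` in the middle slot, with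
`c` in `𝔤`, detects `⟨a, c⟩`, and nondegeneracy of `B` concludes. -/
theorem eq_zero_of_Omega (hε : ε ≠ 0) (hπ : IsPrincipalCircleBundle π) [T2Space M]
    (hS : IsOrientedAtlas S) (hBsymm : B.IsSymm) (hBnondeg : B.Nondegenerate) {l v : Triple M 𝔤}
    (hl : l ∈ connections M 𝔤) (hv : v ∈ variations M 𝔤)
    (h : ∀ w ∈ variations M 𝔤, Omega ε B π l v w = 0) : v = 0 := by
  have := hπ.smooth_action
  have hR := genR_ne_zero hl
  have h0 (w : Triple M 𝔤) (hw : w ∈ variations M 𝔤) :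
      surfaceIntegral π (extPairWedge ε B v w) = 0 :=
    (Omega_eq ε B hπ hR hBsymm l hv hw).symm.trans (h w hw)
  have hz : IsBasic1 (0 : Form1 M ℝ) := ⟨IsSmoothForm1.zero, fun _ => rfl, fun _ => rfl⟩
  have hb (f : S → ℝ) (hf : ContMDiff (𝓡 2) 𝓘(ℝ, ℝ) ∞ f) : IsBasic1 (d0 (f ∘ π) : Form1 M ℝ) := by
    have h1 : ContMDiff (𝓡 3) 𝓘(ℝ, ℝ) ∞ (f ∘ π) := hf.comp hπ.smooth
    have h2 (t : Circle) (m : M) : (f ∘ π) (t • m) = (f ∘ π) m := congrArg f (hπ.map_smul t m)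
    exact ⟨isSmoothForm1_d0 h1, isHorizontal1_d0 h1 h2, isInvariant1_d0 h1 h2⟩
  have hba (f : S → ℝ) (hf : ContMDiff (𝓡 2) 𝓘(ℝ, ℝ) ∞ f) (g : M → ℝ)
      (hg : ContMDiff (𝓡 3) 𝓘(ℝ, ℝ) ∞ g) :
      IsBasic1 (mulForm1 (smulL ℝ) (d0 (f ∘ π)) (avg0 g)) :=
    (hb f hf).mul (contMDiff_avg0_and_d0 hg).1 (avg0_smul g)
  have hp0 : avg2 (pairWedge B v.2.1 (0 : Form1 M 𝔤)) = 0 := by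
    have : pairWedge B v.2.1 (0 : Form1 M 𝔤) = (0 : ℝ) • pairWedge B v.2.1 0 := by
      funext m x y
      simp [pairWedge]
    rw [this, avg2_const_smul, zero_smul]
  -- Only basic variations are allowed in the outer slots, so the test function is averaged; against
  -- basic forms this equals averaging the whole two-form.
  have hw (α : Form1 M ℝ) (hα : IsBasic1 α) (f : S → ℝ) (hf : ContMDiff (𝓡 2) 𝓘(ℝ, ℝ) ∞ f)
      (g : M → ℝ) : wedge α (mulForm1 (smulL ℝ) (d0 (f ∘ π)) (avg0 g)) =
      avg2 (mulForm2 (smulL ℝ) (wedge α (d0 (f ∘ π))) g) := by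
    funext m x y
    refine Eq.trans ?_ (avg2_invariant_mul (hα.wedge (hb f hf)).invariant g m x y).symm
    simp only [wedge, mulForm1_apply, smulL_apply, smul_eq_mul]
    ring
  have hsurf (α : Form1 M ℝ) (hα : IsBasic1 α)
      (hα0 : ∀ f : S → ℝ, ContMDiff (𝓡 2) 𝓘(ℝ, ℝ) ∞ f → ∀ g : M → ℝ,
        ContMDiff (𝓡 3) 𝓘(ℝ, ℝ) ∞ g → surfaceIntegral π
          (ε • wedge α (mulForm1 (smulL ℝ) (d0 (f ∘ π)) (avg0 g))) = 0) : α = 0 := by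
    refine hπ.eq_zero_of_surfaceIntegral hR hS hα.smooth hα.horizontal fun g hg f hf => ?_
    have h1 := hα0 f hf g hg
    rw [surfaceIntegral_const_smul hπ hR (hα.wedge (hba f hf g hg)), hw α hα f hf g] at h1
    exact (mul_eq_zero.1 h1).resolve_left hε
  have hwz (α : Form1 M ℝ) : wedge α 0 = 0 := by
    funext m x y
    simp [wedge]
  have hv1 : v.1 = 0 := hsurf v.1 ⟨hv.1.1, hv.1.2.2, hv.1.2.1⟩ fun f hf g hg => by
    have hb' := hba f hf g hg
    have h1 := h0 (0, 0, mulForm1 (smulL ℝ) (d0 (f ∘ π)) (avg0 g))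
      ⟨⟨hz.smooth, hz.invariant, hz.horizontal⟩, ⟨IsSmoothForm1.zero, fun _ => rfl⟩,
        hb'.smooth, hb'.invariant, hb'.horizontal⟩
    rwa [extPairWedge, hp0, hwz, add_zero, zero_add] at h1
  have hv3 : v.2.2 = 0 := hsurf v.2.2 ⟨hv.2.2.1, hv.2.2.2.2, hv.2.2.2.1⟩ fun f hf g hg => by
    have hb' := hba f hf g hg
    have h1 := h0 (mulForm1 (smulL ℝ) (d0 (f ∘ π)) (avg0 g), 0, 0)
      ⟨⟨hb'.smooth, hb'.invariant, hb'.horizontal⟩, ⟨IsSmoothForm1.zero, fun _ => rfl⟩,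
        hz.smooth, hz.invariant, hz.horizontal⟩
    rwa [extPairWedge, hp0, hwz, zero_add, zero_add] at h1
  have hv2 (c : 𝔤) : pairForm1 B v.2.1 (fun _ => c) = 0 := by
    refine hπ.eq_zero_of_surfaceIntegral hR hS (hv.2.1.1.pairForm1 B contMDiff_const)
      (hv.2.1.2.pairForm1 B _) fun g hg f hf => ?_
    have hgc : ContMDiff (𝓡 3) 𝓘(ℝ, 𝔤) ∞ fun m => g m • c :=
      contMDiff_bilin (smulL 𝔤) hg contMDiff_const
    have h1 := h0 (0, mulForm1 (smulL 𝔤) (d0 (f ∘ π)) (fun m => g m • c), 0)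
      ⟨⟨hz.smooth, hz.invariant, hz.horizontal⟩, ⟨(hb f hf).smooth.mulForm1 _ hgc, fun m => by
        rw [mulForm1_apply, (hb f hf).horizontal, map_zero]; rfl⟩,
        hz.smooth, hz.invariant, hz.horizontal⟩
    rw [extPairWedge, hwz, hwz, add_zero, smul_zero, add_zero] at h1
    refine Eq.trans (congrArg (fun β => surfaceIntegral π (avg2 β)) ?_) h1
    funext m x y
    simp only [mulForm2, wedge, pairWedge, pairForm1_apply, mulForm1_apply, smulL_apply,
      LinearMap.BilinForm.smul_right, smul_eq_mul]
    ring
  refine Prod.ext hv1 (Prod.ext ?_ hv3)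
  funext m
  ext1 x
  refine hBnondeg.1 _ fun c => ?_
  exact congrArg (fun α : Form1 M ℝ => α m x) (hv2 c)

theorem isSymplecticForm_Omega (hε : ε ≠ 0) (hπ : IsPrincipalCircleBundle π) [T2Space M]
    (hS : IsOrientedAtlas S) (hBsymm : B.IsSymm) (hBnondeg : B.Nondegenerate) :
    IsSymplecticForm (connections M 𝔤) (variations M 𝔤) (Omega ε B π) := by
  have := hπ.smooth_action
  have hlin {l : Triple M 𝔤} (hl : l ∈ connections M 𝔤) {u v w : Triple M 𝔤}
      (hu : u ∈ variations M 𝔤) (hv : v ∈ variations M 𝔤) (hw : w ∈ variations M 𝔤) (c : ℝ) :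
      Omega ε B π l (c • u + v) w = c * Omega ε B π l u w + Omega ε B π l v w := by
    have hR := genR_ne_zero hl
    have h1 := isBasic2_extPairWedge ε B hu hw
    rw [Omega_eq ε B hπ hR hBsymm l hu hw, Omega_eq ε B hπ hR hBsymm l hv hw,
      Omega_eq ε B hπ hR hBsymm l (smul_add_mem_variations hu hv c) hw,
      extPairWedge_smul_add ε B (isSmoothTriple_of_mem_variations hu)
        (isSmoothTriple_of_mem_variations hv) (isSmoothTriple_of_mem_variations hw),
      surfaceIntegral_add hπ hR (h1.const_smul c) (isBasic2_extPairWedge ε B hv hw),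
      surfaceIntegral_const_smul hπ hR h1]
  refine ⟨fun l hl u hu v hv w hw => ?_, fun l hl c v hv w hw => ?_, fun l hl v hv w hw => ?_,
    fun l hl u hu v hv w hw => ?_, fun l hl v hv h =>
      eq_zero_of_Omega ε B hε hπ hS hBsymm hBnondeg hl hv h⟩
  · have := hlin hl hu hv hw 1
    rwa [one_smul, one_mul] at this
  -- Homogeneity is extracted from the combined rule by writing `c • v` as `(c - 1) • v + v`.
  · have h1 := hlin hl hv hv hw (c - 1)
    have e : (c - 1) • v + v = c • v := by module
    rw [e] at h1
    rw [h1]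
    ring
  · have hR := genR_ne_zero hl
    rw [Omega_eq ε B hπ hR hBsymm l hv hw, Omega_eq ε B hπ hR hBsymm l hw hv,
      extPairWedge_swap ε B hBsymm w v,
      surfaceIntegral_const_smul hπ hR (isBasic2_extPairWedge ε B hw hv), neg_one_mul]
  -- `Omega` does not depend on the base point, so all three derivatives vanish.
  · exact ⟨0, 0, 0, hasDerivAt_const _ _, hasDerivAt_const _ _, hasDerivAt_const _ _, by simp⟩

theorem dualOf_smul_add_right (hπ : IsPrincipalCircleBundle π) (hR : ∀ m : M, genR m ≠ 0)
    {f : Triple2 M 𝔤} (hf : IsCurvatureTriple f) {X Y : Gauge M 𝔤} (hX : X ∈ gaugeAlgebra M 𝔤)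
    (hY : Y ∈ gaugeAlgebra M 𝔤) (c : ℝ) :
    dualOf ε B π f (c • X + Y) = c * dualOf ε B π f X + dualOf ε B π f Y := by
  have := hπ.smooth_action
  have h1 := isBasic2_extPair ε B hf hX
  rw [dualOf, extPair_smul_add_right ε B hf.smooth hX hY, surfaceIntegral_add hπ hR
    (h1.const_smul c) (isBasic2_extPair ε B hf hY), surfaceIntegral_const_smul hπ hR h1]
  rfl

/-- Along a line the moment map is a quadratic polynomial in `t`; its derivative is the linear
coefficient, and no differentiation under the surface integral is needed. -/
theorem dualOf_curvature_add_smul (hπ : IsPrincipalCircleBundle π) (hBsymm : B.IsSymm)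
    {X : Gauge M 𝔤} (hX : X ∈ gaugeAlgebra M 𝔤) {l w : Triple M 𝔤} (hl : l ∈ connections M 𝔤)
    (hw : w ∈ variations M 𝔤) (t : ℝ) : dualOf ε B π (curvature ε B (l + t • w)) X =
      dualOf ε B π (curvature ε B l) X + t * dualOf ε B π (dCurvature ε B l w) X +
        t ^ 2 * dualOf ε B π ((1 / 2 : ℝ) • formBracket2 ε B w w) X := by
  have := hπ.smooth_action
  have hR := genR_ne_zero hl
  have h1 := isCurvatureTriple_curvature ε B hl
  have h2 := isCurvatureTriple_dCurvature ε B hl hw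
  have h3 := isCurvatureTriple_formBracket2 ε B hw
  have b1 := isBasic2_extPair ε B h1 hX
  have b2 := isBasic2_extPair ε B h2 hX
  have b3 := isBasic2_extPair ε B h3 hX
  rw [curvature_add_smul ε B hBsymm (isSmoothTriple_of_mem_connections hl)
    (isSmoothTriple_of_mem_variations hw), ← add_assoc, dualOf,
    extPair_smul_add_left ε B (h1.smooth.add (h2.smooth.const_smul t)) h3.smooth hX,
    extPair_smul_add_left ε B h1.smooth h2.smooth hX,
    surfaceIntegral_add hπ hR (b1.add (b2.const_smul t)) (b3.const_smul _),
    surfaceIntegral_add hπ hR b1 (b2.const_smul t), surfaceIntegral_const_smul hπ hR b2,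
    surfaceIntegral_const_smul hπ hR b3]
  rfl

theorem hasDerivAt_dualOf_curvature (hπ : IsPrincipalCircleBundle π) (hBsymm : B.IsSymm)
    {X : Gauge M 𝔤} (hX : X ∈ gaugeAlgebra M 𝔤) {l w : Triple M 𝔤} (hl : l ∈ connections M 𝔤)
    (hw : w ∈ variations M 𝔤) :
    HasDerivAt (fun t : ℝ => dualOf ε B π (curvature ε B (l + t • w)) X)
      (dualOf ε B π (dCurvature ε B l w) X) 0 := by
  simp only [dualOf_curvature_add_smul ε B hπ hBsymm hX hl hw]
  have h := ((hasDerivAt_id (0 : ℝ)).mul_const (dualOf ε B π (dCurvature ε B l w) X)).const_add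
    (dualOf ε B π (curvature ε B l) X)
  have h' := h.add ((hasDerivAt_pow 2 (0 : ℝ)).mul_const
    (dualOf ε B π ((1 / 2 : ℝ) • formBracket2 ε B w w) X))
  refine h'.congr_deriv ?_
  simp

/-- The two integrands add up to the differential of the basic form `momentForm`, and Stokes'
theorem applies. -/
theorem dualOf_dCurvature (hε : ε * ε = 1) (hπ : IsPrincipalCircleBundle π)
    (hS : IsOrientedAtlas S) (hBsymm : B.IsSymm) (hBinv : B.lieInvariant 𝔤)
    {X : Gauge M 𝔤} (hX : X ∈ gaugeAlgebra M 𝔤) {l w : Triple M 𝔤} (hl : l ∈ connections M 𝔤)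
    (hw : w ∈ variations M 𝔤) :
    dualOf ε B π (dCurvature ε B l w) X = -Omega ε B π l (act ε B X l) w := by
  have := hπ.smooth_action
  have hR := genR_ne_zero hl
  have h1 := act_mem ε B hX hl
  have h2 := isBasic2_extPair ε B (isCurvatureTriple_dCurvature ε B hl hw) hX
  have h3 := isBasic2_extPairWedge ε B h1 hw
  rw [Omega_eq ε B hπ hR hBsymm l h1 hw, dualOf, eq_neg_iff_add_eq_zero,
    ← surfaceIntegral_add hπ hR h2 h3, extPair_dCurvature_add ε B hε hBsymm hBinv hX hl hw,
    surfaceIntegral_d1 hπ hR hS (isBasic1_momentForm ε B hX hw)]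

end Moment

end ExtendedConnection

end

/-! ### The proposition. -/

theorem mainTheorem5
    {𝔤 : Type*} [NormedLieRing 𝔤] [NormedLieAlgebra 𝔤] [FiniteDimensional ℝ 𝔤]
    (B : LinearMap.BilinForm ℝ 𝔤) (hBsymm : B.IsSymm) (hBnondeg : B.Nondegenerate)
    (hBinv : B.lieInvariant 𝔤)
    {S : Type*} [TopologicalSpace S] [ChartedSpace E2 S] [IsManifold (𝓡 2) ∞ S]
    [T2Space S] [CompactSpace S] (hS : IsOrientedAtlas S)
    {M : Type*} [TopologicalSpace M] [ChartedSpace E3 M] [IsManifold (𝓡 3) ∞ M]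
    [T2Space M] [CompactSpace M] [MulAction Circle M]
    (π : M → S) (hπ : IsPrincipalCircleBundle π)
    (ε : ℝ) (hε : ε = 1 ∨ ε = -1) :
    -- the gauge algebra is a Lie algebra in which the last summand is central
    IsLieBracketOn (gaugeAlgebra M 𝔤) (bracket ε B) ∧
    (∀ (y : M → ℝ), ∀ X ∈ gaugeAlgebra M 𝔤, bracket ε B (0, 0, y) X = 0) ∧
    -- it acts on the space of extended connections
    (∀ X ∈ gaugeAlgebra M 𝔤, ∀ l ∈ connections M 𝔤, act ε B X l ∈ variations M 𝔤) ∧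
    (∀ X ∈ gaugeAlgebra M 𝔤, ∀ Y ∈ gaugeAlgebra M 𝔤, ∀ l ∈ connections M 𝔤, ∀ c : ℝ,
      act ε B (c • X + Y) l = c • act ε B X l + act ε B Y l) ∧
    (∀ X ∈ gaugeAlgebra M 𝔤, ∀ Y ∈ gaugeAlgebra M 𝔤, ∀ l ∈ connections M 𝔤,
      fieldDeriv (act ε B Y) l (act ε B X l) - fieldDeriv (act ε B X) l (act ε B Y l) =
        act ε B (bracket ε B X Y) l) ∧
    -- the two-form is symplectic
    IsSymplecticForm (connections M 𝔤) (variations M 𝔤) (Omega ε B π) ∧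
    -- and invariant: its Lie derivative along the vector fields of the action vanishes
    (∀ X ∈ gaugeAlgebra M 𝔤, ∀ l ∈ connections M 𝔤,
      ∀ v ∈ variations M 𝔤, ∀ w ∈ variations M 𝔤, ∃ c : ℝ,
        HasDerivAt (fun t : ℝ => Omega ε B π (l + t • act ε B X l) v w) c 0 ∧
        c + Omega ε B π l (fieldDeriv (act ε B X) l v) w +
          Omega ε B π l v (fieldDeriv (act ε B X) l w) = 0) ∧
    -- the curvature: explicit formula, and it is a triple of smooth horizontal two-forms
    (∀ l ∈ connections M 𝔤,
      curvature ε B l =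
        (d1 l.1,
          curvatureG l.2.1 - smulWedge l.1 (lie1 l.2.1),
          d1 l.2.2 + (ε / 2) • avg2 (pairWedge B l.2.1 (lie1 l.2.1))) ∧
      (IsSmoothForm2 (curvature ε B l).1 ∧ IsHorizontal2 (curvature ε B l).1 ∧
        IsInvariant2 (curvature ε B l).1) ∧
      (IsSmoothForm2 (curvature ε B l).2.1 ∧ IsHorizontal2 (curvature ε B l).2.1) ∧
      (IsSmoothForm2 (curvature ε B l).2.2 ∧ IsHorizontal2 (curvature ε B l).2.2 ∧
        IsInvariant2 (curvature ε B l).2.2)) ∧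
    -- the action is Hamiltonian with moment map the curvature: linearity in the gauge parameter,
    -- the moment map equation, and equivariance
    (∀ l ∈ connections M 𝔤, ∀ X ∈ gaugeAlgebra M 𝔤, ∀ Y ∈ gaugeAlgebra M 𝔤, ∀ c : ℝ,
      dualOf ε B π (curvature ε B l) (c • X + Y) =
        c * dualOf ε B π (curvature ε B l) X + dualOf ε B π (curvature ε B l) Y) ∧
    (∀ X ∈ gaugeAlgebra M 𝔤, ∀ l ∈ connections M 𝔤, ∀ w ∈ variations M 𝔤,
      HasDerivAt (fun t : ℝ => dualOf ε B π (curvature ε B (l + t • w)) X)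
        (-Omega ε B π l (act ε B X l) w) 0) ∧
    (∀ X ∈ gaugeAlgebra M 𝔤, ∀ Y ∈ gaugeAlgebra M 𝔤, ∀ l ∈ connections M 𝔤,
      HasDerivAt (fun t : ℝ => dualOf ε B π (curvature ε B (l + t • act ε B X l)) Y)
        (dualOf ε B π (curvature ε B l) (bracket ε B X Y)) 0) := by
  have := hπ.smooth_action
  have hεε : ε * ε = 1 := by rcases hε with rfl | rfl <;> norm_num
  have hε0 : ε ≠ 0 := by rcases hε with rfl | rfl <;> norm_num
  refine ⟨isLieBracketOn_bracket ε B hBsymm hBinv, fun y X _ => bracket_central ε B y X,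
    fun X hX l hl => act_mem ε B hX hl,
    fun X hX Y hY l hl c => act_linear ε B hX hY (isSmoothTriple_of_mem_connections hl) c,
    fun X hX Y hY l hl => fieldDeriv_act_sub ε B hBsymm hBinv hX hY hl,
    isSymplecticForm_Omega ε B hε0 hπ hS hBsymm hBnondeg,
    fun X hX l hl v hv w hw => ⟨0, hasDerivAt_const _ _, ?_⟩,
    fun l hl => ?_,
    fun l hl X hX Y hY c => dualOf_smul_add_right ε B hπ (genR_ne_zero hl)
      (isCurvatureTriple_curvature ε B hl) hX hY c,
    fun X hX l hl w hw => ?_, fun X hX Y hY l hl => ?_⟩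
  · have hs := isSmoothTriple_of_mem_connections hl
    rw [fieldDeriv_act ε B hX hs (isSmoothTriple_of_mem_variations hv),
      fieldDeriv_act ε B hX hs (isSmoothTriple_of_mem_variations hw), zero_add,
      Omega_formBracket1 ε B hεε hπ hBsymm hBinv hX hl hv hw]
  · have h := isCurvatureTriple_curvature ε B hl
    exact ⟨curvature_eq ε B l, ⟨h.fst.smooth, h.fst.horizontal, h.fst.invariant⟩,
      ⟨h.smooth, h.horizontal⟩, h.snd.smooth, h.snd.horizontal, h.snd.invariant⟩
  · rw [← dualOf_dCurvature ε B hεε hπ hS hBsymm hBinv hX hl hw]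
    exact hasDerivAt_dualOf_curvature ε B hπ hBsymm hX hl hw
  -- Equivariance needs no Stokes' theorem: the integrands on both sides are the same form.
  · have h := hasDerivAt_dualOf_curvature ε B hπ hBsymm hY hl (act_mem ε B hX hl)
    rwa [dualOf, extPair_dCurvature_act ε B hεε hBsymm hBinv hX hY hl] at h
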